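/- Fix integers $G\ge 2$ and $b\ge 2$, a constant $a>0$ and a function $d:\mathbb R\to\mathbb R$. Consider a sequence of models indexed by $m\to\infty$; the numbers of sources $K$, of covariates $p$ and of important variables $s$, the sample sizes, true parameters, tuning parameters and the probability space may all depend on $m$, while $G$, $b$, $a$, $d$ and the constants below do not. **Data.** In batch $u\in[b]$ source $k\in[K]$ yields $\mathcal D_u^{(k)}=\{(y_{u,i}^{(k)},\mathbf x_{u,i}^{(k)})\}_{i\le n_{u,k}}$ with $\mathbf x_{u,i}^{(k)}\in\mathbb R^p$, $y_{u,i}^{(k)}\in\mathbb R$. All observations are independent, and given $\mathbf x=\mathbf x_{u,i}^{(k)}$ the response has density $c(y;\phi^{(k)})\exp\{y\,\mathbf x^\top\beta^{*(k)}-d(\mathbf x^\top\beta^{*(k)})\}$, where $c(y;\phi^{(k)})\exp\{y\theta-d(\theta)\}$ is a probability density for every $\theta\in\mathbb R$. The sources are partitioned into $G$ nonempty subgroups $\mathcal G^{(1)},\dots,\mathcal G^{(G)}$, and $\beta^{*(k)}=\xi^{*(g)}$ for $k\in\mathcal G^{(g)}$. Let $\mathcal B_k$ be the support of $\beta^{*(k)}$,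 $\mathcal A_g$ that of $\xi^{*(g)}$, $s=\max_g|\mathcal A_g|$, $N_{u,k}=\sum_{v\le u}n_{v,k}$, $N_u=\sum_kN_{u,k}$, $N_u^{(g)}=\sum_{k\in\mathcal G^{(g)}}N_{u,k}$, $\bar N_u=\min_gN_u^{(g)}$. For every $u\in[b]$ there are $n_{u,*}\to\infty$ with $n_{u,k}\asymp n_{u,*}$ uniformly in $k$. **Estimators.** Let $\mathcal L(\beta;\mathcal D_u^{(k)})=\sum_i[y_{u,i}^{(k)}\mathbf x_{u,i}^{(k)\top}\beta-d(\mathbf x_{u,i}^{(k)\top}\beta)]$ with Hessian $\mathbf J(\beta;\mathcal D_u^{(k)})$. Given the online estimates $\hat{\mathbf B}_v=(\hat\beta_v^{(1)},\dots,\hat\beta_v^{(K)})$, $v<u$, put $\hat{\mathbf J}^{(k)}_{u-1}=\sum_{v<u}\mathbf J(\hat\beta^{(k)}_v;\mathcal D_v^{(k)})$ (zero for $u=1$) and $$\hat{\mathcal L}_u^{(k)}(\beta)=\tfrac12(\beta-\hat\beta^{(k)}_{u-1})^\top\hat{\mathbf J}^{(k)}_{u-1}(\beta-\hat\beta^{(k)}_{u-1})+\mathcal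 L(\beta;\mathcal D_u^{(k)}),$$ $$\mathcal Q_u^{\rm on}(\mathbf B)=-\frac1{N_u}\sum_k\hat{\mathcal L}_u^{(k)}(\beta^{(k)})+\sum_{k,j}\rho_a(|\beta^{(k)}_j|,\lambda_{1,u})+\sum_{k_1<k_2}\rho_a(\|\beta^{(k_1)}-\beta^{(k_2)}\|_2,\lambda_{2,u}).$$ The oracle estimator $\hat{\mathbf B}_u^{or}$ minimizes $-N_u^{-1}\sum_k\hat{\mathcal L}_u^{(k)}(\beta^{(k)})$ over all $\mathbf B$ with $\beta^{(k_1)}=\beta^{(k_2)}$ for $k_1,k_2$ in the same subgroup and $\beta^{(k)}_{\mathcal B_k^c}=0$; $\hat\Xi_u^{or}=(\hat\xi_u^{or(1)},\dots,\hat\xi_u^{or(G)})$ minimizes $-N_u^{-1}\sum_g\sum_{k\in\mathcal G^{(g)}}\hat{\mathcal L}_u^{(k)}(\xi^{(g)})$ over all $\Xi$ with $\xi^{(g)}_{\mathcal A_g^c}=0$ (both arbitrary where no minimizer exists). The online estimate $\hat{\mathbf B}_u$ is a strict local minimizer of $\mathcal Q_u^{\rm on}$ whenever one exists, and is $\hat{\mathbf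 B}_u^{or}$ whenever $\hat{\mathbf B}_u^{or}$ is an oracle minimizer and a strict local minimizer of $\mathcal Q_u^{\rm on}$. **Conditions** (for all $u\in[b]$, $g\in[G]$, $k\in\mathcal G^{(g)}$; $C_x,c_1,C_1,C_2,C_3,\kappa>0$ constants). $\mathbf X=\mathbf X_u^{(k)}$ is the design matrix, $\mathbf X_{\mathcal A}$ consists of its columns in $\mathcal A$, $\mathbf\Sigma(\varphi)=\mathrm{diag}\{d''(\varphi_i)\}$, $\mathbf d'''(\varphi)=(d'''(\varphi_i))_i$, and $\circ$ is the entrywise product. 1. $\max_{i,j}|\mathbf X_{ij}|\le C_x$ almost surely; and, simultaneously over $u,g,k$ with probability tending to $1$, $\sigma_{\max}[\mathbf X_{\mathcal A_g}^\top\mathbf X_{\mathcal A_g}]\le C_xn_{u,k}$ and Conditions 3 and 5 hold. 2. With $d_1=\min\{|\beta^{*(k)}_j|:k\in[K],j\in\mathcal B_k\}$ and $d_2$ the minimal distance $\|\beta^{*(k_1)}-\beta^{*(k_2)}\|_2$ over $k_1,k_2$ in different subgroups: $d_1>2a\lambda_{1,u}$, $d_2>2a\lambda_{2,u}$, $\lambda_{1,u},\lambda_{2,u}>0$,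 $\lambda_{1,u}\gg\sqrt{[\log(pK)+s]/\bar N_u}$, $\lambda_{2,u}\gg\sqrt{s/\bar N_u}$. 3. For all $\alpha\in\mathbb R^{\mathcal A_g}$ with $\|\alpha-\xi^{*(g)}_{\mathcal A_g}\|_\infty\le d_1/2$ and all $j\in[p]$, the eigenvalues of $\mathbf X_{\mathcal A_g}^\top\mathbf\Sigma(\mathbf X_{\mathcal A_g}\alpha)\mathbf X_{\mathcal A_g}$ lie in $[c_1n_{u,k},C_1n_{u,k}]$, and $\sigma_{\max}[\mathbf X_{\mathcal A_g}^\top\mathrm{diag}\{|\mathbf X_{\cdot j}|\circ\mathbf d'''(\mathbf X_{\mathcal A_g}\alpha)\}\mathbf X_{\mathcal A_g}]\le C_2n_{u,k}$. 4. For every nonzero vector $\eta=(\eta_{k,i})_{k\in\mathcal G^{(g)},\,i\le n_{u,k}}$ and every $\epsilon>0$, $\Pr\big[|\sum_{k\in\mathcal G^{(g)}}\sum_i\eta_{k,i}\{y_{u,i}^{(k)}-d'(\mathbf x_{u,i}^{(k)\top}\xi^{*(g)})\}|<\|\eta\|_2\epsilon\big]>1-2e^{-\kappa\epsilon^2}$.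 5. $\max_{\|v\|_2=1}\|\mathbf X_{\mathcal A_g^c}^\top\mathbf\Sigma(\mathbf X\beta^{*(k)})\mathbf X_{\mathcal A_g}v\|_\infty\le C_3n_{u,k}$. 6. For each $\lambda>0$, $\rho_a(\cdot,\lambda)$ is even, $\rho_a(0,\lambda)=0$, nondecreasing, concave and continuously differentiable on $[0,\infty)$, $\rho_a'(0+,\lambda)=\lambda$, and constant on $|x|\ge a\lambda$ (for example the minimax concave penalty $\int_0^{|x|}(\lambda-t/a)_+\,dt$). **Theorem.** Estimators as above exist, and for all such estimators, as $m\to\infty$: (1) $\max_{g}\|\hat\xi^{or(g)}_{b,\mathcal A_g}-\xi^{*(g)}_{\mathcal A_g}\|_2=O_p(\sqrt{s/\bar N_b})$ and $\max_{k}\|\hat\beta^{or(k)}_{b,\mathcal B_k}-\beta^{*(k)}_{\mathcal B_k}\|_2=O_p(\sqrt{s/\bar N_b})$. (2) With probability tending to $1$, $\hat{\mathbf B}_b^{or}$ is an oracle minimizer, $\hat{\mathbf B}_b$ is a strict local minimizer of $\mathcal Q_b^{\rm on}$, and $\hat{\mathbf B}_b=\hat{\mathbf B}_b^{or}$. -/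

import Mathlib

open MeasureTheory ProbabilityTheory Filter Topology Matrix

universe w

/-- One stage of the triangular array: streaming data from `K` sources with `p` covariates, the
sources being divided into `G` subgroups.  Only data are recorded here; every assumption is
stated separately. Batches are numbered `1, 2, 3, …`. -/
structure StreamModel (G : ℕ) where
  /-- number of covariates -/
  p : ℕ
  /-- number of sources -/
  K : ℕ
  /-- the subgroup a source belongs to -/
  grp : Fin K → Fin G
  /-- `n u k`: sample size of the `u`-th batch from the `k`-th source -/
  n : ℕ → Fin K → ℕ
  /-- true subgroup coefficients -/
  xi : Fin G → Fin p → ℝ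
  /-- dispersion parameters -/
  disp : Fin K → ℝ
  /-- sparsity tuning parameter of each batch -/
  lam1 : ℕ → ℝ
  /-- fusion tuning parameter of each batch -/
  lam2 : ℕ → ℝ
  Ω : Type w
  mΩ : MeasurableSpace Ω
  P : @Measure Ω mΩ
  prob : @IsProbabilityMeasure Ω mΩ P
  /-- covariates -/
  x : (u : ℕ) → (k : Fin K) → Fin (n u k) → Ω → (Fin p → ℝ)
  /-- responses -/
  y : (u : ℕ) → (k : Fin K) → Fin (n u k) → Ω → ℝ

attribute [instance] StreamModel.mΩ StreamModel.prob

noncomputable section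

/-- Euclidean norm of a real vector. -/
def l2 {ι : Type*} [Fintype ι] (v : ι → ℝ) : ℝ := Real.sqrt (∑ j, v j ^ 2)

/-- All eigenvalues of the (symmetric) matrix `M` are at most `C` (Rayleigh quotients). -/
def EigLE {ι : Type*} [Fintype ι] (M : Matrix ι ι ℝ) (C : ℝ) : Prop :=
  ∀ v : ι → ℝ, v ⬝ᵥ (M *ᵥ v) ≤ C * (v ⬝ᵥ v)

/-- All eigenvalues of the (symmetric) matrix `M` are at least `c` (Rayleigh quotients). -/
def EigGE {ι : Type*} [Fintype ι] (M : Matrix ι ι ℝ) (c : ℝ) : Prop :=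
  ∀ v : ι → ℝ, c * (v ⬝ᵥ v) ≤ v ⬝ᵥ (M *ᵥ v)

/-- `‖H‖_{2,∞} ≤ C`, where `‖H‖_{2,∞}` is the largest `‖H v‖_∞` over Euclidean unit vectors. -/
def TwoInfLE {ι κ : Type*} [Fintype κ] (H : Matrix ι κ ℝ) (C : ℝ) : Prop :=
  ∀ v : κ → ℝ, l2 v = 1 → ∀ j, |(H *ᵥ v) j| ≤ C

/-- The Hessian matrix of a function of `p` real variables, by second partial derivatives. -/
def hessianMat {p : ℕ} (f : (Fin p → ℝ) → ℝ) (β : Fin p → ℝ) : Matrix (Fin p) (Fin p) ℝ :=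
  Matrix.of fun j l =>
    lineDeriv ℝ (fun β' => lineDeriv ℝ f β' (Pi.single l 1)) β (Pi.single j 1)

/-- `B` is a strict local minimizer of `F`. -/
def IsStrictLocalMin {E : Type*} [TopologicalSpace E] (F : E → ℝ) (B : E) : Prop :=
  ∀ᶠ B' in 𝓝[≠] B, F B < F B'

/-- `X m = O_p(r m)` as `m → ∞`, each `X m` living on its own probability space. -/
def IsBigOp {Ω : ℕ → Type w} [∀ m, MeasurableSpace (Ω m)] (P : ∀ m, Measure (Ω m))
    (X : ∀ m, Ω m → ℝ) (r : ℕ → ℝ) : Prop :=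
  ∀ ε : ℝ, 0 < ε → ∃ M : ℝ, 0 < M ∧
    ∀ᶠ m in atTop, P m {ω | ¬ (|X m ω| ≤ M * r m)} ≤ ENNReal.ofReal ε

/-- The events `A m` hold with probability tending to one: the complements have (outer) measure
tending to zero. -/
def WithProbTendingToOne {Ω : ℕ → Type w} [∀ m, MeasurableSpace (Ω m)] (P : ∀ m, Measure (Ω m))
    (A : ∀ m, Ω m → Prop) : Prop :=
  Tendsto (fun m => P m {ω | ¬ A m ω}) atTop (𝓝 0)

/-- The member with natural parameter `θ` of the canonical exponential family: density
`c(y; φ) exp(y θ - d(θ))` with respect to the dominating measure `ν`. -/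
def glmLaw (ν : Measure ℝ) (c : ℝ → ℝ → ℝ) (d : ℝ → ℝ) (φ θ : ℝ) : Measure ℝ :=
  ν.withDensity fun y => ENNReal.ofReal (c y φ * Real.exp (y * θ - d θ))

/-- The class of penalties `x ↦ ρ(x, λ)` (for a fixed shape parameter `a`), which contains the
minimax concave penalty `∫_0^{|x|} (λ - t / a)_+ dt`. -/
structure IsPenalty (a : ℝ) (ρ : ℝ → ℝ → ℝ) : Prop where
  symm : ∀ lam, 0 < lam → ∀ x, ρ (-x) lam = ρ x lam
  zero : ∀ lam, 0 < lam → ρ 0 lam = 0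
  mono : ∀ lam, 0 < lam → MonotoneOn (fun x => ρ x lam) (Set.Ici 0)
  concave : ∀ lam, 0 < lam → ConcaveOn ℝ (Set.Ici 0) (fun x => ρ x lam)
  deriv : ∀ lam, 0 < lam → ∃ ρ' : ℝ → ℝ, ContinuousOn ρ' (Set.Ici 0) ∧ ρ' 0 = lam ∧
    ∀ x, 0 ≤ x → HasDerivWithinAt (fun x => ρ x lam) (ρ' x) (Set.Ici 0) x
  const : ∀ lam, 0 < lam → ∀ x, a * lam ≤ |x| → ρ x lam = ρ (a * lam) lam

namespace StreamModel

variable {G : ℕ} (S : StreamModel.{w} G)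

/-! ### Deterministic quantities -/

/-- True coefficients of the `k`-th source. -/
def beta (k : Fin S.K) : Fin S.p → ℝ := S.xi (S.grp k)

/-- Sources in subgroup `g`. -/
def members (g : Fin G) : Finset (Fin S.K) := Finset.univ.filter fun k => S.grp k = g

/-- Support of the true coefficients of subgroup `g`. -/
def A (g : Fin G) : Finset (Fin S.p) := Finset.univ.filter fun j => S.xi g j ≠ 0

/-- Support of the true coefficients of source `k`. -/
def suppB (k : Fin S.K) : Finset (Fin S.p) := Finset.univ.filter fun j => S.beta k j ≠ 0

/-- Largest number of important variables. -/
def s : ℕ := Finset.univ.sup fun g => (S.A g).card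

/-- Cumulative sample size of source `k` up to batch `u`. -/
def Nk (u : ℕ) (k : Fin S.K) : ℕ := ∑ v ∈ Finset.Icc 1 u, S.n v k

/-- Total cumulative sample size up to batch `u`. -/
def N (u : ℕ) : ℕ := ∑ k, S.Nk u k

/-- Cumulative sample size of subgroup `g` up to batch `u`. -/
def Ng (u : ℕ) (g : Fin G) : ℕ := ∑ k ∈ S.members g, S.Nk u k

/-- Smallest cumulative subgroup sample size up to batch `u`. -/
def Nbar (u : ℕ) : ℕ := ⨅ g, S.Ng u g

/-- The rate `√(s / N̄_u)`. -/
def rate (u : ℕ) : ℝ := Real.sqrt ((S.s : ℝ) / (S.Nbar u : ℝ))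

/-- Minimal signal level. -/
def d1 : ℝ := sInf {r | ∃ k, ∃ j ∈ S.A (S.grp k), r = |S.beta k j|}

/-- Minimal Euclidean distance between coefficients of different subgroups. -/
def d2 : ℝ := sInf {r | ∃ k₁ k₂, S.grp k₁ ≠ S.grp k₂ ∧ r = l2 (S.beta k₁ - S.beta k₂)}

/-! ### Likelihood, renewable approximation, objective functions -/

/-- Log-likelihood (up to a constant) of batch `u` from source `k`. -/
def logLik (d : ℝ → ℝ) (u : ℕ) (k : Fin S.K) (ω : S.Ω) (β : Fin S.p → ℝ) : ℝ :=
  ∑ i, (S.y u k i ω * (S.x u k i ω ⬝ᵥ β) - d (S.x u k i ω ⬝ᵥ β))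

/-- Accumulated Hessian of the batches before `u`, batch `v` being evaluated at the estimate
`Bh v` produced when it arrived; it is zero for `u = 1`. -/
def accHess (d : ℝ → ℝ) (Bh : ℕ → Fin S.K → Fin S.p → ℝ) (u : ℕ) (k : Fin S.K) (ω : S.Ω) :
    Matrix (Fin S.p) (Fin S.p) ℝ :=
  ∑ v ∈ Finset.Ico 1 u, hessianMat (S.logLik d v k ω) (Bh v k)

/-- Approximate log-likelihood of the first `u` batches of source `k`: quadratic summary
statistics for the past plus the log-likelihood of the current batch. -/
def approxLik (d : ℝ → ℝ) (Bh : ℕ → Fin S.K → Fin S.p → ℝ) (u : ℕ) (k : Fin S.K) (ω : S.Ω)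
    (β : Fin S.p → ℝ) : ℝ :=
  1 / 2 * ((β - Bh (u - 1) k) ⬝ᵥ (S.accHess d Bh u k ω *ᵥ (β - Bh (u - 1) k)))
    + S.logLik d u k ω β

/-- Unpenalized online loss at batch `u`, as a function of all source coefficients. -/
def loss (d : ℝ → ℝ) (Bh : ℕ → Fin S.K → Fin S.p → ℝ) (u : ℕ) (ω : S.Ω)
    (B : Fin S.K → Fin S.p → ℝ) : ℝ :=
  -(1 / (S.N u : ℝ)) * ∑ k, S.approxLik d Bh u k ω (B k)

/-- Unpenalized online loss at batch `u`, as a function of the subgroup coefficients. -/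
def lossOr (d : ℝ → ℝ) (Bh : ℕ → Fin S.K → Fin S.p → ℝ) (u : ℕ) (ω : S.Ω)
    (Xi : Fin G → Fin S.p → ℝ) : ℝ :=
  -(1 / (S.N u : ℝ)) * ∑ g, ∑ k ∈ S.members g, S.approxLik d Bh u k ω (Xi g)

/-- Penalized online objective at batch `u`. -/
def Qon (d : ℝ → ℝ) (ρ : ℝ → ℝ → ℝ) (Bh : ℕ → Fin S.K → Fin S.p → ℝ) (u : ℕ) (ω : S.Ω)
    (B : Fin S.K → Fin S.p → ℝ) : ℝ :=
  S.loss d Bh u ω B + ∑ k, ∑ j, ρ |B k j| (S.lam1 u)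
    + ∑ k₂, ∑ k₁ ∈ Finset.univ.filter (fun k₁ => k₁ < k₂), ρ (l2 (B k₁ - B k₂)) (S.lam2 u)

/-- Coefficient matrices that are constant on subgroups. -/
def MG : Set (Fin S.K → Fin S.p → ℝ) :=
  {B | ∀ k₁ k₂, S.grp k₁ = S.grp k₂ → B k₁ = B k₂}

/-- Coefficient matrices with the true sparsity pattern. -/
def MB : Set (Fin S.K → Fin S.p → ℝ) := {B | ∀ k, ∀ j ∉ S.suppB k, B k j = 0}

/-- Subgroup coefficient matrices with the true sparsity pattern. -/
def MA : Set (Fin G → Fin S.p → ℝ) := {Xi | ∀ g, ∀ j ∉ S.A g, Xi g j = 0}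

/-- `B` is a subgroup-sparsity-oracle estimate at batch `u`. -/
def IsOracle (d : ℝ → ℝ) (Bh : ℕ → Fin S.K → Fin S.p → ℝ) (u : ℕ) (ω : S.Ω)
    (B : Fin S.K → Fin S.p → ℝ) : Prop :=
  B ∈ S.MG ∩ S.MB ∧ IsMinOn (S.loss d Bh u ω) (S.MG ∩ S.MB) B

/-- `Xi` is a subgroup-sparsity-oracle estimate of the common coefficients at batch `u`. -/
def IsOracleXi (d : ℝ → ℝ) (Bh : ℕ → Fin S.K → Fin S.p → ℝ) (u : ℕ) (ω : S.Ω)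
    (Xi : Fin G → Fin S.p → ℝ) : Prop :=
  Xi ∈ S.MA ∧ IsMinOn (S.lossOr d Bh u ω) S.MA Xi

/-- Estimates computed from the data: online estimates, oracle estimates of the source
coefficients, and oracle estimates of the subgroup coefficients, for every batch. -/
structure Estimates where
  hat : S.Ω → ℕ → Fin S.K → Fin S.p → ℝ
  orB : S.Ω → ℕ → Fin S.K → Fin S.p → ℝ
  orXi : S.Ω → ℕ → Fin G → Fin S.p → ℝ

/-- The renewable estimation scheme for the batches `1, …, b`.  The oracle estimates are minimizers
of the loss over the oracle subspaces whenever minimizers exist.  The online estimate is a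
strict local minimizer of the penalized objective whenever there is one, namely the oracle
estimate if that is a strict local minimizer (the objective is not convex, so that it may have
several local minimizers).  The summary statistics of later batches use the online estimates. -/
structure IsRenewable (d : ℝ → ℝ) (ρ : ℝ → ℝ → ℝ) (b : ℕ) (E : S.Estimates) : Prop where
  oracle : ∀ ω, ∀ u ∈ Finset.Icc 1 b, (∃ B, S.IsOracle d (E.hat ω) u ω B) →
    S.IsOracle d (E.hat ω) u ω (E.orB ω u)
  oracleXi : ∀ ω, ∀ u ∈ Finset.Icc 1 b, (∃ Xi, S.IsOracleXi d (E.hat ω) u ω Xi) →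
    S.IsOracleXi d (E.hat ω) u ω (E.orXi ω u)
  locMin : ∀ ω, ∀ u ∈ Finset.Icc 1 b,
    (∃ B, IsStrictLocalMin (S.Qon d ρ (E.hat ω) u ω) B) →
      IsStrictLocalMin (S.Qon d ρ (E.hat ω) u ω) (E.hat ω u)
  select : ∀ ω, ∀ u ∈ Finset.Icc 1 b, S.IsOracle d (E.hat ω) u ω (E.orB ω u) →
    IsStrictLocalMin (S.Qon d ρ (E.hat ω) u ω) (E.orB ω u) → E.hat ω u = E.orB ω u

/-- `max_g ‖ξ̂^{or(g)}_{u,A_g} - ξ*^{(g)}_{A_g}‖₂`. -/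
def errXi (E : S.Estimates) (u : ℕ) (ω : S.Ω) : ℝ :=
  ⨆ g, l2 fun j : S.A g => E.orXi ω u g j - S.xi g j

/-- `max_k ‖β̂^{or(k)}_{u,B_k} - β*^{(k)}_{B_k}‖₂`. -/
def errB (E : S.Estimates) (u : ℕ) (ω : S.Ω) : ℝ :=
  ⨆ k, l2 fun j : S.suppB k => E.orB ω u k j - S.beta k j

/-! ### Assumptions -/

/-- The observations are independent, and given `x` the response of source `k` follows the
exponential family with natural parameter `xᵀ β*^{(k)}`. -/
structure IsModel (ν : Measure ℝ) (c : ℝ → ℝ → ℝ) (d : ℝ → ℝ) (b : ℕ) : Prop where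
  meas_x : ∀ u ∈ Finset.Icc 1 b, ∀ k i, Measurable (S.x u k i)
  meas_y : ∀ u ∈ Finset.Icc 1 b, ∀ k i, Measurable (S.y u k i)
  indep : iIndepFun
    (fun (q : (u : Finset.Icc 1 b) × (k : Fin S.K) × Fin (S.n u k)) (ω : S.Ω) =>
      (S.x q.1 q.2.1 q.2.2 ω, S.y q.1 q.2.1 q.2.2 ω)) S.P
  law : ∀ u ∈ Finset.Icc 1 b, ∀ k i, ∀ᵐ v ∂(S.P.map (S.x u k i)),
    condDistrib (S.y u k i) (S.x u k i) S.P v = glmLaw ν c d (S.disp k) (v ⬝ᵥ S.beta k)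

/-- The design matrix restricted to the important variables of subgroup `g`. -/
def XA (u : ℕ) (k : Fin S.K) (g : Fin G) (ω : S.Ω) : Matrix (Fin (S.n u k)) (S.A g) ℝ :=
  Matrix.of fun i j => S.x u k i ω j

/-- The design matrix restricted to the unimportant variables of subgroup `g`. -/
def XAc (u : ℕ) (k : Fin S.K) (g : Fin G) (ω : S.Ω) :
    Matrix (Fin (S.n u k)) {j // j ∉ S.A g} ℝ :=
  Matrix.of fun i j => S.x u k i ω j

/-- The neighborhood of the true nonzero coefficients of subgroup `g`. -/
def nbhd (g : Fin G) : Set (S.A g → ℝ) := {α | ∀ j, |α j - S.xi g j| ≤ S.d1 / 2}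

/-- Covariates are bounded by `Cx`. -/
def BoundedCov (Cx : ℝ) (b : ℕ) (ω : S.Ω) : Prop :=
  ∀ u ∈ Finset.Icc 1 b, ∀ k i j, |S.x u k i ω j| ≤ Cx

/-- Regularity of the (realized) design matrices. -/
structure RegularDesign (d : ℝ → ℝ) (Cx c1 C1 C2 C3 : ℝ) (b : ℕ) (ω : S.Ω) : Prop where
  gram : ∀ u ∈ Finset.Icc 1 b, ∀ g, ∀ k ∈ S.members g,
    EigLE ((S.XA u k g ω)ᵀ * S.XA u k g ω) (Cx * S.n u k)
  eigMin : ∀ u ∈ Finset.Icc 1 b, ∀ g, ∀ k ∈ S.members g, ∀ α ∈ S.nbhd g,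
    EigGE ((S.XA u k g ω)ᵀ *
      Matrix.diagonal (fun i => iteratedDeriv 2 d ((S.XA u k g ω *ᵥ α) i)) * S.XA u k g ω)
      (c1 * S.n u k)
  eigMax : ∀ u ∈ Finset.Icc 1 b, ∀ g, ∀ k ∈ S.members g, ∀ α ∈ S.nbhd g,
    EigLE ((S.XA u k g ω)ᵀ *
      Matrix.diagonal (fun i => iteratedDeriv 2 d ((S.XA u k g ω *ᵥ α) i)) * S.XA u k g ω)
      (C1 * S.n u k)
  third : ∀ u ∈ Finset.Icc 1 b, ∀ g, ∀ k ∈ S.members g, ∀ α ∈ S.nbhd g, ∀ j : Fin S.p,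
    EigLE ((S.XA u k g ω)ᵀ *
      Matrix.diagonal (fun i => |S.x u k i ω j| * iteratedDeriv 3 d ((S.XA u k g ω *ᵥ α) i)) *
        S.XA u k g ω)
      (C2 * S.n u k)
  cross : ∀ u ∈ Finset.Icc 1 b, ∀ g, ∀ k ∈ S.members g,
    TwoInfLE ((S.XAc u k g ω)ᵀ *
      Matrix.diagonal (fun i => iteratedDeriv 2 d (S.x u k i ω ⬝ᵥ S.beta k)) * S.XA u k g ω)
      (C3 * S.n u k)

/-- Sub-Gaussian tails of linear combinations of the errors of a subgroup in a batch. -/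
def SubGaussianErrors (d : ℝ → ℝ) (κ : ℝ) (b : ℕ) : Prop :=
  ∀ u ∈ Finset.Icc 1 b, ∀ g, ∀ η : (k : Fin S.K) → Fin (S.n u k) → ℝ,
    (∃ k ∈ S.members g, ∃ i, η k i ≠ 0) → ∀ ε : ℝ, 0 < ε →
      1 - 2 * Real.exp (-(κ * ε ^ 2)) <
        S.P.real {ω | |∑ k ∈ S.members g, ∑ i,
            η k i * (S.y u k i ω - deriv d (S.x u k i ω ⬝ᵥ S.xi g))| <
          Real.sqrt (∑ k ∈ S.members g, ∑ i, η k i ^ 2) * ε}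

end StreamModel

end

/-!
The online estimates coincide, batch after batch, with oracle estimates, for which the problem is a
smooth convex one in at most `G * s` unknowns.

*Good samples.* Integrating the exponential family density to one makes `d` the cumulant generating
function of a finite-exponential-moment measure, so that `d` is smooth and convex, and the errors
`y - d'(xᵀβ*)` are centered given the covariates.  The sub-Gaussian tails and bounded covariates
then make all score coordinates sub-Gaussian (`SubGaussianErrors.hasSubgaussianMGF_score`).  A union
bound over the `p K` score coordinates gives the order `√(n (log (p K) + s))`, and second moments
give the order `√(s N)` for the Euclidean norms of the scores on the important variables.  The
tails also bound the variance function: the conditional law at a natural parameter near the true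
one is a tilt of the true law, so that Jensen's inequality yields an exponential moment of
`varSup d (xᵀβ*)`, the maximum of `d''` within distance one of the true natural parameter
(`exp_deriv2_glm_le`).  Its sums over batches have the order `n + log (p K) + s`.  All these bounds
hold together with a constant `M` outside an event of small probability
(`exists_measure_not_goodSample_le`).

*One batch.* Let the previous estimates be supported on the important variables and have rate
`√(s / N_g)`.  Then the gradient of the subgroup loss at the truth is of order `√(s N_g)`, while
the loss is strongly convex near the truth.  It exceeds its central value on a sphere whose radius
is a large multiple of the rate, so that its minimizer exists, is unique and lies inside
(`GoodSample.exists_isGroupMin`).  At this oracle estimate the penalty is flat in the important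
coefficients and in the differences between subgroups, by the minimal signal conditions; at
zero it has slopes `λ₁` and `λ₂`.  Strict local minimality therefore follows from gradients that are
small relative to `N λ₁` along unimportant variables and to `N λ₂` along important ones.  Along the
important variables the gradients of a subgroup add up to zero, so that each source can be compared
with the first one of its subgroup (`sum_grad_ge`, `isStrictLocalMin_of_oracle`).  Along an
unimportant variable the Hessian couples to the important ones; by the Cauchy–Schwarz inequality the
coupling is at most the square root of the sum of `d''` times that of the quadratic form, and the
sum of `d''` is controlled by `varSup` where the linear predictor moves by at most one and by the
quadratic form elsewhere (`sum_deriv2_le`, `GoodSample.abs_grad_single_le`).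

*All batches.* The selection rule makes the online estimate equal to the oracle estimate, which
restores the induction hypothesis with a larger rate constant (`exists_oracleHolds`).  As `b` is
fixed, the final constants do not depend on the stage of the array, and the growth conditions on the
tuning parameters absorb them.
-/

noncomputable section

/-! ### Canonical exponential families -/

/-- The dominating measure of the exponential family with dispersion `φ`, namely the measure with
density `c(·; φ)` with respect to `ν`; the function `d` is its cumulant generating function. -/
def glmBase (ν : Measure ℝ) (c : ℝ → ℝ → ℝ) (φ : ℝ) : Measure ℝ :=
  ν.withDensity fun y => ENNReal.ofReal (c y φ)

/-- The largest value of `d''` within distance one of `θ`. -/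
def varSup (d : ℝ → ℝ) (θ : ℝ) : ℝ :=
  sSup ((fun w => iteratedDeriv 2 d (θ + w)) '' Set.Icc (-1) 1)

section GLM

variable {ν : Measure ℝ} {c : ℝ → ℝ → ℝ} {d : ℝ → ℝ} {φ : ℝ}

theorem lintegral_glmLaw (hc : ∀ y φ, 0 ≤ c y φ) (hm : ∀ φ, Measurable fun y => c y φ) (θ : ℝ)
    {f : ℝ → ENNReal} (hf : Measurable f) :
    ∫⁻ y, f y ∂(glmLaw ν c d φ θ) =
      ∫⁻ y, ENNReal.ofReal (Real.exp (y * θ - d θ)) * f y ∂(glmBase ν c φ) := by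
  have h1 : Measurable fun y => ENNReal.ofReal (c y φ) := (hm φ).ennreal_ofReal
  rw [glmLaw, glmBase, lintegral_withDensity_eq_lintegral_mul _ _ hf,
    lintegral_withDensity_eq_lintegral_mul _ h1 (by fun_prop)]
  · refine lintegral_congr fun y => ?_
    simp only [Pi.mul_apply]
    rw [ENNReal.ofReal_mul (hc _ _), mul_assoc]
  · exact ((hm φ).mul (by fun_prop)).ennreal_ofReal

variable (hc : ∀ y φ, 0 ≤ c y φ) (hm : ∀ φ, Measurable fun y => c y φ)
  (hp : ∀ θ, IsProbabilityMeasure (glmLaw ν c d φ θ))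

include hc hm hp

theorem lintegral_exp_glmBase (θ : ℝ) :
    ∫⁻ y, ENNReal.ofReal (Real.exp (θ * y)) ∂(glmBase ν c φ) = ENNReal.ofReal (Real.exp (d θ)) := by
  have h := lintegral_glmLaw (ν := ν) (d := d) (φ := φ) hc hm θ
    (f := fun _ => ENNReal.ofReal (Real.exp (d θ))) measurable_const
  have := hp θ
  rw [lintegral_const, measure_univ, mul_one] at h
  rw [h]
  refine lintegral_congr fun y => ?_
  rw [← ENNReal.ofReal_mul (Real.exp_pos _).le, ← Real.exp_add]
  ring_nf

theorem integrable_exp_glmBase (θ : ℝ) :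
    Integrable (fun y => Real.exp (θ * id y)) (glmBase ν c φ) := by
  refine ⟨by fun_prop, ?_⟩
  rw [hasFiniteIntegral_iff_ofReal (.of_forall fun y => (Real.exp_pos _).le)]
  simp only [id]
  rw [lintegral_exp_glmBase hc hm hp]
  exact ENNReal.ofReal_lt_top

theorem mgf_glmBase (θ : ℝ) : mgf id (glmBase ν c φ) θ = Real.exp (d θ) := by
  rw [mgf, integral_eq_lintegral_of_nonneg_ae (.of_forall fun y => (Real.exp_pos _).le)
    (by fun_prop)]
  simp only [id]
  rw [lintegral_exp_glmBase hc hm hp, ENNReal.toReal_ofReal (Real.exp_pos _).le]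

theorem cgf_glmBase : cgf id (glmBase ν c φ) = d := by
  ext θ
  rw [cgf, mgf_glmBase hc hm hp, Real.log_exp]

theorem glmLaw_eq_tilted (θ : ℝ) :
    glmLaw ν c d φ θ = (glmBase ν c φ).tilted (fun y => θ * id y) := by
  ext s hs
  have h := lintegral_glmLaw (ν := ν) (d := d) (φ := φ) hc hm θ
    (f := s.indicator 1) (measurable_one.indicator hs)
  rw [lintegral_indicator_one hs] at h
  rw [h, tilted_mul_apply_cgf' hs (integrable_exp_glmBase hc hm hp θ), cgf_glmBase hc hm hp,
    ← lintegral_indicator hs]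
  refine lintegral_congr fun y => ?_
  by_cases hy : y ∈ s <;> simp [hy, mul_comm]

theorem mem_interior_glmBase (θ : ℝ) : θ ∈ interior (integrableExpSet id (glmBase ν c φ)) := by
  have : integrableExpSet id (glmBase ν c φ) = Set.univ := by
    ext t; simpa [integrableExpSet] using integrable_exp_glmBase hc hm hp t
  simp [this]

theorem contDiff_glm {n : WithTop ℕ∞} : ContDiff ℝ n d := by
  rw [← cgf_glmBase hc hm hp, ← contDiffOn_univ]
  have h : AnalyticOnNhd ℝ (cgf id (glmBase ν c φ)) Set.univ :=
    fun θ _ => analyticAt_cgf (mem_interior_glmBase hc hm hp θ)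
  exact h.contDiffOn uniqueDiffOn_univ

theorem differentiable_glm : Differentiable ℝ d :=
  (contDiff_glm hc hm hp (n := 1)).differentiable one_ne_zero

theorem hasDerivAt_deriv_glm (θ : ℝ) : HasDerivAt (deriv d) (iteratedDeriv 2 d θ) θ := by
  have h : ContDiff ℝ 1 (deriv d) :=
    ((contDiff_succ_iff_deriv (n := 1)).1 (contDiff_glm hc hm hp (n := 1 + 1))).2.2
  rw [iteratedDeriv_succ, iteratedDeriv_one]
  exact (h.differentiable one_ne_zero θ).hasDerivAt

theorem continuous_deriv_glm : Continuous (deriv d) :=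
  continuous_iff_continuousAt.2 fun θ => (hasDerivAt_deriv_glm hc hm hp θ).continuousAt

theorem continuous_deriv2_glm : Continuous (iteratedDeriv 2 d) :=
  (contDiff_glm hc hm hp (n := 2)).continuous_iteratedDeriv 2 le_rfl

theorem memLp_id_glmLaw (θ : ℝ) (p : NNReal) : MemLp id p (glmLaw ν c d φ θ) := by
  rw [glmLaw_eq_tilted hc hm hp]
  exact memLp_tilted_mul (mem_interior_glmBase hc hm hp θ) p

theorem integral_glmLaw (θ : ℝ) : ∫ y, y ∂(glmLaw ν c d φ θ) = deriv d θ := by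
  rw [glmLaw_eq_tilted hc hm hp]
  have := integral_tilted_mul_self (mem_interior_glmBase hc hm hp θ)
  rwa [cgf_glmBase hc hm hp] at this

theorem variance_glmLaw (θ : ℝ) : Var[id; glmLaw ν c d φ θ] = iteratedDeriv 2 d θ := by
  rw [glmLaw_eq_tilted hc hm hp]
  have := variance_tilted_mul (mem_interior_glmBase hc hm hp θ)
  rwa [cgf_glmBase hc hm hp] at this

theorem deriv2_glm_nonneg (θ : ℝ) : 0 ≤ iteratedDeriv 2 d θ := by
  rw [← variance_glmLaw hc hm hp θ]
  exact variance_nonneg _ _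

theorem convexOn_glm : ConvexOn ℝ Set.univ d := by
  refine convexOn_univ_of_deriv2_nonneg (differentiable_glm hc hm hp)
    (fun θ => (hasDerivAt_deriv_glm hc hm hp θ).differentiableAt) fun θ => ?_
  rw [← iteratedDeriv_eq_iterate]
  exact deriv2_glm_nonneg hc hm hp θ

/-- The tangent inequality for the cumulant function. -/
theorem glm_tangent (θ w : ℝ) : d θ + deriv d θ * w ≤ d (θ + w) := by
  have hd := differentiable_glm hc hm hp θ
  rcases lt_trichotomy w 0 with h | h | h
  · have := (convexOn_glm hc hm hp).slope_le_of_hasDerivAt (x := θ + w) (y := θ) trivial trivial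
      (by linarith) hd.hasDerivAt
    rw [slope_def_field, div_le_iff₀ (by linarith)] at this
    linarith
  · simp [h]
  · have := (convexOn_glm hc hm hp).le_slope_of_hasDerivAt (x := θ) (y := θ + w) trivial trivial
      (by linarith) hd.hasDerivAt
    rw [slope_def_field, le_div_iff₀ (by linarith)] at this
    linarith

/-- By Jensen's inequality an exponential moment of the squared error bounds the exponential of
the variance function, even at natural parameters within distance one: the change of measure costs
a factor `exp (w (y - d' θ))`, which is absorbed by the square. -/
theorem exp_deriv2_glm_le {κ : ℝ} (hκ : 0 < κ) {θ w : ℝ} (hw : |w| ≤ 1) :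
    ENNReal.ofReal (Real.exp (κ / 4 * iteratedDeriv 2 d (θ + w))) ≤
      ENNReal.ofReal (Real.exp (1 / κ)) *
        ∫⁻ y, ENNReal.ofReal (Real.exp (κ / 2 * (y - deriv d θ) ^ 2)) ∂(glmLaw ν c d φ θ) := by
  have hpw := hp (θ + w)
  set m := deriv d θ with hmdef
  -- the change of measure from `θ + w` to `θ`
  have h1 : ∫⁻ y, ENNReal.ofReal (Real.exp (κ / 4 * (y - m) ^ 2)) ∂(glmLaw ν c d φ (θ + w)) ≤
      ENNReal.ofReal (Real.exp (1 / κ)) *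
        ∫⁻ y, ENNReal.ofReal (Real.exp (κ / 2 * (y - m) ^ 2)) ∂(glmLaw ν c d φ θ) := by
    rw [lintegral_glmLaw hc hm _ (by fun_prop), lintegral_glmLaw hc hm _ (by fun_prop),
      ← lintegral_const_mul _ (by fun_prop)]
    refine lintegral_mono fun y => ?_
    simp only [← ENNReal.ofReal_mul (Real.exp_pos _).le, ← Real.exp_add]
    refine ENNReal.ofReal_le_ofReal (Real.exp_le_exp.2 ?_)
    have ht := glm_tangent hc hm hp θ w
    have h2 : w * (y - m) ≤ κ / 4 * (y - m) ^ 2 + 1 / κ := by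
      have h3 : w * (y - m) ≤ |y - m| := by
        calc w * (y - m) ≤ |w * (y - m)| := le_abs_self _
          _ = |w| * |y - m| := abs_mul _ _
          _ ≤ 1 * |y - m| := by gcongr
          _ = _ := one_mul _
      have h4 : |y - m| ≤ κ / 4 * |y - m| ^ 2 + 1 / κ := by
        have : 0 ≤ (κ / 2 * |y - m| - 1) ^ 2 / κ := by positivity
        have e : (κ / 2 * |y - m| - 1) ^ 2 / κ = κ / 4 * |y - m| ^ 2 + 1 / κ - |y - m| := by
          field_simp; ring
        linarith
      rw [sq_abs] at h4; linarith
    nlinarith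
  refine le_trans ?_ h1
  by_cases hfin : ∫⁻ y, ENNReal.ofReal (Real.exp (κ / 4 * (y - m) ^ 2)) ∂(glmLaw ν c d φ (θ + w)) = ⊤
  · rw [hfin]; exact le_top
  have hint : Integrable (fun y => Real.exp (κ / 4 * (y - m) ^ 2)) (glmLaw ν c d φ (θ + w)) := by
    refine ⟨by fun_prop, ?_⟩
    rw [hasFiniteIntegral_iff_ofReal (.of_forall fun y => (Real.exp_pos _).le)]
    exact lt_top_iff_ne_top.2 hfin
  rw [← ofReal_integral_eq_lintegral_ofReal hint (.of_forall fun y => (Real.exp_pos _).le)]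
  refine ENNReal.ofReal_le_ofReal ?_
  have hL2 : MemLp (fun y : ℝ => y - m) 2 (glmLaw ν c d φ (θ + w)) :=
    (memLp_id_glmLaw hc hm hp (θ + w) 2).sub (memLp_const m)
  have hI2 : Integrable (fun y : ℝ => κ / 4 * (y - m) ^ 2) (glmLaw ν c d φ (θ + w)) :=
    hL2.integrable_sq.const_mul _
  have hJ := convexOn_exp.map_integral_le (μ := glmLaw ν c d φ (θ + w))
    (f := fun y => κ / 4 * (y - m) ^ 2) Real.continuous_exp.continuousOn isClosed_univ
    (by simp) hI2 hint
  refine le_trans (Real.exp_le_exp.2 ?_) hJ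
  rw [integral_const_mul]
  gcongr
  rw [← variance_glmLaw hc hm hp (θ + w)]
  have hv : Var[id; glmLaw ν c d φ (θ + w)] = Var[fun y => y - m; glmLaw ν c d φ (θ + w)] := by
    have := variance_sub_const (μ := glmLaw ν c d φ (θ + w)) (X := id) (by fun_prop) m
    simpa using this.symm
  rw [hv]
  exact variance_le_expectation_sq (by fun_prop)

theorem continuous_varSup : Continuous (varSup d) := by
  have h := continuous_deriv2_glm hc hm hp
  exact isCompact_Icc.continuous_sSup (f := fun θ w => iteratedDeriv 2 d (θ + w)) (by fun_prop)

theorem deriv2_le_varSup {θ w : ℝ} (hw : |w| ≤ 1) : iteratedDeriv 2 d (θ + w) ≤ varSup d θ := by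
  have h := continuous_deriv2_glm hc hm hp
  refine le_csSup (isCompact_Icc.image (by fun_prop)).bddAbove ⟨w, abs_le.1 hw, rfl⟩

theorem exp_varSup_le {κ : ℝ} (hκ : 0 < κ) (θ : ℝ) :
    ENNReal.ofReal (Real.exp (κ / 4 * varSup d θ)) ≤
      ENNReal.ofReal (Real.exp (1 / κ)) *
        ∫⁻ y, ENNReal.ofReal (Real.exp (κ / 2 * (y - deriv d θ) ^ 2)) ∂(glmLaw ν c d φ θ) := by
  have h := continuous_deriv2_glm hc hm hp
  obtain ⟨w, hw, e, -⟩ := isCompact_Icc.exists_sSup_image_eq_and_ge (s := Set.Icc (-1 : ℝ) 1)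
    ⟨0, by simp⟩ (f := fun w => iteratedDeriv 2 d (θ + w)) (by fun_prop)
  rw [varSup, e]
  exact exp_deriv2_glm_le hc hm hp hκ (abs_le.2 hw)

end GLM

/-! ### Sub-Gaussian tails, moment generating functions and second moments -/

theorem exp_le_add_exp_sq (x : ℝ) : Real.exp x ≤ x + Real.exp (x ^ 2) := by
  have h2 := Real.add_one_le_exp (x ^ 2)
  rcases le_or_gt |x| 1 with h | h
  · have := (abs_le.1 (Real.abs_exp_sub_one_sub_id_le h)).2
    linarith
  · rcases lt_abs.1 h with h | h
    · have : Real.exp x ≤ Real.exp (x ^ 2) := Real.exp_le_exp.2 (by nlinarith)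
      linarith
    · have : Real.exp x ≤ 1 := Real.exp_le_one_iff.2 (by linarith)
      nlinarith

/-- For `0 ≤ t ≤ 1` the chord of `exp` over `[0, u]` lies above its graph. -/
theorem exp_mul_le_chord {t u : ℝ} (h0 : 0 ≤ t) (h1 : t ≤ 1) :
    Real.exp (t * u) ≤ 1 + t * (Real.exp u - 1) := by
  have := convexOn_exp.2 (Set.mem_univ 0) (Set.mem_univ u) (sub_nonneg.2 h1) h0 (by ring)
  simp only [smul_eq_mul, mul_zero, zero_add, Real.exp_zero, mul_one] at this
  linarith

section

variable {Ω : Type*} [MeasurableSpace Ω] {μ : Measure Ω} [IsProbabilityMeasure μ]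

/-- A sub-Gaussian tail bound gives an exponential moment of the square. -/
theorem lintegral_exp_sq_le_of_tail {e : Ω → ℝ} (he : Measurable e) {κ : ℝ} (hκ : 0 < κ)
    (h : ∀ ε : ℝ, 0 < ε → μ {ω | ε ≤ |e ω|} ≤ ENNReal.ofReal (2 * Real.exp (-(κ * ε ^ 2)))) :
    ∫⁻ ω, ENNReal.ofReal (Real.exp (κ / 2 * e ω ^ 2)) ∂μ ≤ 3 := by
  have hl := lintegral_comp_eq_lintegral_meas_le_mul μ (f := fun ω => κ / 2 * e ω ^ 2)
    (g := Real.exp) (.of_forall fun ω => by positivity) (by fun_prop)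
    (fun t _ => Real.continuous_exp.intervalIntegrable _ _)
    (.of_forall fun t => (Real.exp_pos _).le)
  have h2 : ∫⁻ t in Set.Ioi 0, μ {ω | t ≤ κ / 2 * e ω ^ 2} * ENNReal.ofReal (Real.exp t) ≤ 2 := by
    calc _ ≤ ∫⁻ t in Set.Ioi 0, ENNReal.ofReal (2 * Real.exp (-t)) := by
          refine setLIntegral_mono (by fun_prop) fun t ht => ?_
          have ht : 0 < t := ht
          have hs : {ω | t ≤ κ / 2 * e ω ^ 2} ⊆ {ω | Real.sqrt (2 * t / κ) ≤ |e ω|} := by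
            intro ω (hω : t ≤ κ / 2 * e ω ^ 2)
            refine Real.sqrt_le_iff.2 ⟨abs_nonneg _, ?_⟩
            rw [sq_abs, div_le_iff₀ hκ]; linarith
          refine (mul_le_mul_left ((measure_mono hs).trans (h _ (by positivity))) _).trans ?_
          rw [← ENNReal.ofReal_mul (by positivity), Real.sq_sqrt (by positivity), mul_assoc,
            ← Real.exp_add]
          refine ENNReal.ofReal_le_ofReal (le_of_eq ?_)
          congr 2
          field_simp
          ring
      _ = 2 := by
          rw [← ofReal_integral_eq_lintegral_ofReal, integral_const_mul,
            integral_exp_neg_Ioi_zero]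
          · simp
          · exact (integrableOn_exp_neg_Ioi 0).const_mul 2
          · exact .of_forall fun t => by positivity
  calc ∫⁻ ω, ENNReal.ofReal (Real.exp (κ / 2 * e ω ^ 2)) ∂μ
      = ∫⁻ ω, (ENNReal.ofReal (∫ t in (0:ℝ)..κ / 2 * e ω ^ 2, Real.exp t) + 1) ∂μ := by
        refine lintegral_congr fun ω => ?_
        rw [integral_exp, Real.exp_zero, ← ENNReal.ofReal_one, ← ENNReal.ofReal_add]
        · simp
        · have := Real.one_le_exp (x := κ / 2 * e ω ^ 2) (by positivity); linarith
        · norm_num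
    _ ≤ 2 + 1 := by
        rw [lintegral_add_right _ measurable_const, hl]
        simpa using h2
    _ = 3 := by norm_num

/-- A centered variable whose square has an exponential moment is sub-Gaussian. -/
theorem hasSubgaussianMGF_of_exp_sq {z : Ω → ℝ} (hz : Measurable z) {A : NNReal} (hA : 0 < A)
    (h : ∫⁻ ω, ENNReal.ofReal (Real.exp (z ω ^ 2 / A)) ∂μ ≤ 3) (h0 : ∫ ω, z ω ∂μ = 0) :
    HasSubgaussianMGF z (4 * A) μ := by
  have hA' : (0 : ℝ) < A := hA
  have hI : Integrable (fun ω => Real.exp (z ω ^ 2 / A)) μ := by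
    refine ⟨by fun_prop, ?_⟩
    rw [hasFiniteIntegral_iff_ofReal (.of_forall fun y => (Real.exp_pos _).le)]
    exact h.trans_lt (by norm_num)
  have h3 : ∫ ω, Real.exp (z ω ^ 2 / A) ∂μ ≤ 3 := by
    rw [integral_eq_lintegral_of_nonneg_ae (.of_forall fun y => (Real.exp_pos _).le) (by fun_prop)]
    exact ENNReal.toReal_le_of_le_ofReal (by norm_num) (by simpa using h)
  have hb : ∀ t x : ℝ, Real.exp (t * x) ≤ Real.exp (t ^ 2 * A / 2) * Real.exp (x ^ 2 / A) := by
    intro t x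
    rw [← Real.exp_add]
    refine Real.exp_le_exp.2 ?_
    have e : t ^ 2 * A / 2 + x ^ 2 / A - t * x
        = ((t * A - x) ^ 2 + x ^ 2) / (2 * A) := by field_simp; ring
    have : 0 ≤ ((t * A - x) ^ 2 + x ^ 2) / (2 * A) := by positivity
    linarith
  have hI2 : ∀ t : ℝ, Integrable (fun ω => Real.exp (t * z ω)) μ := fun t =>
    (hI.const_mul (Real.exp (t ^ 2 * A / 2))).mono' (by fun_prop)
      (.of_forall fun ω => by rw [Real.norm_of_nonneg (Real.exp_pos _).le]; exact hb t _)
  have hIz : Integrable z μ := by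
    refine ((hI2 1).add (hI2 (-1))).mono' (by fun_prop) (.of_forall fun ω => ?_)
    rw [Real.norm_eq_abs]
    have h1 := Real.add_one_le_exp (z ω)
    have h2 := Real.add_one_le_exp (-z ω)
    have h3 := Real.exp_pos (z ω)
    have h4 := Real.exp_pos (-z ω)
    simp only [Pi.add_apply, one_mul, neg_mul]
    exact abs_le.2 ⟨by linarith, by linarith⟩
  refine ⟨hI2, fun t => ?_⟩
  rw [mgf]
  push_cast
  rcases le_or_gt (t ^ 2 * A) 1 with ht | ht
  · have hb2 : ∀ x : ℝ, Real.exp (t * x) ≤ t * x + (1 + t ^ 2 * A * (Real.exp (x ^ 2 / A) - 1)) := by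
      intro x
      refine (exp_le_add_exp_sq _).trans ?_
      have := exp_mul_le_chord (u := x ^ 2 / A) (by positivity) ht
      have e : t ^ 2 * A * (x ^ 2 / A) = (t * x) ^ 2 := by field_simp
      rw [e] at this
      linarith
    have hIs : Integrable (fun ω => Real.exp (z ω ^ 2 / A) - 1) μ := hI.sub (integrable_const _)
    have hIr : Integrable (fun ω => 1 + t ^ 2 * A * (Real.exp (z ω ^ 2 / A) - 1)) μ :=
      (integrable_const _).add (hIs.const_mul _)
    calc ∫ ω, Real.exp (t * z ω) ∂μ
        ≤ ∫ ω, (t * z ω + (1 + t ^ 2 * A * (Real.exp (z ω ^ 2 / A) - 1))) ∂μ :=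
          integral_mono (hI2 t) ((hIz.const_mul t).add hIr) fun ω => hb2 _
      _ = 1 + t ^ 2 * A * (∫ ω, Real.exp (z ω ^ 2 / A) ∂μ - 1) := by
          rw [integral_add (hIz.const_mul t) hIr, integral_const_mul, h0,
            integral_add (integrable_const _) (hIs.const_mul _), integral_const_mul,
            integral_sub hI (integrable_const _)]
          simp
      _ ≤ 1 + t ^ 2 * A * 2 := by gcongr; linarith
      _ ≤ Real.exp (t ^ 2 * A * 2) := by linarith [Real.add_one_le_exp (t ^ 2 * A * 2)]
      _ ≤ _ := Real.exp_le_exp.2 (by linarith)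
  · calc ∫ ω, Real.exp (t * z ω) ∂μ
        ≤ ∫ ω, Real.exp (t ^ 2 * A / 2) * Real.exp (z ω ^ 2 / A) ∂μ :=
          integral_mono (hI2 t) (hI.const_mul _) fun ω => hb t _
      _ ≤ Real.exp (t ^ 2 * A / 2) * 3 := by rw [integral_const_mul]; gcongr
      _ ≤ Real.exp (t ^ 2 * A / 2) * Real.exp (t ^ 2 * A * (3 / 2)) := by
          gcongr
          have := Real.quadratic_le_exp_of_nonneg (x := t ^ 2 * A * (3 / 2)) (by positivity)
          nlinarith
      _ ≤ _ := by rw [← Real.exp_add]; exact Real.exp_le_exp.2 (by linarith)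

theorem ProbabilityTheory.HasSubgaussianMGF.abs_ge_le {Z : Ω → ℝ} {C : NNReal}
    (h : HasSubgaussianMGF Z C μ) {ε : ℝ} (hε : 0 ≤ ε) :
    μ {ω | ε ≤ |Z ω|} ≤ ENNReal.ofReal (2 * Real.exp (-ε ^ 2 / (2 * C))) := by
  have h1 := h.measure_ge_le hε
  have h2 := h.neg.measure_ge_le hε
  have hs : {ω | ε ≤ |Z ω|} ⊆ {ω | ε ≤ Z ω} ∪ {ω | ε ≤ (-Z) ω} := fun ω (hω : ε ≤ |Z ω|) =>
    le_abs.1 hω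
  have h3 : μ.real {ω | ε ≤ |Z ω|} ≤ 2 * Real.exp (-ε ^ 2 / (2 * C)) :=
    (measureReal_mono hs).trans ((measureReal_union_le _ _).trans (by linarith))
  rw [← ofReal_measureReal]
  exact ENNReal.ofReal_le_ofReal h3

/-- The second moment of a sub-Gaussian variable is at most four times its variance proxy:
compare `(t Z)²` with `2 (exp (t Z) + exp (-t Z) - 2)` at `t = C ^ (-1/2)`. -/
theorem ProbabilityTheory.HasSubgaussianMGF.lintegral_sq_le {Z : Ω → ℝ} {C : NNReal} (hC : 0 < C)
    (h : HasSubgaussianMGF Z C μ) :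
    ∫⁻ ω, ENNReal.ofReal (Z ω ^ 2) ∂μ ≤ ENNReal.ofReal (4 * C) := by
  have hC' : (0 : ℝ) < C := hC
  set t := (Real.sqrt C)⁻¹ with ht
  have ht2 : t ^ 2 = 1 / C := by rw [ht, inv_pow, Real.sq_sqrt hC'.le, one_div]
  have hI1 := h.integrable_exp_mul t
  have hI2 := h.integrable_exp_mul (-t)
  have hm1 := h.mgf_le t
  have hm2 := h.mgf_le (-t)
  rw [mgf] at hm1 hm2
  have e1 : C * t ^ 2 / 2 = 1 / 2 := by rw [ht2]; field_simp
  rw [neg_sq, e1] at hm2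
  rw [e1] at hm1
  have hexp : Real.exp (1 / 2) ≤ 2 := by
    have h1 : Real.exp (1 / 2) * Real.exp (1 / 2) = Real.exp 1 := by
      rw [← Real.exp_add]; norm_num
    have := Real.exp_one_lt_d9
    nlinarith [Real.exp_pos (1 / 2)]
  have hbd : ∀ x : ℝ, x ^ 2 ≤ 2 * C * (Real.exp (t * x) + Real.exp (-t * x) - 2) := by
    intro x
    have h1 : (t * x) ^ 2 ≤ 2 * (Real.exp (t * x) + Real.exp (-t * x) - 2) := by
      rw [neg_mul]
      have ha := Real.add_one_le_exp (t * x)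
      have hb := Real.add_one_le_exp (-(t * x))
      rcases le_total 0 (t * x) with h | h
      · linarith [Real.quadratic_le_exp_of_nonneg h]
      · have := Real.quadratic_le_exp_of_nonneg (neg_nonneg.2 h)
        rw [neg_sq] at this
        linarith
    rw [mul_pow, ht2] at h1
    calc x ^ 2 = C * (1 / C * x ^ 2) := by field_simp
      _ ≤ C * (2 * (Real.exp (t * x) + Real.exp (-t * x) - 2)) := by gcongr
      _ = _ := by ring
  have hIr : Integrable (fun ω => 2 * C * (Real.exp (t * Z ω) + Real.exp (-t * Z ω) - 2)) μ :=
    ((hI1.add hI2).sub (integrable_const _)).const_mul _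
  calc _ ≤ ∫⁻ ω, ENNReal.ofReal (2 * C * (Real.exp (t * Z ω) + Real.exp (-t * Z ω) - 2)) ∂μ :=
        lintegral_mono fun ω => ENNReal.ofReal_le_ofReal (hbd _)
    _ = ENNReal.ofReal (∫ ω, 2 * C * (Real.exp (t * Z ω) + Real.exp (-t * Z ω) - 2) ∂μ) :=
        (ofReal_integral_eq_lintegral_ofReal hIr
          (.of_forall fun ω => (sq_nonneg (Z ω)).trans (hbd _))).symm
    _ ≤ _ := by
        refine ENNReal.ofReal_le_ofReal ?_
        have e : ∫ ω, (Real.exp (t * Z ω) + Real.exp (-t * Z ω) - 2) ∂μ =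
            ∫ ω, Real.exp (t * Z ω) ∂μ + ∫ ω, Real.exp (-t * Z ω) ∂μ - 2 := by
          have := integral_sub (hI1.add hI2) (integrable_const (2 : ℝ))
          simp only [Pi.add_apply] at this
          rw [this, integral_add hI1 hI2]
          simp
        rw [integral_const_mul, e]
        nlinarith

/-- Chernoff bound for a sum of independent variables with a common bound on `E exp (t Z)`. -/
theorem measure_sum_ge_le_of_exp_moment {ι : Type*} {Z : ι → Ω → ℝ} (hind : iIndepFun Z μ)
    (hZ : ∀ i, Measurable (Z i)) (s : Finset ι) {t B : ℝ} (ht : 0 ≤ t) (hB : 0 ≤ B)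
    (h : ∀ i, ∫⁻ ω, ENNReal.ofReal (Real.exp (t * Z i ω)) ∂μ ≤ ENNReal.ofReal B) (T : ℝ) :
    μ {ω | T ≤ ∑ i ∈ s, Z i ω} ≤ ENNReal.ofReal (Real.exp (-t * T) * B ^ s.card) := by
  have hI : ∀ i, Integrable (fun ω => Real.exp (t * Z i ω)) μ := fun i => by
    have := hZ i
    refine ⟨by fun_prop, ?_⟩
    rw [hasFiniteIntegral_iff_ofReal (.of_forall fun y => (Real.exp_pos _).le)]
    exact (h i).trans_lt ENNReal.ofReal_lt_top
  have hm : ∀ i, mgf (Z i) μ t ≤ B := fun i => by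
    have := hZ i
    rw [mgf, integral_eq_lintegral_of_nonneg_ae (.of_forall fun y => (Real.exp_pos _).le)
      (by fun_prop)]
    exact ENNReal.toReal_le_of_le_ofReal hB (h i)
  have h1 := measure_ge_le_exp_mul_mgf (X := ∑ i ∈ s, Z i) (μ := μ) T ht
    (hind.integrable_exp_mul_sum hZ fun i _ => hI i)
  rw [hind.mgf_sum hZ] at h1
  have h2 : ∏ i ∈ s, mgf (Z i) μ t ≤ B ^ s.card :=
    (Finset.prod_le_prod (fun _ _ => mgf_nonneg) fun i _ => hm i).trans_eq (by simp)
  rw [← ofReal_measureReal]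
  refine ENNReal.ofReal_le_ofReal ?_
  simp only [Finset.sum_apply] at h1
  exact h1.trans (by gcongr)

end

/-! ### Moments of the errors and of the variance function -/

namespace StreamModel

variable {G : ℕ} (S : StreamModel.{w} G)

/-- The error `y - d'(xᵀ β*)` of an observation. -/
def err (d : ℝ → ℝ) (u : ℕ) (k : Fin S.K) (i : Fin (S.n u k)) (ω : S.Ω) : ℝ :=
  S.y u k i ω - deriv d (S.x u k i ω ⬝ᵥ S.beta k)

variable {S} {ν : Measure ℝ} {c : ℝ → ℝ → ℝ} {d : ℝ → ℝ} {b : ℕ}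

theorem measurable_err_fun (hd : Continuous (deriv d)) {p : ℕ} (β : Fin p → ℝ) :
    Measurable fun q : (Fin p → ℝ) × ℝ => q.2 - deriv d (q.1 ⬝ᵥ β) := by
  have := hd.measurable
  simp only [dotProduct]
  fun_prop

theorem IsModel.measurable_err (h : S.IsModel ν c d b) (hd : Continuous (deriv d)) {u : ℕ}
    (hu : u ∈ Finset.Icc 1 b) (k : Fin S.K) (i : Fin (S.n u k)) : Measurable (S.err d u k i) :=
  (measurable_err_fun hd (S.beta k)).comp ((h.meas_x u hu k i).prodMk (h.meas_y u hu k i))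

theorem mem_members {g : Fin G} {k : Fin S.K} : k ∈ S.members g ↔ S.grp k = g := by
  simp [members]

theorem SubGaussianErrors.tail {κ : ℝ} (ht : S.SubGaussianErrors d κ b) (h : S.IsModel ν c d b)
    (hd : Continuous (deriv d)) {u : ℕ} (hu : u ∈ Finset.Icc 1 b) (k : Fin S.K)
    (i : Fin (S.n u k)) {ε : ℝ} (hε : 0 < ε) :
    S.P {ω | ε ≤ |S.err d u k i ω|} ≤ ENNReal.ofReal (2 * Real.exp (-(κ * ε ^ 2))) := by
  classical
  have hk : k ∈ S.members (S.grp k) := mem_members.2 rfl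
  have e : ∀ F : (k : Fin S.K) → Fin (S.n u k) → ℝ → ℝ, (∀ k i, F k i 0 = 0) →
      ∑ k' ∈ S.members (S.grp k), ∑ i', F k' i'
        ((Pi.single k (Pi.single i 1) : (k : Fin S.K) → Fin (S.n u k) → ℝ) k' i') = F k i 1 := by
    intro F hF
    rw [Finset.sum_eq_single_of_mem k hk, Finset.sum_eq_single_of_mem i (Finset.mem_univ _)]
    · simp
    · intro i' _ hi'
      simp [hi', hF]
    · intro k' _ hk'
      simp [hk', hF]
  have key := ht u hu (S.grp k) (Pi.single k (Pi.single i 1)) ⟨k, hk, i, by simp⟩ ε hε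
  have e1 := fun ω => e (fun k' i' t => t * (S.y u k' i' ω -
    deriv d (S.x u k' i' ω ⬝ᵥ S.xi (S.grp k)))) (by simp)
  have e2 := e (fun k' i' t => t ^ 2) (by simp)
  simp only [one_mul] at e1
  simp only [e1, e2, one_pow, Real.sqrt_one, one_mul] at key
  have hm : MeasurableSet {ω | |S.err d u k i ω| < ε} :=
    measurableSet_lt (h.measurable_err hd hu k i).abs measurable_const
  have hc : {ω | ε ≤ |S.err d u k i ω|} = {ω | |S.err d u k i ω| < ε}ᶜ := by
    ext ω; simp
  rw [hc, ← ofReal_measureReal, probReal_compl_eq_one_sub hm]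
  refine ENNReal.ofReal_le_ofReal ?_
  change _ < S.P.real {ω | |S.err d u k i ω| < ε} at key
  linarith

theorem SubGaussianErrors.lintegral_exp_err_sq {κ : ℝ} (hκ : 0 < κ)
    (ht : S.SubGaussianErrors d κ b) (h : S.IsModel ν c d b) (hd : Continuous (deriv d)) {u : ℕ}
    (hu : u ∈ Finset.Icc 1 b) (k : Fin S.K) (i : Fin (S.n u k)) :
    ∫⁻ ω, ENNReal.ofReal (Real.exp (κ / 2 * S.err d u k i ω ^ 2)) ∂S.P ≤ 3 :=
  lintegral_exp_sq_le_of_tail (h.measurable_err hd hu k i) hκ fun _ hε => ht.tail h hd hu k i hε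

section

variable (hc : ∀ y φ, 0 ≤ c y φ) (hm : ∀ φ, Measurable fun y => c y φ)
  (hp : ∀ (k : Fin S.K) θ, IsProbabilityMeasure (glmLaw ν c d (S.disp k) θ))

include hc hm hp

/-- Given the covariates, the variance function near the true natural parameter is controlled by
the conditional exponential moment of the squared error, so that it has an exponential moment. -/
theorem SubGaussianErrors.lintegral_exp_varSup {κ : ℝ} (hκ : 0 < κ)
    (ht : S.SubGaussianErrors d κ b) (h : S.IsModel ν c d b) {u : ℕ}
    (hu : u ∈ Finset.Icc 1 b) (k : Fin S.K) (i : Fin (S.n u k)) :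
    ∫⁻ ω, ENNReal.ofReal (Real.exp (κ / 4 * varSup d (S.x u k i ω ⬝ᵥ S.beta k))) ∂S.P ≤
      ENNReal.ofReal (Real.exp (1 / κ) * 3) := by
  have hd := continuous_deriv_glm hc hm (hp k)
  have hv := (continuous_varSup hc hm (hp k)).measurable
  have hx := h.meas_x u hu k i
  have hy := h.meas_y u hu k i
  have hF : Measurable fun q : (Fin S.p → ℝ) × ℝ =>
      ENNReal.ofReal (Real.exp (κ / 2 * (q.2 - deriv d (q.1 ⬝ᵥ S.beta k)) ^ 2)) := by
    have := measurable_err_fun hd (S.beta k)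
    fun_prop
  have hV : Measurable fun v : Fin S.p → ℝ =>
      ENNReal.ofReal (Real.exp (κ / 4 * varSup d (v ⬝ᵥ S.beta k))) := by
    simp only [dotProduct]
    fun_prop
  calc _ = ∫⁻ v, ENNReal.ofReal (Real.exp (κ / 4 * varSup d (v ⬝ᵥ S.beta k)))
          ∂(S.P.map (S.x u k i)) := (lintegral_map hV hx).symm
    _ ≤ ∫⁻ v, ENNReal.ofReal (Real.exp (1 / κ)) * ∫⁻ y, ENNReal.ofReal
          (Real.exp (κ / 2 * (y - deriv d (v ⬝ᵥ S.beta k)) ^ 2))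
            ∂(condDistrib (S.y u k i) (S.x u k i) S.P v) ∂(S.P.map (S.x u k i)) := by
        refine lintegral_mono_ae ?_
        filter_upwards [h.law u hu k i] with v hlaw
        rw [hlaw]
        exact exp_varSup_le hc hm (hp k) hκ _
    _ = ENNReal.ofReal (Real.exp (1 / κ)) *
          ∫⁻ ω, ENNReal.ofReal (Real.exp (κ / 2 * S.err d u k i ω ^ 2)) ∂S.P := by
        rw [lintegral_const_mul _ hF.lintegral_kernel_prod_right', ← Measure.lintegral_compProd hF,
          compProd_map_condDistrib hy.aemeasurable, lintegral_map hF (hx.prodMk hy)]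
        rfl
    _ ≤ _ := by
        rw [ENNReal.ofReal_mul (Real.exp_pos _).le]
        gcongr
        simpa using ht.lintegral_exp_err_sq hκ h hd hu k i

/-- The errors, being centered given the covariates, are uncorrelated with them. -/
theorem IsModel.integral_mul_err (h : S.IsModel ν c d b) {u : ℕ} (hu : u ∈ Finset.Icc 1 b)
    (k : Fin S.K) (i : Fin (S.n u k)) (j : Fin S.p) :
    ∫ ω, S.x u k i ω j * S.err d u k i ω ∂S.P = 0 := by
  have hd := continuous_deriv_glm hc hm (hp k)
  have hx := h.meas_x u hu k i
  have hy := h.meas_y u hu k i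
  have hF : Measurable fun q : (Fin S.p → ℝ) × ℝ =>
      q.1 j * (q.2 - deriv d (q.1 ⬝ᵥ S.beta k)) := by
    have := measurable_err_fun hd (S.beta k)
    fun_prop
  have e : ∫ ω, S.x u k i ω j * S.err d u k i ω ∂S.P =
      ∫ q, q.1 j * (q.2 - deriv d (q.1 ⬝ᵥ S.beta k))
        ∂(S.P.map (S.x u k i) ⊗ₘ condDistrib (S.y u k i) (S.x u k i) S.P) := by
    rw [compProd_map_condDistrib hy.aemeasurable,
      integral_map (hx.prodMk hy).aemeasurable hF.aestronglyMeasurable]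
    rfl
  rw [e]
  by_cases hI : Integrable (fun q : (Fin S.p → ℝ) × ℝ =>
      q.1 j * (q.2 - deriv d (q.1 ⬝ᵥ S.beta k)))
      (S.P.map (S.x u k i) ⊗ₘ condDistrib (S.y u k i) (S.x u k i) S.P)
  · rw [Measure.integral_compProd hI]
    refine integral_eq_zero_of_ae ?_
    filter_upwards [h.law u hu k i] with v hlaw
    have := hp k (v ⬝ᵥ S.beta k)
    have hint : Integrable (fun y : ℝ => y) (glmLaw ν c d (S.disp k) (v ⬝ᵥ S.beta k)) :=
      (memLp_id_glmLaw hc hm (hp k) (v ⬝ᵥ S.beta k) 1).integrable le_rfl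
    simp only [hlaw, Pi.zero_apply]
    rw [integral_const_mul, integral_sub hint (integrable_const _), integral_glmLaw hc hm (hp k)]
    simp
  -- a product that is not integrable has Bochner integral zero
  · exact integral_undef hI

theorem SubGaussianErrors.hasSubgaussianMGF_mul_err {κ : ℝ} (hκ : 0 < κ)
    (ht : S.SubGaussianErrors d κ b) (h : S.IsModel ν c d b) {Cx : ℝ} (hCx : 0 < Cx)
    (hb : ∀ᵐ ω ∂S.P, S.BoundedCov Cx b ω) {u : ℕ} (hu : u ∈ Finset.Icc 1 b)
    (k : Fin S.K) (i : Fin (S.n u k)) (j : Fin S.p) :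
    HasSubgaussianMGF (fun ω => S.x u k i ω j * S.err d u k i ω)
      (4 * (2 * Cx ^ 2 / κ).toNNReal) S.P := by
  have hd := continuous_deriv_glm hc hm (hp k)
  have hA : 0 < 2 * Cx ^ 2 / κ := by positivity
  have hx := h.meas_x u hu k i
  have he := h.measurable_err hd hu k i
  refine hasSubgaussianMGF_of_exp_sq (by fun_prop) (Real.toNNReal_pos.2 hA) ?_
    (h.integral_mul_err hc hm hp hu k i j)
  refine le_trans (lintegral_mono_ae ?_) (ht.lintegral_exp_err_sq hκ h hd hu k i)
  filter_upwards [hb] with ω hω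
  refine ENNReal.ofReal_le_ofReal (Real.exp_le_exp.2 ?_)
  have h1 : S.x u k i ω j ^ 2 ≤ Cx ^ 2 := sq_le_sq.2 (by
    rw [abs_of_pos hCx]; exact hω u hu k i j)
  rw [Real.coe_toNNReal _ hA.le, div_le_iff₀ hA, mul_pow]
  have e : κ / 2 * S.err d u k i ω ^ 2 * (2 * Cx ^ 2 / κ) = Cx ^ 2 * S.err d u k i ω ^ 2 := by
    field_simp
  rw [e]
  gcongr

end

theorem IsModel.iIndepFun_batch (h : S.IsModel ν c d b) {u : ℕ} (hu : u ∈ Finset.Icc 1 b)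
    (F : (k : Fin S.K) → (Fin S.p → ℝ) × ℝ → ℝ) (hF : ∀ k, Measurable (F k)) :
    iIndepFun (fun (q : (k : Fin S.K) × Fin (S.n u k)) ω =>
      F q.1 (S.x u q.1 q.2 ω, S.y u q.1 q.2 ω)) S.P := by
  have h1 := h.indep.precomp (g := fun q : (k : Fin S.K) × Fin (S.n u k) =>
    (⟨⟨u, hu⟩, q.1, q.2⟩ : (u : Finset.Icc 1 b) × (k : Fin S.K) × Fin (S.n u k))) (by
      rintro ⟨k, i⟩ ⟨k', i'⟩ hq
      simpa using hq)
  exact h1.comp (fun q => F q.1) fun q => hF q.1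

section

variable (hc : ∀ y φ, 0 ≤ c y φ) (hm : ∀ φ, Measurable fun y => c y φ)
  (hp : ∀ (k : Fin S.K) θ, IsProbabilityMeasure (glmLaw ν c d (S.disp k) θ))

include hc hm hp

/-- The score coordinates, summed over a batch and a set of sources, are sub-Gaussian with a variance
proxy proportional to the number of observations. -/
theorem SubGaussianErrors.hasSubgaussianMGF_score {κ : ℝ} (hκ : 0 < κ)
    (ht : S.SubGaussianErrors d κ b) (h : S.IsModel ν c d b) {Cx : ℝ} (hCx : 0 < Cx)
    (hb : ∀ᵐ ω ∂S.P, S.BoundedCov Cx b ω) {u : ℕ} (hu : u ∈ Finset.Icc 1 b)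
    (s : Finset (Fin S.K)) (j : Fin S.p) :
    HasSubgaussianMGF (fun ω => ∑ k ∈ s, ∑ i, S.x u k i ω j * S.err d u k i ω)
      (4 * (2 * Cx ^ 2 / κ).toNNReal * ∑ k ∈ s, (S.n u k : NNReal)) S.P := by
  have hind := h.iIndepFun_batch hu
    (fun k q => q.1 j * (q.2 - deriv d (q.1 ⬝ᵥ S.beta k))) fun k => by
      have := measurable_err_fun (continuous_deriv_glm hc hm (hp k)) (S.beta k)
      fun_prop
  have := HasSubgaussianMGF.sum_of_iIndepFun hind
    (s := s.sigma fun k => (Finset.univ : Finset (Fin (S.n u k))))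
    (c := fun _ => (4 * (2 * Cx ^ 2 / κ : ℝ).toNNReal : NNReal))
    fun q _ => by exact ht.hasSubgaussianMGF_mul_err hc hm hp hκ h hCx hb hu q.1 q.2 j
  convert this using 1
  · ext ω
    rw [Finset.sum_sigma]
    rfl
  · simp [Finset.card_sigma, mul_comm]

/-- Large deviations of the sum over a batch of the variance function near the truth. -/
theorem SubGaussianErrors.measure_sum_varSup {κ : ℝ} (hκ : 0 < κ)
    (ht : S.SubGaussianErrors d κ b) (h : S.IsModel ν c d b) {u : ℕ} (hu : u ∈ Finset.Icc 1 b)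
    (k : Fin S.K) (T : ℝ) :
    S.P {ω | T ≤ ∑ i, varSup d (S.x u k i ω ⬝ᵥ S.beta k)} ≤
      ENNReal.ofReal (Real.exp (-(κ / 4) * T) * (Real.exp (1 / κ) * 3) ^ S.n u k) := by
  have hF : ∀ k : Fin S.K, Measurable fun q : (Fin S.p → ℝ) × ℝ =>
      varSup d (q.1 ⬝ᵥ S.beta k) := fun k => by
    have := (continuous_varSup hc hm (hp k)).measurable
    simp only [dotProduct]
    fun_prop
  have hind := (h.iIndepFun_batch hu (fun k q => varSup d (q.1 ⬝ᵥ S.beta k)) hF).precomp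
    (g := fun i : Fin (S.n u k) => (⟨k, i⟩ : (k : Fin S.K) × Fin (S.n u k)))
    (fun i i' hi => by simpa using hi)
  have := measure_sum_ge_le_of_exp_moment hind
    (fun i => (hF k).comp ((h.meas_x u hu k i).prodMk (h.meas_y u hu k i))) Finset.univ
    (by positivity : 0 ≤ κ / 4) (by positivity : 0 ≤ Real.exp (1 / κ) * 3)
    (fun i => ht.lintegral_exp_varSup hc hm hp hκ h hu k i) T
  simpa using this

end

end StreamModel

/-! ### The Euclidean norm of coordinate vectors -/

section L2

variable {ι : Type*} [Fintype ι]

theorem l2_eq_norm (v : ι → ℝ) : l2 v = ‖WithLp.toLp 2 v‖ := by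
  simp [l2, EuclideanSpace.norm_eq]

theorem l2_nonneg (v : ι → ℝ) : 0 ≤ l2 v := Real.sqrt_nonneg _

theorem l2_sq (v : ι → ℝ) : l2 v ^ 2 = ∑ j, v j ^ 2 :=
  Real.sq_sqrt (Finset.sum_nonneg fun _ _ => sq_nonneg _)

theorem dotProduct_self_eq_l2_sq (v : ι → ℝ) : v ⬝ᵥ v = l2 v ^ 2 := by
  rw [l2_sq]
  simp [dotProduct, sq]

theorem l2_add_le (v w : ι → ℝ) : l2 (v + w) ≤ l2 v + l2 w := by
  simpa [l2_eq_norm] using norm_add_le (WithLp.toLp 2 v) (WithLp.toLp 2 w)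

theorem l2_neg (v : ι → ℝ) : l2 (-v) = l2 v := by
  simp [l2]

theorem l2_sub_comm (v w : ι → ℝ) : l2 (v - w) = l2 (w - v) := by
  rw [← l2_neg, neg_sub]

theorem l2_sub_le (u v w : ι → ℝ) : l2 (u - w) ≤ l2 (u - v) + l2 (v - w) := by
  have := l2_add_le (u - v) (v - w)
  rwa [sub_add_sub_cancel] at this

theorem l2_smul (t : ℝ) (v : ι → ℝ) : l2 (t • v) = |t| * l2 v := by
  simpa [l2_eq_norm] using norm_smul t (WithLp.toLp 2 v)

theorem l2_zero : l2 (0 : ι → ℝ) = 0 := by simp [l2]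

theorem l2_pos {v : ι → ℝ} (h : v ≠ 0) : 0 < l2 v := by
  rw [l2_eq_norm]
  simpa using h

theorem abs_le_l2 (v : ι → ℝ) (j : ι) : |v j| ≤ l2 v :=
  Real.abs_le_sqrt (Finset.single_le_sum (f := fun j => v j ^ 2) (fun _ _ => sq_nonneg _)
    (Finset.mem_univ j))

theorem continuous_l2 : Continuous (l2 : (ι → ℝ) → ℝ) := by
  unfold l2; fun_prop

theorem l2_restrict_eq {A : Finset ι} {v : ι → ℝ} (h : ∀ j ∉ A, v j = 0) :
    l2 (fun j : A => v j) = l2 v := by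
  unfold l2
  congr 1
  rw [Finset.sum_coe_sort A fun j => v j ^ 2]
  exact Finset.sum_subset (Finset.subset_univ A) fun j _ hj => by simp [h j hj]

/-- The Cauchy–Schwarz inequality for a linear form on vectors supported in `A`. -/
theorem abs_sum_mul_le_l2 {A : Finset ι} {v : ι → ℝ} (h : ∀ j ∉ A, v j = 0) (z : ι → ℝ) :
    |∑ j, v j * z j| ≤ Real.sqrt (∑ j ∈ A, z j ^ 2) * l2 v := by
  have e : ∑ j, v j * z j = ∑ j ∈ A, z j * v j :=
    (Finset.sum_subset (Finset.subset_univ A) fun j _ hj => by simp [h j hj]).symm.trans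
      (Finset.sum_congr rfl fun j _ => mul_comm _ _)
  have e2 : l2 v = Real.sqrt (∑ j ∈ A, v j ^ 2) := by
    rw [l2]
    congr 1
    exact (Finset.sum_subset (Finset.subset_univ A) fun j _ hj => by simp [h j hj]).symm
  rw [e, e2, ← Real.sqrt_mul (Finset.sum_nonneg fun _ _ => sq_nonneg _)]
  exact Real.abs_le_sqrt (Finset.sum_mul_sq_le_sq_mul_sq _ _ _)

end L2

/-- The Cauchy–Schwarz inequality for nonnegative weights. -/
theorem abs_sum_weight_mul_le {ι : Type*} (s : Finset ι) {w : ι → ℝ} (hw : ∀ i, 0 ≤ w i)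
    (f g : ι → ℝ) : |∑ i ∈ s, w i * f i * g i| ≤
      Real.sqrt (∑ i ∈ s, w i * f i * f i) * Real.sqrt (∑ i ∈ s, w i * g i * g i) := by
  have h := Finset.sum_mul_sq_le_sq_mul_sq s (fun i => Real.sqrt (w i) * f i)
    (fun i => Real.sqrt (w i) * g i)
  have e : ∀ a b : ι → ℝ, ∀ i, Real.sqrt (w i) * a i * (Real.sqrt (w i) * b i)
      = w i * a i * b i := fun a b i => by
    linear_combination (a i * b i) * Real.mul_self_sqrt (hw i)
  simp only [sq (_ * _), e] at h
  rw [← Real.sqrt_mul (Finset.sum_nonneg fun i _ => by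
    rw [mul_assoc]; exact mul_nonneg (hw i) (mul_self_nonneg _))]
  exact Real.abs_le_sqrt h

/-- Second-order Taylor lower bound on the unit interval. -/
theorem add_deriv_add_half_le {f f' f'' : ℝ → ℝ} (h1 : ∀ t, HasDerivAt f (f' t) t)
    (h2 : ∀ t, HasDerivAt f' (f'' t) t) {m : ℝ} (hm : ∀ t ∈ Set.Icc (0 : ℝ) 1, m ≤ f'' t) :
    f 0 + f' 0 + m / 2 ≤ f 1 := by
  have hg' : ∀ t, HasDerivAt (fun t => f' t - m * t) (f'' t - m) t := fun t => by
    exact ((h2 t).sub ((hasDerivAt_id t).const_mul m)).congr_deriv (by simp)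
  have mono1 : MonotoneOn (fun t => f' t - m * t) (Set.Icc 0 1) := by
    refine monotoneOn_of_deriv_nonneg (convex_Icc 0 1)
      (fun t _ => (hg' t).continuousAt.continuousWithinAt)
      (fun t _ => (hg' t).differentiableAt.differentiableWithinAt) fun t ht => ?_
    rw [(hg' t).deriv]
    linarith [hm t (interior_subset ht)]
  have hg : ∀ t, HasDerivAt (fun t => f t - f' 0 * t - m / 2 * t ^ 2)
      (f' t - f' 0 - m * t) t := fun t => by
    have := ((h1 t).sub ((hasDerivAt_id t).const_mul (f' 0))).sub
      (((hasDerivAt_id t).pow 2).const_mul (m / 2))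
    exact this.congr_deriv (by simp; ring)
  have mono2 : MonotoneOn (fun t => f t - f' 0 * t - m / 2 * t ^ 2) (Set.Icc 0 1) := by
    refine monotoneOn_of_deriv_nonneg (convex_Icc 0 1)
      (fun t _ => (hg t).continuousAt.continuousWithinAt)
      (fun t _ => (hg t).differentiableAt.differentiableWithinAt) fun t ht => ?_
    rw [(hg t).deriv]
    have ht' := interior_subset ht
    have := mono1 (Set.left_mem_Icc.2 zero_le_one) ht' ht'.1
    simp only at this
    linarith
  have := mono2 (Set.left_mem_Icc.2 zero_le_one) (Set.right_mem_Icc.2 zero_le_one) zero_le_one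
  simp only at this
  linarith

/-! ### The renewable loss of one source -/

/-- The analytic properties of the cumulant function of an exponential family. -/
structure IsCumulant (d : ℝ → ℝ) : Prop where
  hasDerivAt : ∀ θ, HasDerivAt d (deriv d θ) θ
  hasDerivAt_deriv : ∀ θ, HasDerivAt (deriv d) (iteratedDeriv 2 d θ) θ
  nonneg : ∀ θ, 0 ≤ iteratedDeriv 2 d θ
  le_varSup : ∀ θ w, |w| ≤ 1 → iteratedDeriv 2 d (θ + w) ≤ varSup d θ

theorem isCumulant_of_glmLaw {ν : Measure ℝ} {c : ℝ → ℝ → ℝ} {d : ℝ → ℝ} {φ : ℝ}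
    (hc : ∀ y φ, 0 ≤ c y φ) (hm : ∀ φ, Measurable fun y => c y φ)
    (hp : ∀ θ, IsProbabilityMeasure (glmLaw ν c d φ θ)) : IsCumulant d where
  hasDerivAt θ := (differentiable_glm hc hm hp θ).hasDerivAt
  hasDerivAt_deriv := hasDerivAt_deriv_glm hc hm hp
  nonneg := deriv2_glm_nonneg hc hm hp
  le_varSup _ _ hw := deriv2_le_varSup hc hm hp hw

namespace StreamModel

variable {G : ℕ} (S : StreamModel.{w} G)

/-- The bilinear form `aᵀ Xᵀ Σ(Xβ) X c` of the negative Hessian of a batch log-likelihood. -/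
def hform (d : ℝ → ℝ) (u : ℕ) (k : Fin S.K) (ω : S.Ω) (β a c : Fin S.p → ℝ) : ℝ :=
  ∑ i, iteratedDeriv 2 d (S.x u k i ω ⬝ᵥ β) * (S.x u k i ω ⬝ᵥ a) * (S.x u k i ω ⬝ᵥ c)

/-- The negative approximate log-likelihood, with the quadratic part written by bilinear forms. -/
def fit (d : ℝ → ℝ) (Bh : ℕ → Fin S.K → Fin S.p → ℝ) (u : ℕ) (k : Fin S.K) (ω : S.Ω)
    (β : Fin S.p → ℝ) : ℝ :=
  1 / 2 * ∑ v ∈ Finset.Ico 1 u, S.hform d v k ω (Bh v k) (β - Bh (u - 1) k) (β - Bh (u - 1) k)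
    + ∑ i, (d (S.x u k i ω ⬝ᵥ β) - S.y u k i ω * (S.x u k i ω ⬝ᵥ β))

/-- The derivative of `fit` at `β`, as a linear form. -/
def grad (d : ℝ → ℝ) (Bh : ℕ → Fin S.K → Fin S.p → ℝ) (u : ℕ) (k : Fin S.K) (ω : S.Ω)
    (β : Fin S.p → ℝ) : (Fin S.p → ℝ) →ₗ[ℝ] ℝ where
  toFun a := ∑ v ∈ Finset.Ico 1 u, S.hform d v k ω (Bh v k) (β - Bh (u - 1) k) a
    + ∑ i, (deriv d (S.x u k i ω ⬝ᵥ β) - S.y u k i ω) * (S.x u k i ω ⬝ᵥ a)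
  map_add' a a' := by
    simp only [hform, dotProduct_add, mul_add, Finset.sum_add_distrib]
    ring
  map_smul' t a := by
    simp only [hform, dotProduct_smul, smul_eq_mul, RingHom.id_apply, mul_add, Finset.mul_sum]
    congr 1
    · exact Finset.sum_congr rfl fun _ _ => Finset.sum_congr rfl fun _ _ => by ring
    · exact Finset.sum_congr rfl fun _ _ => by ring

variable {S} {d : ℝ → ℝ} {ω : S.Ω} {Bh : ℕ → Fin S.K → Fin S.p → ℝ} {u : ℕ} {k : Fin S.K}

theorem grad_apply (β a : Fin S.p → ℝ) : S.grad d Bh u k ω β a =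
    ∑ v ∈ Finset.Ico 1 u, S.hform d v k ω (Bh v k) (β - Bh (u - 1) k) a
      + ∑ i, (deriv d (S.x u k i ω ⬝ᵥ β) - S.y u k i ω) * (S.x u k i ω ⬝ᵥ a) := rfl

theorem dotProduct_line {p : ℕ} (x β a : Fin p → ℝ) (t : ℝ) :
    x ⬝ᵥ (β + t • a) = x ⬝ᵥ β + t * (x ⬝ᵥ a) := by
  simp

theorem hasDerivAt_dotProduct_line {p : ℕ} (x β a : Fin p → ℝ) (t : ℝ) :
    HasDerivAt (fun t : ℝ => x ⬝ᵥ (β + t • a)) (x ⬝ᵥ a) t := by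
  simp only [dotProduct_line]
  simpa using ((hasDerivAt_id t).mul_const (x ⬝ᵥ a)).const_add (x ⬝ᵥ β)

theorem hasDerivAt_logLik_line (hd : IsCumulant d) (β a : Fin S.p → ℝ) (t : ℝ) :
    HasDerivAt (fun t : ℝ => S.logLik d u k ω (β + t • a))
      (∑ i, (S.y u k i ω - deriv d (S.x u k i ω ⬝ᵥ (β + t • a))) * (S.x u k i ω ⬝ᵥ a)) t := by
  unfold logLik
  refine HasDerivAt.fun_sum fun i _ => ?_
  have h := hasDerivAt_dotProduct_line (S.x u k i ω) β a t
  have h2 := (h.const_mul (S.y u k i ω)).sub ((hd.hasDerivAt _).comp t h)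
  exact h2.congr_deriv (by ring)

theorem hasDerivAt_score_line (hd : IsCumulant d) (β a c : Fin S.p → ℝ) (t : ℝ) :
    HasDerivAt (fun t : ℝ => ∑ i, (S.y u k i ω - deriv d (S.x u k i ω ⬝ᵥ (β + t • a))) *
      (S.x u k i ω ⬝ᵥ c)) (-S.hform d u k ω (β + t • a) a c) t := by
  unfold hform
  rw [← Finset.sum_neg_distrib]
  refine HasDerivAt.fun_sum fun i _ => ?_
  have h := hasDerivAt_dotProduct_line (S.x u k i ω) β a t
  have h2 := (((hd.hasDerivAt_deriv _).comp t h).const_sub (S.y u k i ω)).mul_const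
    (S.x u k i ω ⬝ᵥ c)
  exact h2.congr_deriv (by ring)

theorem hessianMat_logLik (hd : IsCumulant d) (β : Fin S.p → ℝ) (j l : Fin S.p) :
    hessianMat (S.logLik d u k ω) β j l =
      -S.hform d u k ω β (Pi.single j 1) (Pi.single l 1) := by
  have h1 : (fun β' => lineDeriv ℝ (S.logLik d u k ω) β' (Pi.single l 1)) = fun β' =>
      ∑ i, (S.y u k i ω - deriv d (S.x u k i ω ⬝ᵥ β')) * (S.x u k i ω ⬝ᵥ Pi.single l 1) := by
    ext β'
    have := (hasDerivAt_logLik_line (u := u) (k := k) (ω := ω) hd β' (Pi.single l 1) 0).deriv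
    simpa [lineDeriv] using this
  rw [hessianMat, Matrix.of_apply, h1]
  have := (hasDerivAt_score_line (u := u) (k := k) (ω := ω) hd β (Pi.single j 1)
    (Pi.single l 1) 0).deriv
  simpa [lineDeriv] using this

theorem hform_eq_sum (β a c : Fin S.p → ℝ) : S.hform d u k ω β a c =
    ∑ j, ∑ l, a j * S.hform d u k ω β (Pi.single j 1) (Pi.single l 1) * c l := by
  simp only [hform, dotProduct_single, mul_one, Finset.mul_sum, Finset.sum_mul]
  have e : ∀ i, iteratedDeriv 2 d (S.x u k i ω ⬝ᵥ β) * (S.x u k i ω ⬝ᵥ a) *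
      (S.x u k i ω ⬝ᵥ c) = ∑ j, ∑ l, a j * (iteratedDeriv 2 d (S.x u k i ω ⬝ᵥ β) *
        S.x u k i ω j * S.x u k i ω l) * c l := fun i => by
    rw [mul_assoc, dotProduct.eq_1 _ a, dotProduct.eq_1 _ c, Finset.sum_mul_sum, Finset.mul_sum]
    refine Finset.sum_congr rfl fun j _ => ?_
    rw [Finset.mul_sum]
    exact Finset.sum_congr rfl fun l _ => by ring
  rw [Finset.sum_congr rfl fun i _ => e i, Finset.sum_comm]
  exact Finset.sum_congr rfl fun j _ => Finset.sum_comm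

theorem dotProduct_hessianMat (hd : IsCumulant d) (β a c : Fin S.p → ℝ) :
    a ⬝ᵥ (hessianMat (S.logLik d u k ω) β *ᵥ c) = -S.hform d u k ω β a c := by
  rw [hform_eq_sum]
  simp only [dotProduct, mulVec, hessianMat_logLik hd, Finset.mul_sum, ← Finset.sum_neg_distrib]
  exact Finset.sum_congr rfl fun j _ => Finset.sum_congr rfl fun l _ => by ring

theorem approxLik_eq_neg_fit (hd : IsCumulant d) (β : Fin S.p → ℝ) :
    S.approxLik d Bh u k ω β = -S.fit d Bh u k ω β := by
  have h : ∀ a : Fin S.p → ℝ, a ⬝ᵥ (S.accHess d Bh u k ω *ᵥ a) =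
      -∑ v ∈ Finset.Ico 1 u, S.hform d v k ω (Bh v k) a a := fun a => by
    rw [accHess, Matrix.sum_mulVec, dotProduct_sum, ← Finset.sum_neg_distrib]
    exact Finset.sum_congr rfl fun v _ => dotProduct_hessianMat hd _ _ _
  rw [approxLik, fit, h, logLik, neg_add]
  congr 1
  · ring
  · rw [← Finset.sum_neg_distrib]
    exact Finset.sum_congr rfl fun i _ => by ring

theorem hform_self_nonneg (hd : IsCumulant d) (β a : Fin S.p → ℝ) :
    0 ≤ S.hform d u k ω β a a :=
  Finset.sum_nonneg fun i _ => by
    rw [mul_assoc]; exact mul_nonneg (hd.nonneg _) (mul_self_nonneg _)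

theorem abs_hform_le (hd : IsCumulant d) (β a c : Fin S.p → ℝ) :
    |S.hform d u k ω β a c| ≤
      Real.sqrt (S.hform d u k ω β a a) * Real.sqrt (S.hform d u k ω β c c) :=
  abs_sum_weight_mul_le _ (fun _ => hd.nonneg _) _ _

theorem hasDerivAt_hform_line (β b a : Fin S.p → ℝ) (v : ℕ) (γ : Fin S.p → ℝ) (t : ℝ) :
    HasDerivAt (fun t : ℝ => S.hform d v k ω γ (β + t • a - b) (β + t • a - b))
      (2 * S.hform d v k ω γ (β + t • a - b) a) t := by
  unfold hform
  rw [Finset.mul_sum]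
  refine HasDerivAt.fun_sum fun i _ => ?_
  have h : HasDerivAt (fun t : ℝ => S.x v k i ω ⬝ᵥ (β + t • a - b)) (S.x v k i ω ⬝ᵥ a) t := by
    simp only [dotProduct_sub]
    exact (hasDerivAt_dotProduct_line _ _ _ _).sub_const _
  exact ((h.const_mul _).mul h).congr_deriv (by ring)

theorem hasDerivAt_fit_line (hd : IsCumulant d) (β a : Fin S.p → ℝ) (t : ℝ) :
    HasDerivAt (fun t : ℝ => S.fit d Bh u k ω (β + t • a)) (S.grad d Bh u k ω (β + t • a) a) t := by
  have h1 : HasDerivAt (fun t : ℝ => 1 / 2 * ∑ v ∈ Finset.Ico 1 u, S.hform d v k ω (Bh v k)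
      (β + t • a - Bh (u - 1) k) (β + t • a - Bh (u - 1) k))
      (1 / 2 * ∑ v ∈ Finset.Ico 1 u,
        2 * S.hform d v k ω (Bh v k) (β + t • a - Bh (u - 1) k) a) t :=
    (HasDerivAt.fun_sum fun v _ => hasDerivAt_hform_line _ _ _ _ _ _).const_mul _
  have h2 := (hasDerivAt_logLik_line (u := u) (k := k) (ω := ω) hd β a t).neg
  have h3 := h1.add h2
  refine (h3.congr_deriv ?_).congr_of_eventuallyEq (.of_forall fun s => ?_)
  · rw [grad_apply, ← Finset.mul_sum, ← Finset.sum_neg_distrib]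
    congr 1
    · ring
    · exact Finset.sum_congr rfl fun i _ => by ring
  · simp only [fit, Pi.add_apply, Pi.neg_apply, logLik, ← Finset.sum_neg_distrib]
    congr 1
    exact Finset.sum_congr rfl fun i _ => by ring

theorem hasDerivAt_grad_line (hd : IsCumulant d) (β a : Fin S.p → ℝ) (t : ℝ) :
    HasDerivAt (fun t : ℝ => S.grad d Bh u k ω (β + t • a) a)
      (∑ v ∈ Finset.Ico 1 u, S.hform d v k ω (Bh v k) a a + S.hform d u k ω (β + t • a) a a) t := by
  simp only [grad_apply]
  refine HasDerivAt.add (HasDerivAt.fun_sum fun v _ => ?_) ?_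
  · unfold hform
    refine HasDerivAt.fun_sum fun i _ => ?_
    have h : HasDerivAt (fun t : ℝ => S.x v k i ω ⬝ᵥ (β + t • a - Bh (u - 1) k))
        (S.x v k i ω ⬝ᵥ a) t := by
      simp only [dotProduct_sub]
      exact (hasDerivAt_dotProduct_line _ _ _ _).sub_const _
    exact (h.const_mul _).mul_const _
  · have := (hasDerivAt_score_line (u := u) (k := k) (ω := ω) hd β a a t).neg
    rw [neg_neg] at this
    refine this.congr_of_eventuallyEq (.of_forall fun s => ?_)
    simp only [Pi.neg_apply, ← Finset.sum_neg_distrib]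
    exact Finset.sum_congr rfl fun i _ => by ring

/-- Second-order lower bound for the loss, given a lower bound for the curvature of the current
batch along the segment. -/
theorem fit_add_ge (hd : IsCumulant d) (β a : Fin S.p → ℝ) {m : ℝ}
    (hm : ∀ t ∈ Set.Icc (0 : ℝ) 1, m ≤ S.hform d u k ω (β + t • a) a a) :
    S.fit d Bh u k ω β + S.grad d Bh u k ω β a +
      (∑ v ∈ Finset.Ico 1 u, S.hform d v k ω (Bh v k) a a + m) / 2 ≤ S.fit d Bh u k ω (β + a) := by
  have := add_deriv_add_half_le (hasDerivAt_fit_line (Bh := Bh) (u := u) (k := k) (ω := ω) hd β a)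
    (hasDerivAt_grad_line hd β a)
    (m := ∑ v ∈ Finset.Ico 1 u, S.hform d v k ω (Bh v k) a a + m)
    (fun t ht => by linarith [hm t ht])
  simpa using this

/-- The loss is convex: it lies above its tangents. -/
theorem fit_tangent (hd : IsCumulant d) (β a : Fin S.p → ℝ) :
    S.fit d Bh u k ω β + S.grad d Bh u k ω β a ≤ S.fit d Bh u k ω (β + a) := by
  have h := fit_add_ge (Bh := Bh) (u := u) (k := k) (ω := ω) hd β a (m := 0)
    fun t _ => hform_self_nonneg hd _ _
  have h2 : 0 ≤ ∑ v ∈ Finset.Ico 1 u, S.hform d v k ω (Bh v k) a a :=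
    Finset.sum_nonneg fun v _ => hform_self_nonneg hd _ _
  linarith

theorem continuous_fit (hd : IsCumulant d) : Continuous (S.fit d Bh u k ω) := by
  have h : Continuous d := continuous_iff_continuousAt.2 fun θ => (hd.hasDerivAt θ).continuousAt
  unfold fit hform
  simp only [dotProduct]
  fun_prop

/-- The gradient at `β`, expanded about the true coefficients by the mean value theorem. -/
theorem exists_grad_eq (hd : IsCumulant d) (β a : Fin S.p → ℝ) :
    ∃ t ∈ Set.Icc (0 : ℝ) 1, S.grad d Bh u k ω β a =
      ∑ v ∈ Finset.Ico 1 u, S.hform d v k ω (Bh v k) (β - Bh (u - 1) k) a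
        + S.hform d u k ω (S.beta k + t • (β - S.beta k)) (β - S.beta k) a
        - ∑ i, S.err d u k i ω * (S.x u k i ω ⬝ᵥ a) := by
  have h := fun t => hasDerivAt_score_line (u := u) (k := k) (ω := ω) hd (S.beta k)
    (β - S.beta k) a t
  obtain ⟨t, ht, e⟩ := exists_hasDerivAt_eq_slope _ _ (zero_lt_one' ℝ)
    (fun t _ => (h t).continuousAt.continuousWithinAt) (fun t _ => h t)
  refine ⟨t, ⟨ht.1.le, ht.2.le⟩, ?_⟩
  simp only [zero_smul, one_smul, add_zero, add_sub_cancel, sub_zero, div_one] at e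
  rw [grad_apply, add_sub_assoc]
  congr 1
  simp only [err]
  have e2 : ∑ i, (deriv d (S.x u k i ω ⬝ᵥ β) - S.y u k i ω) * (S.x u k i ω ⬝ᵥ a) =
      -∑ i, (S.y u k i ω - deriv d (S.x u k i ω ⬝ᵥ β)) * (S.x u k i ω ⬝ᵥ a) := by
    rw [← Finset.sum_neg_distrib]
    exact Finset.sum_congr rfl fun i _ => by ring
  rw [e2]
  linarith

/-- The variance function summed over a batch.  Where the linear predictor moves by at most one it
is controlled by its local maximum at the truth, and elsewhere by the quadratic form. -/
theorem sum_deriv2_le (hd : IsCumulant d) (β β₀ : Fin S.p → ℝ) :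
    ∑ i, iteratedDeriv 2 d (S.x u k i ω ⬝ᵥ β) ≤ ∑ i, varSup d (S.x u k i ω ⬝ᵥ β₀) +
      S.hform d u k ω β (β - β₀) (β - β₀) := by
  unfold hform
  rw [← Finset.sum_add_distrib]
  refine Finset.sum_le_sum fun i _ => ?_
  have e : S.x u k i ω ⬝ᵥ β = S.x u k i ω ⬝ᵥ β₀ + S.x u k i ω ⬝ᵥ (β - β₀) := by
    rw [dotProduct_sub]; ring
  have h0 := hd.nonneg (S.x u k i ω ⬝ᵥ β)
  rcases le_or_gt |S.x u k i ω ⬝ᵥ (β - β₀)| 1 with h | h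
  · have h1 := hd.le_varSup (S.x u k i ω ⬝ᵥ β₀) _ h
    rw [← e] at h1
    have h2 := mul_nonneg h0 (mul_self_nonneg (S.x u k i ω ⬝ᵥ (β - β₀)))
    linarith
  · have h1 := (hd.nonneg (S.x u k i ω ⬝ᵥ β₀ + 0)).trans
      (hd.le_varSup (S.x u k i ω ⬝ᵥ β₀) 0 (by simp))
    have h2 : 1 ≤ (S.x u k i ω ⬝ᵥ (β - β₀)) * (S.x u k i ω ⬝ᵥ (β - β₀)) := by
      rw [← abs_mul_abs_self]; nlinarith
    nlinarith

/-- The Hessian form between a coordinate direction and an arbitrary one. -/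
theorem abs_hform_single_le (hd : IsCumulant d) {Cx : ℝ} (hCx : 0 ≤ Cx) {j : Fin S.p}
    (hx : ∀ i, |S.x u k i ω j| ≤ Cx) (β β₀ a : Fin S.p → ℝ) :
    |S.hform d u k ω β a (Pi.single j 1)| ≤ Cx * Real.sqrt (∑ i, varSup d (S.x u k i ω ⬝ᵥ β₀) +
      S.hform d u k ω β (β - β₀) (β - β₀)) * Real.sqrt (S.hform d u k ω β a a) := by
  refine (abs_hform_le hd _ _ _).trans ?_
  rw [mul_comm]
  gcongr
  refine Real.sqrt_le_iff.2 ⟨by positivity, ?_⟩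
  rw [mul_pow, Real.sq_sqrt]
  · refine le_trans ?_ (mul_le_mul_of_nonneg_left (sum_deriv2_le hd β β₀) (sq_nonneg Cx))
    rw [Finset.mul_sum]
    refine Finset.sum_le_sum fun i _ => ?_
    have h1 : S.x u k i ω j * S.x u k i ω j ≤ Cx ^ 2 := by
      rw [← abs_mul_abs_self, sq]
      exact mul_le_mul (hx i) (hx i) (abs_nonneg _) hCx
    rw [dotProduct_single, mul_one, mul_assoc, mul_comm]
    exact mul_le_mul_of_nonneg_right h1 (hd.nonneg _)
  · exact (Finset.sum_nonneg fun i _ => hd.nonneg _).trans (sum_deriv2_le hd β β₀)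

end StreamModel

/-! ### Convex functions on a coordinate subspace -/

section ConvexMin

variable {ι : Type*} [Fintype ι] {h : (ι → ℝ) → ℝ} {L : (ι → ℝ) → (ι → ℝ) →ₗ[ℝ] ℝ}
  {A : Finset ι} {ξ : ι → ℝ} {r : ℝ}

/-- If a convex function exceeds its value at the center everywhere on a sphere, the points where
it does not exceed that value lie inside the sphere. -/
theorem l2_sub_lt_of_le (hL : ∀ β a, h β + L β a ≤ h (β + a)) (hξ : ∀ j ∉ A, ξ j = 0) (hr : 0 < r)
    (hs : ∀ a : ι → ℝ, (∀ j ∉ A, a j = 0) → l2 a = r → h ξ < h (ξ + a)) {β : ι → ℝ}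
    (hβ : ∀ j ∉ A, β j = 0) (hle : h β ≤ h ξ) : l2 (β - ξ) < r := by
  by_contra! hge
  set ρ := l2 (β - ξ) with hρ
  have hρ0 : 0 < ρ := hr.trans_le hge
  set t := r / ρ with ht
  have ht0 : 0 < t := div_pos hr hρ0
  have ht1 : t ≤ 1 := (div_le_one hρ0).2 hge
  set z := ξ + t • (β - ξ) with hz
  have h1 := hL z ((-t) • (β - ξ))
  have h2 := hL z ((1 - t) • (β - ξ))
  have e1 : z + (-t) • (β - ξ) = ξ := by rw [hz]; module
  have e2 : z + (1 - t) • (β - ξ) = β := by rw [hz]; module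
  rw [e1, map_smul, smul_eq_mul] at h1
  rw [e2, map_smul, smul_eq_mul] at h2
  have h3 : h ξ < h z := hs _ (fun j hj => by simp [hβ j hj, hξ j hj]) (by
    rw [l2_smul, abs_of_pos ht0, ← hρ, ht, div_mul_cancel₀ _ hρ0.ne'])
  nlinarith

theorem exists_min_of_sphere (hc : Continuous h) (hL : ∀ β a, h β + L β a ≤ h (β + a))
    (hξ : ∀ j ∉ A, ξ j = 0) (hr : 0 < r)
    (hs : ∀ a : ι → ℝ, (∀ j ∉ A, a j = 0) → l2 a = r → h ξ < h (ξ + a)) :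
    ∃ β : ι → ℝ, (∀ j ∉ A, β j = 0) ∧ ∀ β' : ι → ℝ, (∀ j ∉ A, β' j = 0) → h β ≤ h β' := by
  set K : Set (ι → ℝ) := {β | (∀ j ∉ A, β j = 0) ∧ l2 (β - ξ) ≤ r} with hK
  have hcomp : IsCompact K := by
    have hcl : IsClosed K := by
      have e : K = (⋂ j, ⋂ (_ : j ∉ A), {β | β j = 0}) ∩ {β | l2 (β - ξ) ≤ r} := by
        ext β; simp [hK]
      rw [e]
      refine IsClosed.inter (isClosed_iInter fun j => isClosed_iInter fun _ =>
        isClosed_eq (continuous_apply j) continuous_const) ?_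
      exact isClosed_le (continuous_l2.comp (continuous_id.sub continuous_const)) continuous_const
    refine (isCompact_closedBall ξ r).of_isClosed_subset hcl fun β hβ => ?_
    rw [Metric.mem_closedBall, dist_pi_le_iff hr.le]
    exact fun j => by
      rw [Real.dist_eq]
      exact (abs_le_l2 (β - ξ) j).trans hβ.2
  obtain ⟨β, hβ, hmin⟩ := hcomp.exists_isMinOn ⟨ξ, hξ, by simpa [l2_zero] using hr.le⟩
    hc.continuousOn
  have hξK : ξ ∈ K := ⟨hξ, by simpa [l2_zero] using hr.le⟩
  refine ⟨β, hβ.1, fun β' hβ' => ?_⟩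
  by_contra! hlt
  have h1 : h β' ≤ h ξ := hlt.le.trans (hmin hξK)
  have h2 := l2_sub_lt_of_le hL hξ hr hs hβ' h1
  exact absurd (hmin (a := β') ⟨hβ', h2.le⟩) (not_le.2 hlt)

omit [Fintype ι] in
/-- First-order condition on the subspace of vectors supported in `A`. -/
theorem stationary_of_min
    (hD : ∀ β a, HasDerivAt (fun t : ℝ => h (β + t • a)) (L β a) 0) {β : ι → ℝ}
    (hβ : ∀ j ∉ A, β j = 0) (hmin : ∀ β' : ι → ℝ, (∀ j ∉ A, β' j = 0) → h β ≤ h β') {a : ι → ℝ}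
    (ha : ∀ j ∉ A, a j = 0) : L β a = 0 := by
  refine IsLocalMin.hasDerivAt_eq_zero (f := fun t : ℝ => h (β + t • a)) (a := 0) ?_ (hD β a)
  refine .of_forall fun t => ?_
  simpa using hmin (β + t • a) fun j hj => by simp [hβ j hj, ha j hj]

end ConvexMin

namespace StreamModel

variable {G : ℕ} (S : StreamModel.{w} G)

/-- The loss of subgroup `g` as a function of its common coefficients. -/
def gfit (d : ℝ → ℝ) (Bh : ℕ → Fin S.K → Fin S.p → ℝ) (u : ℕ) (g : Fin G) (ω : S.Ω)
    (β : Fin S.p → ℝ) : ℝ :=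
  ∑ k ∈ S.members g, S.fit d Bh u k ω β

/-- The derivative of `gfit` at `β`, as a linear form. -/
def ggrad (d : ℝ → ℝ) (Bh : ℕ → Fin S.K → Fin S.p → ℝ) (u : ℕ) (g : Fin G) (ω : S.Ω)
    (β : Fin S.p → ℝ) : (Fin S.p → ℝ) →ₗ[ℝ] ℝ :=
  ∑ k ∈ S.members g, S.grad d Bh u k ω β

/-- `β` minimizes the loss of subgroup `g` among the vectors with the true support. -/
def IsGroupMin (d : ℝ → ℝ) (Bh : ℕ → Fin S.K → Fin S.p → ℝ) (u : ℕ) (g : Fin G) (ω : S.Ω)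
    (β : Fin S.p → ℝ) : Prop :=
  (∀ j ∉ S.A g, β j = 0) ∧
    ∀ β' : Fin S.p → ℝ, (∀ j ∉ S.A g, β' j = 0) → S.gfit d Bh u g ω β ≤ S.gfit d Bh u g ω β'

variable {S} {d : ℝ → ℝ} {ω : S.Ω} {Bh : ℕ → Fin S.K → Fin S.p → ℝ} {u : ℕ}

theorem ggrad_apply (g : Fin G) (β a : Fin S.p → ℝ) :
    S.ggrad d Bh u g ω β a = ∑ k ∈ S.members g, S.grad d Bh u k ω β a := by
  simp [ggrad]

theorem gfit_tangent (hd : IsCumulant d) (g : Fin G) (β a : Fin S.p → ℝ) :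
    S.gfit d Bh u g ω β + S.ggrad d Bh u g ω β a ≤ S.gfit d Bh u g ω (β + a) := by
  rw [ggrad_apply, gfit, gfit, ← Finset.sum_add_distrib]
  exact Finset.sum_le_sum fun k _ => fit_tangent hd β a

theorem continuous_gfit (hd : IsCumulant d) (g : Fin G) : Continuous (S.gfit d Bh u g ω) :=
  continuous_finsetSum _ fun _ _ => continuous_fit hd

theorem hasDerivAt_gfit_line (hd : IsCumulant d) (g : Fin G) (β a : Fin S.p → ℝ) :
    HasDerivAt (fun t : ℝ => S.gfit d Bh u g ω (β + t • a)) (S.ggrad d Bh u g ω β a) 0 := by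
  rw [ggrad_apply]
  refine HasDerivAt.fun_sum fun k _ => ?_
  simpa using hasDerivAt_fit_line (Bh := Bh) (u := u) (k := k) (ω := ω) hd β a 0

theorem IsGroupMin.stationary (hd : IsCumulant d) {g : Fin G} {β : Fin S.p → ℝ}
    (h : S.IsGroupMin d Bh u g ω β) {a : Fin S.p → ℝ} (ha : ∀ j ∉ S.A g, a j = 0) :
    S.ggrad d Bh u g ω β a = 0 :=
  stationary_of_min (hasDerivAt_gfit_line hd g) h.1 h.2 ha

theorem sum_eq_sum_members (f : Fin S.K → ℝ) :
    ∑ k, f k = ∑ g, ∑ k ∈ S.members g, f k :=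
  (Finset.sum_fiberwise Finset.univ S.grp f).symm

theorem loss_eq (hd : IsCumulant d) (B : Fin S.K → Fin S.p → ℝ) :
    S.loss d Bh u ω B = 1 / (S.N u : ℝ) * ∑ k, S.fit d Bh u k ω (B k) := by
  simp only [loss, approxLik_eq_neg_fit hd, Finset.sum_neg_distrib, neg_mul_neg]

theorem lossOr_eq (hd : IsCumulant d) (Xi : Fin G → Fin S.p → ℝ) :
    S.lossOr d Bh u ω Xi = 1 / (S.N u : ℝ) * ∑ g, S.gfit d Bh u g ω (Xi g) := by
  simp only [lossOr, approxLik_eq_neg_fit hd, Finset.sum_neg_distrib, neg_mul_neg, gfit]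

theorem loss_comp_grp (hd : IsCumulant d) (Xi : Fin G → Fin S.p → ℝ) :
    S.loss d Bh u ω (fun k => Xi (S.grp k)) = S.lossOr d Bh u ω Xi := by
  rw [loss_eq hd, lossOr_eq hd, sum_eq_sum_members]
  congr 1
  refine Finset.sum_congr rfl fun g _ => Finset.sum_congr rfl fun k hk => ?_
  rw [mem_members.1 hk]

theorem mem_MGB_iff (hs : Function.Surjective S.grp) {B : Fin S.K → Fin S.p → ℝ} :
    B ∈ S.MG ∩ S.MB ↔ ∃ Xi ∈ S.MA, B = fun k => Xi (S.grp k) := by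
  constructor
  · rintro ⟨h1, h2⟩
    refine ⟨fun g => B (Function.surjInv hs g), fun g j hj => ?_, ?_⟩
    · refine h2 _ j ?_
      change j ∉ S.A (S.grp (Function.surjInv hs g))
      rwa [Function.surjInv_eq hs]
    · ext1 k
      exact h1 _ _ (Function.surjInv_eq hs _).symm
  · rintro ⟨Xi, hXi, rfl⟩
    exact ⟨fun k₁ k₂ h => by simp only [h], fun k j hj => hXi _ j hj⟩

theorem isOracleXi_iff (hd : IsCumulant d) (hN : 0 < S.N u) {Xi : Fin G → Fin S.p → ℝ} :
    S.IsOracleXi d Bh u ω Xi ↔ ∀ g, S.IsGroupMin d Bh u g ω (Xi g) := by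
  have hN' : (0 : ℝ) < 1 / S.N u := by positivity
  constructor
  · rintro ⟨h1, h2⟩ g
    refine ⟨h1 g, fun β' hβ' => ?_⟩
    have h3 : Function.update Xi g β' ∈ S.MA := fun g' j hj => by
      rcases eq_or_ne g' g with rfl | hne
      · simpa using hβ' j hj
      · simpa [hne] using h1 g' j hj
    have h4 : S.lossOr d Bh u ω Xi ≤ S.lossOr d Bh u ω (Function.update Xi g β') := h2 h3
    rw [lossOr_eq hd, lossOr_eq hd, mul_le_mul_iff_right₀ hN',
      ← Finset.add_sum_erase _ _ (Finset.mem_univ g),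
      ← Finset.add_sum_erase _ (fun g' => S.gfit d Bh u g' ω (Function.update Xi g β' g'))
        (Finset.mem_univ g)] at h4
    have h5 : ∑ g' ∈ Finset.univ.erase g, S.gfit d Bh u g' ω (Function.update Xi g β' g') =
        ∑ g' ∈ Finset.univ.erase g, S.gfit d Bh u g' ω (Xi g') :=
      Finset.sum_congr rfl fun g' hg' => by
        rw [Function.update_of_ne (Finset.ne_of_mem_erase hg')]
    rw [h5, Function.update_self] at h4
    linarith
  · intro h
    refine ⟨fun g => (h g).1, fun Xi' hXi' => ?_⟩
    change S.lossOr d Bh u ω Xi ≤ S.lossOr d Bh u ω Xi'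
    rw [lossOr_eq hd, lossOr_eq hd, mul_le_mul_iff_right₀ hN']
    exact Finset.sum_le_sum fun g _ => (h g).2 _ (hXi' g)

theorem isOracle_iff (hd : IsCumulant d) (hs : Function.Surjective S.grp) (hN : 0 < S.N u)
    {B : Fin S.K → Fin S.p → ℝ} :
    S.IsOracle d Bh u ω B ↔
      ∃ Xi : Fin G → Fin S.p → ℝ, (∀ g, S.IsGroupMin d Bh u g ω (Xi g)) ∧
        B = fun k => Xi (S.grp k) := by
  simp only [← isOracleXi_iff (Bh := Bh) (ω := ω) hd hN]
  constructor
  · rintro ⟨h1, h2⟩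
    obtain ⟨Xi, hXi, rfl⟩ := (mem_MGB_iff hs).1 h1
    refine ⟨Xi, ⟨hXi, fun Xi' hXi' => ?_⟩, rfl⟩
    have h3 : S.loss d Bh u ω (fun k => Xi (S.grp k)) ≤ S.loss d Bh u ω fun k => Xi' (S.grp k) :=
      h2 ((mem_MGB_iff hs).2 ⟨Xi', hXi', rfl⟩)
    rwa [loss_comp_grp hd, loss_comp_grp hd] at h3
  · rintro ⟨Xi, ⟨h1, h2⟩, rfl⟩
    refine ⟨(mem_MGB_iff hs).2 ⟨Xi, h1, rfl⟩, fun B' hB' => ?_⟩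
    obtain ⟨Xi', hXi', rfl⟩ := (mem_MGB_iff hs).1 hB'
    change S.loss d Bh u ω _ ≤ S.loss d Bh u ω _
    rw [loss_comp_grp hd, loss_comp_grp hd]
    exact h2 hXi'

end StreamModel

/-! ### Strict local minimality of the oracle estimate -/

/-- Near zero the penalty exceeds half of its linear approximation. -/
theorem IsPenalty.exists_half_le {a : ℝ} {ρ : ℝ → ℝ → ℝ} (h : IsPenalty a ρ) {lam : ℝ}
    (hl : 0 < lam) : ∃ t₀ > 0, ∀ t, 0 ≤ t → t < t₀ → lam / 2 * t ≤ ρ t lam := by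
  obtain ⟨ρ', -, h0, hder⟩ := h.deriv lam hl
  have hd := hder 0 le_rfl
  rw [h0, hasDerivWithinAt_iff_tendsto_slope] at hd
  have h1 := hd.eventually (lt_mem_nhds (half_lt_self hl))
  have h2 : Set.Ici (0 : ℝ) \ {0} = Set.Ioi 0 := by
    ext t; simp [lt_iff_le_and_ne, eq_comm]
  rw [h2] at h1
  obtain ⟨t₀, ht₀, hsub⟩ := mem_nhdsGT_iff_exists_Ioo_subset.1 h1
  refine ⟨t₀, ht₀, fun t ht0 ht => ?_⟩
  rcases ht0.eq_or_lt with rfl | hpos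
  · simp [h.zero lam hl]
  · have h3 : lam / 2 < slope (fun x => ρ x lam) 0 t := hsub ⟨hpos, ht⟩
    rw [slope_def_field, h.zero lam hl, sub_zero, sub_zero, lt_div_iff₀ hpos] at h3
    exact h3.le

namespace StreamModel

variable {G : ℕ} {S : StreamModel.{w} G} {d : ℝ → ℝ} {ω : S.Ω}
  {Bh : ℕ → Fin S.K → Fin S.p → ℝ} {u : ℕ}

variable (S) in
/-- The first source of the subgroup of source `k`. -/
def rep (k : Fin S.K) : Fin S.K := (S.members (S.grp k)).min' ⟨k, mem_members.2 rfl⟩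

theorem grp_rep (k : Fin S.K) : S.grp (S.rep k) = S.grp k :=
  mem_members.1 (Finset.min'_mem _ _)

theorem rep_le (k : Fin S.K) : S.rep k ≤ k := Finset.min'_le _ _ (mem_members.2 rfl)

theorem rep_eq {k k' : Fin S.K} (h : S.grp k = S.grp k') : S.rep k = S.rep k' := by
  unfold rep; simp only [h]

/-- Comparing all sources of a subgroup with its first one costs no more than comparing all pairs
of sources within subgroups. -/
theorem sum_l2_rep_le (B : Fin S.K → Fin S.p → ℝ) :
    ∑ k, l2 (B k - B (S.rep k)) ≤ ∑ k₂, ∑ k₁ ∈ Finset.univ.filter (fun k₁ => k₁ < k₂),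
      if S.grp k₁ = S.grp k₂ then l2 (B k₁ - B k₂) else 0 := by
  have hnn : ∀ k₁ k₂, 0 ≤ if S.grp k₁ = S.grp k₂ then l2 (B k₁ - B k₂) else 0 := fun k₁ k₂ => by
    split_ifs
    exacts [l2_nonneg _, le_rfl]
  refine Finset.sum_le_sum fun k _ => ?_
  rcases (rep_le k).eq_or_lt with h | h
  · rw [h, sub_self, l2_zero]
    exact Finset.sum_nonneg fun k₁ _ => hnn _ _
  · refine le_trans (le_of_eq ?_) (Finset.single_le_sum
      (f := fun k₁ => if S.grp k₁ = S.grp k then l2 (B k₁ - B k) else 0) (fun k₁ _ => hnn k₁ k)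
      (Finset.mem_filter.2 ⟨Finset.mem_univ (S.rep k), h⟩))
    simp only [grp_rep, if_true]
    exact l2_sub_comm _ _

/-- Linearized change of the loss at an oracle estimate.  The components along important variables
are compared with those of the first source of the subgroup, since the gradients of a subgroup add
up to zero there. -/
theorem sum_grad_ge {Xi : Fin G → Fin S.p → ℝ} (hd : IsCumulant d)
    (hmin : ∀ g, S.IsGroupMin d Bh u g ω (Xi g)) {m1 m2 : ℝ} (hm2 : 0 ≤ m2)
    (hg1 : ∀ k, ∀ j ∉ S.suppB k, |S.grad d Bh u k ω (Xi (S.grp k)) (Pi.single j 1)| ≤ m1)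
    (hg2 : ∀ k, ∀ a : Fin S.p → ℝ, (∀ j ∉ S.suppB k, a j = 0) →
      |S.grad d Bh u k ω (Xi (S.grp k)) a| ≤ m2 * l2 a) (D : Fin S.K → Fin S.p → ℝ) :
    -(m1 * ∑ k, ∑ j, if j ∈ S.suppB k then 0 else |D k j|) -
      m2 * (∑ k, l2 (D k - D (S.rep k))) ≤ ∑ k, S.grad d Bh u k ω (Xi (S.grp k)) (D k) := by
  -- the parts of a vector on and off the support of source `k`
  set on : Fin S.K → (Fin S.p → ℝ) → Fin S.p → ℝ := fun k v j =>
    if j ∈ S.suppB k then v j else 0 with hon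
  set off : Fin S.K → (Fin S.p → ℝ) → Fin S.p → ℝ := fun k v j =>
    if j ∈ S.suppB k then 0 else v j with hoff
  have hsplit : ∀ k v, v = off k v + (on k (v - D (S.rep k)) + on k (D (S.rep k))) := by
    intro k v
    ext j
    by_cases hj : j ∈ S.suppB k <;> simp [hon, hoff, hj]
  have hzero : ∑ k, S.grad d Bh u k ω (Xi (S.grp k)) (on k (D (S.rep k))) = 0 := by
    rw [sum_eq_sum_members]
    refine Finset.sum_eq_zero fun g _ => ?_
    rcases (S.members g).eq_empty_or_nonempty with he | ⟨k₀, hk₀⟩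
    · simp [he]
    · have h0 := (hmin g).stationary hd (a := on k₀ (D (S.rep k₀))) fun j hj => by
        have : j ∉ S.suppB k₀ := by
          change j ∉ S.A (S.grp k₀)
          rwa [mem_members.1 hk₀]
        simp [hon, this]
      rw [ggrad_apply] at h0
      rw [← h0]
      refine Finset.sum_congr rfl fun k hk => ?_
      have e : S.grp k = S.grp k₀ := (mem_members.1 hk).trans (mem_members.1 hk₀).symm
      have e2 : S.suppB k = S.suppB k₀ := by
        change S.A (S.grp k) = S.A (S.grp k₀)
        rw [e]
      simp only [hon, rep_eq e, e2, mem_members.1 hk]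
  have hoffb : ∀ k, -(m1 * ∑ j, if j ∈ S.suppB k then 0 else |D k j|) ≤
      S.grad d Bh u k ω (Xi (S.grp k)) (off k (D k)) := by
    intro k
    rw [LinearMap.pi_apply_eq_sum_univ, Finset.mul_sum, ← Finset.sum_neg_distrib]
    refine Finset.sum_le_sum fun j _ => ?_
    by_cases hj : j ∈ S.suppB k
    · simp [hoff, hj]
    · have h1 := hg1 k j hj
      have e : (fun l => if j = l then (1 : ℝ) else 0) = Pi.single j 1 := by
        ext l; simp [Pi.single_apply, eq_comm]
      simp only [hoff, hj, if_false, e, smul_eq_mul]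
      have h2 := neg_abs_le (D k j * S.grad d Bh u k ω (Xi (S.grp k)) (Pi.single j 1))
      rw [abs_mul] at h2
      nlinarith [mul_le_mul_of_nonneg_left h1 (abs_nonneg (D k j))]
  have honb : ∀ k, -(m2 * l2 (D k - D (S.rep k))) ≤
      S.grad d Bh u k ω (Xi (S.grp k)) (on k (D k - D (S.rep k))) := by
    intro k
    have h1 := hg2 k (on k (D k - D (S.rep k))) fun j hj => by simp [hon, hj]
    have h2 : l2 (on k (D k - D (S.rep k))) ≤ l2 (D k - D (S.rep k)) := by
      refine Real.sqrt_le_sqrt (Finset.sum_le_sum fun j _ => ?_)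
      by_cases hj : j ∈ S.suppB k
      · simp [hon, hj]
      · simpa [hon, hj] using sq_nonneg (D k j - D (S.rep k) j)
    have h3 := mul_le_mul_of_nonneg_left h2 hm2
    linarith [(abs_le.1 h1).1]
  calc _ = ∑ k, (-(m1 * ∑ j, if j ∈ S.suppB k then 0 else |D k j|) +
        -(m2 * l2 (D k - D (S.rep k)))) := by
        rw [Finset.sum_add_distrib, Finset.sum_neg_distrib, Finset.sum_neg_distrib,
          Finset.mul_sum, Finset.mul_sum]
        ring
    _ ≤ ∑ k, (S.grad d Bh u k ω (Xi (S.grp k)) (off k (D k)) +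
        S.grad d Bh u k ω (Xi (S.grp k)) (on k (D k - D (S.rep k)))) :=
        Finset.sum_le_sum fun k _ => add_le_add (hoffb k) (honb k)
    _ = ∑ k, (S.grad d Bh u k ω (Xi (S.grp k)) (off k (D k)) +
        S.grad d Bh u k ω (Xi (S.grp k)) (on k (D k - D (S.rep k)))) +
        ∑ k, S.grad d Bh u k ω (Xi (S.grp k)) (on k (D (S.rep k))) := by rw [hzero, add_zero]
    _ = _ := by
        rw [← Finset.sum_add_distrib]
        refine Finset.sum_congr rfl fun k _ => ?_
        conv_rhs => rw [hsplit k (D k), map_add, map_add]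
        ring

/-- The oracle estimate is a strict local minimizer of the penalized objective if it is unique, its
nonzero coefficients and subgroup differences lie where the penalty is flat, and its gradient is
dominated by the slopes of the penalty at zero. -/
theorem isStrictLocalMin_of_oracle {a : ℝ} {ρ : ℝ → ℝ → ℝ} (hρ : IsPenalty a ρ)
    (hd : IsCumulant d) (hs : Function.Surjective S.grp) (hN : 0 < S.N u)
    {Xi : Fin G → Fin S.p → ℝ} (hmin : ∀ g, S.IsGroupMin d Bh u g ω (Xi g))
    (huniq : ∀ g β, S.IsGroupMin d Bh u g ω β → β = Xi g)
    (hl1 : 0 < S.lam1 u) (hl2 : 0 < S.lam2 u)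
    (hbig1 : ∀ g, ∀ j ∈ S.A g, a * S.lam1 u < |Xi g j|)
    (hbig2 : ∀ g₁ g₂, g₁ ≠ g₂ → a * S.lam2 u < l2 (Xi g₁ - Xi g₂))
    (hg1 : ∀ k, ∀ j ∉ S.suppB k,
      |S.grad d Bh u k ω (Xi (S.grp k)) (Pi.single j 1)| ≤ S.N u * (S.lam1 u / 4))
    (hg2 : ∀ k, ∀ a : Fin S.p → ℝ, (∀ j ∉ S.suppB k, a j = 0) →
      |S.grad d Bh u k ω (Xi (S.grp k)) a| ≤ S.N u * (S.lam2 u / 4) * l2 a) :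
    IsStrictLocalMin (S.Qon d ρ Bh u ω) fun k => Xi (S.grp k) := by
  set Bo : Fin S.K → Fin S.p → ℝ := fun k => Xi (S.grp k) with hBo
  have hNr : (0 : ℝ) < S.N u := by exact_mod_cast hN
  have hor : S.IsOracle d Bh u ω Bo := (isOracle_iff hd hs hN).2 ⟨Xi, hmin, rfl⟩
  obtain ⟨t1, ht1, hp1⟩ := hρ.exists_half_le hl1
  obtain ⟨t2, ht2, hp2⟩ := hρ.exists_half_le hl2
  have hcoord : ∀ k j, Continuous fun B : Fin S.K → Fin S.p → ℝ => |B k j| := fun k j => by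
    fun_prop
  have hdiff : ∀ k₁ k₂, Continuous fun B : Fin S.K → Fin S.p → ℝ => l2 (B k₁ - B k₂) :=
    fun k₁ k₂ => continuous_l2.comp (by fun_prop)
  have E1 : ∀ᶠ B in 𝓝 Bo, ∀ k j, j ∈ S.suppB k → a * S.lam1 u < |B k j| := by
    refine eventually_all.2 fun k => eventually_all.2 fun j => ?_
    by_cases hj : j ∈ S.suppB k
    · filter_upwards [(hcoord k j).continuousAt.eventually (lt_mem_nhds (hbig1 (S.grp k) j hj))]
        with B hB _ using hB
    · exact .of_forall fun B h => absurd h hj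
  have E2 : ∀ᶠ B in 𝓝 Bo, ∀ k₁ k₂, S.grp k₁ ≠ S.grp k₂ → a * S.lam2 u < l2 (B k₁ - B k₂) := by
    refine eventually_all.2 fun k₁ => eventually_all.2 fun k₂ => ?_
    by_cases hk : S.grp k₁ = S.grp k₂
    · exact .of_forall fun B h => absurd hk h
    · filter_upwards [(hdiff k₁ k₂).continuousAt.eventually (lt_mem_nhds (hbig2 _ _ hk))]
        with B hB _ using hB
  have E3 : ∀ᶠ B in 𝓝 Bo, ∀ k j, j ∉ S.suppB k → |B k j| < t1 := by
    refine eventually_all.2 fun k => eventually_all.2 fun j => ?_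
    by_cases hj : j ∈ S.suppB k
    · exact .of_forall fun B h => absurd hj h
    · have h0 : |Bo k j| < t1 := by simpa [hor.1.2 k j hj] using ht1
      filter_upwards [(hcoord k j).continuousAt.eventually (gt_mem_nhds h0)] with B hB _ using hB
  have E4 : ∀ᶠ B in 𝓝 Bo, ∀ k₁ k₂, S.grp k₁ = S.grp k₂ → l2 (B k₁ - B k₂) < t2 := by
    refine eventually_all.2 fun k₁ => eventually_all.2 fun k₂ => ?_
    by_cases hk : S.grp k₁ = S.grp k₂
    · have h0 : l2 (Bo k₁ - Bo k₂) < t2 := by simpa [hor.1.1 k₁ k₂ hk, l2_zero] using ht2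
      filter_upwards [(hdiff k₁ k₂).continuousAt.eventually (gt_mem_nhds h0)] with B hB _ using hB
    · exact .of_forall fun B h => absurd h hk
  have E : ∀ᶠ B in 𝓝[≠] Bo, B ≠ Bo := eventually_mem_nhdsWithin
  filter_upwards [E, E1.filter_mono nhdsWithin_le_nhds, E2.filter_mono nhdsWithin_le_nhds,
    E3.filter_mono nhdsWithin_le_nhds, E4.filter_mono nhdsWithin_le_nhds] with B hB h1 h2 h3 h4
  set P1 := ∑ k, ∑ j, if j ∈ S.suppB k then 0 else |B k j| with hP1
  set P2 := ∑ k₂, ∑ k₁ ∈ Finset.univ.filter (fun k₁ => k₁ < k₂),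
      if S.grp k₁ = S.grp k₂ then l2 (B k₁ - B k₂) else 0 with hP2
  have hnn1 : ∀ k j, 0 ≤ if j ∈ S.suppB k then 0 else |B k j| := fun k j => by
    split_ifs
    exacts [le_rfl, abs_nonneg _]
  have hnn2 : ∀ k₁ k₂, 0 ≤ if S.grp k₁ = S.grp k₂ then l2 (B k₁ - B k₂) else 0 := fun k₁ k₂ => by
    split_ifs
    exacts [l2_nonneg _, le_rfl]
  have hP1n : 0 ≤ P1 := Finset.sum_nonneg fun k _ => Finset.sum_nonneg fun j _ => hnn1 k j
  have hP2n : 0 ≤ P2 := Finset.sum_nonneg fun k _ => Finset.sum_nonneg fun j _ => hnn2 _ _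
  have hpen1 : ∑ k, ∑ j, ρ |Bo k j| (S.lam1 u) + S.lam1 u / 2 * P1 ≤
      ∑ k, ∑ j, ρ |B k j| (S.lam1 u) := by
    simp only [hP1, Finset.mul_sum, ← Finset.sum_add_distrib]
    refine Finset.sum_le_sum fun k _ => Finset.sum_le_sum fun j _ => ?_
    by_cases hj : j ∈ S.suppB k
    · rw [hρ.const _ hl1 |Bo k j| (by rw [abs_abs]; exact (hbig1 (S.grp k) j hj).le),
        hρ.const _ hl1 |B k j| (by rw [abs_abs]; exact (h1 k j hj).le)]
      simp [hj]
    · rw [hor.1.2 k j hj, abs_zero, hρ.zero _ hl1]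
      simpa [hj] using hp1 _ (abs_nonneg _) (h3 k j hj)
  have hpen2 : ∑ k₂, ∑ k₁ ∈ Finset.univ.filter (fun k₁ => k₁ < k₂),
        ρ (l2 (Bo k₁ - Bo k₂)) (S.lam2 u) + S.lam2 u / 2 * P2 ≤
      ∑ k₂, ∑ k₁ ∈ Finset.univ.filter (fun k₁ => k₁ < k₂), ρ (l2 (B k₁ - B k₂)) (S.lam2 u) := by
    simp only [hP2, Finset.mul_sum, ← Finset.sum_add_distrib]
    refine Finset.sum_le_sum fun k₂ _ => Finset.sum_le_sum fun k₁ _ => ?_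
    by_cases hk : S.grp k₁ = S.grp k₂
    · rw [hor.1.1 k₁ k₂ hk, sub_self, l2_zero, hρ.zero _ hl2]
      simpa [hk] using hp2 _ (l2_nonneg _) (h4 k₁ k₂ hk)
    · rw [hρ.const _ hl2 (l2 (Bo k₁ - Bo k₂)) (by
          rw [abs_of_nonneg (l2_nonneg _)]; exact (hbig2 _ _ hk).le),
        hρ.const _ hl2 (l2 (B k₁ - B k₂)) (by
          rw [abs_of_nonneg (l2_nonneg _)]; exact (h2 k₁ k₂ hk).le)]
      simp [hk]
  have hlin := sum_grad_ge (ω := ω) hd hmin (by positivity) hg1 hg2 fun k => B k - Bo k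
  have e1 : ∑ k, ∑ j, (if j ∈ S.suppB k then 0 else |(B k - Bo k) j|) = P1 := by
    refine Finset.sum_congr rfl fun k _ => Finset.sum_congr rfl fun j _ => ?_
    by_cases hj : j ∈ S.suppB k
    · simp [hj]
    · simp [hj, hor.1.2 k j hj]
  have e2 : ∑ k, l2 (B k - Bo k - (B (S.rep k) - Bo (S.rep k))) ≤ P2 := by
    refine le_trans (le_of_eq (Finset.sum_congr rfl fun k _ => ?_)) (sum_l2_rep_le B)
    rw [hor.1.1 (S.rep k) k (grp_rep k), sub_sub_sub_cancel_right]
  have hloss : S.loss d Bh u ω Bo - S.lam1 u / 4 * P1 - S.lam2 u / 4 * P2 ≤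
      S.loss d Bh u ω B := by
    have h5 : ∑ k, S.fit d Bh u k ω (Bo k) + ∑ k, S.grad d Bh u k ω (Bo k) (B k - Bo k) ≤
        ∑ k, S.fit d Bh u k ω (B k) := by
      rw [← Finset.sum_add_distrib]
      refine Finset.sum_le_sum fun k _ => ?_
      simpa using fit_tangent (Bh := Bh) (u := u) (ω := ω) hd (Bo k) (B k - Bo k)
    simp only [e1] at hlin
    have h6 := mul_le_mul_of_nonneg_left e2 (by positivity : 0 ≤ (S.N u : ℝ) * (S.lam2 u / 4))
    have h7 : ∑ k, S.fit d Bh u k ω (Bo k) - S.N u * (S.lam1 u / 4) * P1 -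
        S.N u * (S.lam2 u / 4) * P2 ≤ ∑ k, S.fit d Bh u k ω (B k) := by linarith
    rw [loss_eq hd, loss_eq hd]
    have h8 := mul_le_mul_of_nonneg_left h7 (by positivity : 0 ≤ 1 / (S.N u : ℝ))
    refine le_trans (le_of_eq ?_) h8
    field_simp
  unfold Qon
  by_cases hz : 0 < P1 ∨ 0 < P2
  · have h9 : 0 < S.lam1 u / 4 * P1 + S.lam2 u / 4 * P2 := by
      rcases hz with hz | hz <;> positivity
    linarith
  · -- without a penalty gain, `B` lies in the oracle space, where the minimizer is unique
    push Not at hz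
    have z1 : P1 = 0 := le_antisymm hz.1 hP1n
    have z2 : P2 = 0 := le_antisymm hz.2 hP2n
    have hMB : B ∈ S.MB := fun k j hj => by
      have h10 := (Finset.sum_eq_zero_iff_of_nonneg fun k _ =>
        Finset.sum_nonneg fun j _ => hnn1 k j).1 z1 k (Finset.mem_univ _)
      have h11 := (Finset.sum_eq_zero_iff_of_nonneg fun j _ => hnn1 k j).1 h10 j (Finset.mem_univ _)
      simpa [hj] using h11
    have hlt : ∀ k₁ k₂, k₁ < k₂ → S.grp k₁ = S.grp k₂ → B k₁ = B k₂ := fun k₁ k₂ hlt hk => by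
      have h10 := (Finset.sum_eq_zero_iff_of_nonneg fun k₂ _ =>
        Finset.sum_nonneg fun k₁ _ => hnn2 k₁ k₂).1 z2 k₂ (Finset.mem_univ _)
      have h11 := (Finset.sum_eq_zero_iff_of_nonneg fun k₁ _ => hnn2 k₁ k₂).1 h10 k₁
        (Finset.mem_filter.2 ⟨Finset.mem_univ _, hlt⟩)
      rw [if_pos hk] at h11
      by_contra hne
      exact (l2_pos (sub_ne_zero.2 hne)).ne' h11
    have hMG : B ∈ S.MG := fun k₁ k₂ hk => by
      rcases lt_trichotomy k₁ k₂ with h | h | h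
      · exact hlt _ _ h hk
      · rw [h]
      · exact (hlt _ _ h hk.symm).symm
    have hlossB : S.loss d Bh u ω Bo < S.loss d Bh u ω B := by
      refine lt_of_le_of_ne (hor.2 ⟨hMG, hMB⟩) fun heq => hB ?_
      have horB : S.IsOracle d Bh u ω B := ⟨⟨hMG, hMB⟩, fun B' hB' => by
        change S.loss d Bh u ω B ≤ S.loss d Bh u ω B'
        rw [← heq]
        exact hor.2 hB'⟩
      obtain ⟨Xi', hXi', rfl⟩ := (isOracle_iff hd hs hN).1 horB
      ext1 k
      exact huniq _ _ (hXi' _)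
    rw [z1] at hpen1
    rw [z2] at hpen2
    linarith

end StreamModel

/-! ### Sample sizes and rates -/

theorem mul_sqrt_div_self {x : ℝ} (N : ℝ) (hx : 0 ≤ x) :
    N * Real.sqrt (x / N) = Real.sqrt (x * N) := by
  rw [Real.sqrt_div hx, Real.sqrt_mul hx, mul_div_left_comm, Real.div_sqrt]

theorem sqrt_mul_sqrt_div_le {n N x : ℝ} (h : n ≤ N) :
    Real.sqrt n * Real.sqrt (x / N) ≤ Real.sqrt x := by
  rcases le_or_gt N 0 with hN | hN
  · rw [Real.sqrt_eq_zero_of_nonpos (h.trans hN), zero_mul]; exact Real.sqrt_nonneg _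
  · calc _ ≤ Real.sqrt N * Real.sqrt (x / N) := by gcongr
      _ = Real.sqrt x := by
        rw [← Real.sqrt_mul hN.le, mul_div_cancel₀ _ hN.ne']

theorem le_mul_sqrt_div {N x : ℝ} (hN : 0 ≤ N) {m r : ℝ} (hx : 0 ≤ x) (hm : 0 < m)
    (hmN : m ≤ N) (hr : Real.sqrt (x / m) ≤ r) : Real.sqrt (x * N) ≤ N * r := by
  rw [← mul_sqrt_div_self N hx]
  gcongr
  refine le_trans (Real.sqrt_le_sqrt ?_) hr
  gcongr

namespace StreamModel

variable {G : ℕ} (S : StreamModel.{w} G)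

/-- The complexity `log (p K) + s` in the condition on the sparsity tuning parameters. -/
def logDim : ℝ := Real.log (S.p * S.K) + S.s

/-- The subgroup rate `√(s / N_u^{(g)})`. -/
def grate (u : ℕ) (g : Fin G) : ℝ := Real.sqrt ((S.s : ℝ) / (S.Ng u g : ℝ))

/-- All batches are nonempty, and in each batch the sample sizes of the sources agree up to the
factor `γ`. -/
structure Balanced (γ : ℝ) (b : ℕ) : Prop where
  pos : ∀ u ∈ Finset.Icc 1 b, ∀ k, 0 < S.n u k
  le : ∀ u ∈ Finset.Icc 1 b, ∀ k k', (S.n u k : ℝ) ≤ γ * S.n u k'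

variable {S}

theorem log_mul_nonneg : 0 ≤ Real.log (S.p * S.K) := by
  rw [← Nat.cast_mul]; exact Real.log_natCast_nonneg _

theorem s_le_logDim : (S.s : ℝ) ≤ S.logDim := le_add_of_nonneg_left log_mul_nonneg

theorem grate_nonneg (u : ℕ) (g : Fin G) : 0 ≤ S.grate u g := Real.sqrt_nonneg _

theorem n_le_Nk {u v : ℕ} (hv : v ∈ Finset.Icc 1 u) (k : Fin S.K) : S.n v k ≤ S.Nk u k :=
  Finset.single_le_sum (f := fun v => S.n v k) (fun _ _ => Nat.zero_le _) hv

theorem Nk_mono {u v : ℕ} (h : v ≤ u) (k : Fin S.K) : S.Nk v k ≤ S.Nk u k :=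
  Finset.sum_le_sum_of_subset (Finset.Icc_subset_Icc_right h)

theorem Nk_le_Ng (u : ℕ) (k : Fin S.K) : S.Nk u k ≤ S.Ng u (S.grp k) :=
  Finset.single_le_sum (f := fun k => S.Nk u k) (fun _ _ => Nat.zero_le _) (mem_members.2 rfl)

theorem Ng_mono {u v : ℕ} (h : v ≤ u) (g : Fin G) : S.Ng v g ≤ S.Ng u g :=
  Finset.sum_le_sum fun k _ => Nk_mono h k

theorem Ng_le_N (u : ℕ) (g : Fin G) : S.Ng u g ≤ S.N u :=
  Finset.sum_le_sum_of_subset (Finset.subset_univ _)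

theorem Nbar_le_Ng (u : ℕ) (g : Fin G) : S.Nbar u ≤ S.Ng u g :=
  ciInf_le (OrderBot.bddBelow _) g

theorem Ng_pos {γ : ℝ} {b : ℕ} (h : S.Balanced γ b) (hs : Function.Surjective S.grp) {u : ℕ}
    (hu : u ∈ Finset.Icc 1 b) (g : Fin G) : 0 < S.Ng u g := by
  obtain ⟨k, rfl⟩ := hs g
  have h1 := h.pos u hu k
  have h2 := n_le_Nk (S := S) (Finset.mem_Icc.2 ⟨(Finset.mem_Icc.1 hu).1, le_rfl⟩) k
  exact (h1.trans_le h2).trans_le (Nk_le_Ng u k)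

theorem Nbar_pos [Nonempty (Fin G)] {γ : ℝ} {b : ℕ} (h : S.Balanced γ b)
    (hs : Function.Surjective S.grp) {u : ℕ} (hu : u ∈ Finset.Icc 1 b) : 0 < S.Nbar u := by
  obtain ⟨g, hg⟩ := exists_eq_ciInf_of_finite (f := S.Ng u)
  rw [Nbar, ← hg]
  exact Ng_pos h hs hu g

theorem Nk_eq {u : ℕ} (hu : 1 ≤ u) (k : Fin S.K) :
    S.Nk u k = S.Nk (u - 1) k + S.n u k := by
  obtain ⟨u, rfl⟩ : ∃ v, u = v + 1 := ⟨u - 1, by omega⟩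
  exact Finset.sum_Icc_succ_top (by omega) _

theorem sum_Ico_n {u : ℕ} (hu : 1 ≤ u) (k : Fin S.K) :
    ∑ v ∈ Finset.Ico 1 u, (S.n v k : ℝ) = S.Nk (u - 1) k := by
  obtain ⟨u, rfl⟩ : ∃ v, u = v + 1 := ⟨u - 1, by omega⟩
  simp [Nk, Finset.Ico_add_one_right_eq_Icc]

theorem Ng_mul_grate (u : ℕ) (g : Fin G) :
    (S.Ng u g : ℝ) * S.grate u g = Real.sqrt (S.s * S.Ng u g) :=
  mul_sqrt_div_self _ (Nat.cast_nonneg _)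

theorem sqrt_mul_grate_le {u v : ℕ} {k : Fin S.K} (h : v ∈ Finset.Icc 1 u) :
    Real.sqrt (S.n v k) * S.grate u (S.grp k) ≤ Real.sqrt S.s :=
  sqrt_mul_sqrt_div_le (by exact_mod_cast (n_le_Nk h k).trans (Nk_le_Ng u k))

/-! ### Realizations with regular designs and small scores -/

variable (S) in
/-- The realized designs are bounded with well-conditioned weighted Gram matrices, and the scores
and summed variance functions have their stochastic orders with constant `M`. -/
structure GoodSample (d : ℝ → ℝ) (Cx c1 C1 M : ℝ) (b : ℕ) (ω : S.Ω) : Prop where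
  bdd : S.BoundedCov Cx b ω
  formMin : ∀ u ∈ Finset.Icc 1 b, ∀ k, ∀ β : Fin S.p → ℝ, (∀ j ∉ S.suppB k, β j = 0) →
    l2 (β - S.beta k) ≤ S.d1 / 2 → ∀ a : Fin S.p → ℝ, (∀ j ∉ S.suppB k, a j = 0) →
      c1 * S.n u k * l2 a ^ 2 ≤ S.hform d u k ω β a a
  formMax : ∀ u ∈ Finset.Icc 1 b, ∀ k, ∀ β : Fin S.p → ℝ, (∀ j ∉ S.suppB k, β j = 0) →
    l2 (β - S.beta k) ≤ S.d1 / 2 → ∀ a : Fin S.p → ℝ, (∀ j ∉ S.suppB k, a j = 0) →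
      S.hform d u k ω β a a ≤ C1 * S.n u k * l2 a ^ 2
  card_le : ∀ u ∈ Finset.Icc 1 b, ∀ k, (S.suppB k).card ≤ S.n u k
  score : ∀ u ∈ Finset.Icc 1 b, ∀ k j,
    |∑ i, S.x u k i ω j * S.err d u k i ω| ≤ M * Real.sqrt (S.n u k * S.logDim)
  scoreSq : ∀ u ∈ Finset.Icc 1 b, ∀ k, ∑ j ∈ S.suppB k,
    (∑ i, S.x u k i ω j * S.err d u k i ω) ^ 2 ≤
      M ^ 2 * (S.s * ∑ k' ∈ S.members (S.grp k), (S.n u k' : ℝ))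
  groupScore : ∀ u ∈ Finset.Icc 1 b, ∀ g, ∑ j ∈ S.A g,
    (∑ k ∈ S.members g, ∑ i, S.x u k i ω j * S.err d u k i ω) ^ 2 ≤
      M ^ 2 * (S.s * ∑ k ∈ S.members g, (S.n u k : ℝ))
  varSum : ∀ u ∈ Finset.Icc 1 b, ∀ k,
    ∑ i, varSup d (S.x u k i ω ⬝ᵥ S.beta k) ≤ M * (S.n u k + S.logDim)

theorem XA_mulVec {u : ℕ} {k : Fin S.K} {g : Fin G} {ω : S.Ω} {β : Fin S.p → ℝ}
    (hβ : ∀ j ∉ S.A g, β j = 0) (i : Fin (S.n u k)) :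
    (S.XA u k g ω *ᵥ fun j => β j) i = S.x u k i ω ⬝ᵥ β := by
  simp only [XA, mulVec, dotProduct, Matrix.of_apply]
  rw [Finset.sum_coe_sort (S.A g) fun j => S.x u k i ω j * β j]
  exact Finset.sum_subset (Finset.subset_univ _) fun j _ hj => by simp [hβ j hj]

theorem dotProduct_gram_mulVec {m n : Type*} [Fintype m] [Fintype n] [DecidableEq m]
    (X : Matrix m n ℝ) (D : m → ℝ) (v : n → ℝ) :
    v ⬝ᵥ ((Xᵀ * Matrix.diagonal D * X) *ᵥ v) = ∑ i, D i * (X *ᵥ v) i * (X *ᵥ v) i := by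
  rw [← Matrix.mulVec_mulVec, ← Matrix.mulVec_mulVec, Matrix.dotProduct_mulVec,
    Matrix.vecMul_transpose, dotProduct]
  refine Finset.sum_congr rfl fun i _ => ?_
  rw [Matrix.mulVec_diagonal]
  ring

theorem mem_nbhd_of_l2 {g : Fin G} {β : Fin S.p → ℝ} (h : l2 (β - S.xi g) ≤ S.d1 / 2) :
    (fun j : S.A g => β j) ∈ S.nbhd g :=
  fun j => (abs_le_l2 (β - S.xi g) j).trans h

theorem hform_eq_gram {d : ℝ → ℝ} {u : ℕ} {k : Fin S.K} {ω : S.Ω} {β a : Fin S.p → ℝ}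
    (hβ : ∀ j ∉ S.suppB k, β j = 0) (ha : ∀ j ∉ S.suppB k, a j = 0) :
    (fun j : S.A (S.grp k) => a j) ⬝ᵥ (((S.XA u k (S.grp k) ω)ᵀ *
      Matrix.diagonal (fun i => iteratedDeriv 2 d
        ((S.XA u k (S.grp k) ω *ᵥ fun j : S.A (S.grp k) => β j) i)) *
      S.XA u k (S.grp k) ω) *ᵥ fun j : S.A (S.grp k) => a j) = S.hform d u k ω β a a := by
  rw [dotProduct_gram_mulVec]
  exact Finset.sum_congr rfl fun i _ => by
    rw [XA_mulVec (g := S.grp k) hβ, XA_mulVec (g := S.grp k) ha]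

theorem RegularDesign.formMin {d : ℝ → ℝ} {Cx c1 C1 C2 C3 : ℝ} {b : ℕ} {ω : S.Ω}
    (h : S.RegularDesign d Cx c1 C1 C2 C3 b ω) {u : ℕ} (hu : u ∈ Finset.Icc 1 b) (k : Fin S.K)
    {β : Fin S.p → ℝ} (hβ : ∀ j ∉ S.suppB k, β j = 0) (hb : l2 (β - S.beta k) ≤ S.d1 / 2)
    {a : Fin S.p → ℝ} (ha : ∀ j ∉ S.suppB k, a j = 0) :
    c1 * S.n u k * l2 a ^ 2 ≤ S.hform d u k ω β a a := by
  have := h.eigMin u hu (S.grp k) k (mem_members.2 rfl) _ (mem_nbhd_of_l2 hb)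
    fun j : S.A (S.grp k) => a j
  rwa [hform_eq_gram hβ ha, dotProduct_self_eq_l2_sq, l2_restrict_eq (A := S.A (S.grp k)) ha]
    at this

theorem RegularDesign.formMax {d : ℝ → ℝ} {Cx c1 C1 C2 C3 : ℝ} {b : ℕ} {ω : S.Ω}
    (h : S.RegularDesign d Cx c1 C1 C2 C3 b ω) {u : ℕ} (hu : u ∈ Finset.Icc 1 b) (k : Fin S.K)
    {β : Fin S.p → ℝ} (hβ : ∀ j ∉ S.suppB k, β j = 0) (hb : l2 (β - S.beta k) ≤ S.d1 / 2)
    {a : Fin S.p → ℝ} (ha : ∀ j ∉ S.suppB k, a j = 0) :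
    S.hform d u k ω β a a ≤ C1 * S.n u k * l2 a ^ 2 := by
  have := h.eigMax u hu (S.grp k) k (mem_members.2 rfl) _ (mem_nbhd_of_l2 hb)
    fun j : S.A (S.grp k) => a j
  rwa [hform_eq_gram hβ ha, dotProduct_self_eq_l2_sq, l2_restrict_eq (A := S.A (S.grp k)) ha]
    at this

theorem beta_eq_zero {k : Fin S.K} {j : Fin S.p} (hj : j ∉ S.suppB k) : S.beta k j = 0 := by
  simpa [suppB] using hj

/-- A nonsingular Gram matrix forces at least as many observations as important variables. -/
theorem RegularDesign.card_le {d : ℝ → ℝ} {Cx c1 C1 C2 C3 : ℝ} {b : ℕ} {ω : S.Ω}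
    (h : S.RegularDesign d Cx c1 C1 C2 C3 b ω) (hc1 : 0 < c1) (hd1 : 0 < S.d1) {u : ℕ}
    (hu : u ∈ Finset.Icc 1 b) (k : Fin S.K) (hn : 0 < S.n u k) :
    (S.suppB k).card ≤ S.n u k := by
  have hinj : Function.Injective (S.XA u k (S.grp k) ω).mulVecLin := by
    rw [← LinearMap.ker_eq_bot, LinearMap.ker_eq_bot']
    intro v hv
    have hmem : (fun j : S.A (S.grp k) => S.xi (S.grp k) j) ∈ S.nbhd (S.grp k) :=
      fun j => by rw [sub_self, abs_zero]; linarith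
    have h1 := h.eigMin u hu (S.grp k) k (mem_members.2 rfl) _ hmem v
    rw [Matrix.mulVecLin_apply] at hv
    rw [← Matrix.mulVec_mulVec, hv, Matrix.mulVec_zero, dotProduct_zero,
      dotProduct_self_eq_l2_sq] at h1
    by_contra hne
    have h2 := l2_pos hne
    have h3 : (0 : ℝ) < S.n u k := by exact_mod_cast hn
    exact absurd h1 (not_le.2 (by positivity))
  have h4 : (S.A (S.grp k)).card ≤ S.n u k := by
    simpa using LinearMap.finrank_le_finrank_of_injective hinj
  exact h4

end StreamModel

/-! ### Gradient bounds on a good sample -/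

namespace StreamModel

variable {G : ℕ} {S : StreamModel.{w} G}

variable (S) in
/-- The estimates `Bh` of the batches before `u` have the true supports and are within `R` times
the subgroup rates of the true coefficients, in the neighborhood where the designs are regular. -/
def PastGood (R : ℝ) (Bh : ℕ → Fin S.K → Fin S.p → ℝ) (u : ℕ) : Prop :=
  ∀ v ∈ Finset.Ico 1 u, ∀ k, (∀ j ∉ S.suppB k, Bh v k j = 0) ∧
    l2 (Bh v k - S.beta k) ≤ R * S.grate v (S.grp k) ∧ l2 (Bh v k - S.beta k) ≤ S.d1 / 2

/-- The sparsity bound by one sample size carries over to all sources, since the samples are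
balanced. -/
theorem s_le_of_goodSample {γ : ℝ} {d : ℝ → ℝ} {Cx c1 C1 M : ℝ} {b : ℕ} {ω : S.Ω}
    (hb : S.Balanced γ b) (hs : Function.Surjective S.grp)
    (hg : S.GoodSample d Cx c1 C1 M b ω) {u : ℕ} (hu : u ∈ Finset.Icc 1 b)
    (k : Fin S.K) : (S.s : ℝ) ≤ γ * S.n u k ∧ S.s ≤ S.N u := by
  have hne : (Finset.univ : Finset (Fin G)).Nonempty := ⟨S.grp k, Finset.mem_univ _⟩
  obtain ⟨g, -, hgs⟩ := Finset.exists_mem_eq_sup Finset.univ hne fun g => (S.A g).card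
  obtain ⟨k', rfl⟩ := hs g
  have h1 : S.s ≤ S.n u k' := by
    rw [s, hgs]; exact hg.card_le u hu k'
  refine ⟨?_, ?_⟩
  · calc (S.s : ℝ) ≤ S.n u k' := by exact_mod_cast h1
      _ ≤ _ := hb.le u hu k' k
  · exact h1.trans ((n_le_Nk (Finset.mem_Icc.2 ⟨(Finset.mem_Icc.1 hu).1, le_rfl⟩) k').trans
      ((Nk_le_Ng u k').trans (Ng_le_N u _)))

section

variable {γ : ℝ} {d : ℝ → ℝ} {Cx c1 C1 M : ℝ} {b : ℕ} {ω : S.Ω}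

theorem GoodSample.abs_hform_le (hg : S.GoodSample d Cx c1 C1 M b ω) (hd : IsCumulant d)
    (hC1 : 0 ≤ C1) {u : ℕ} (hu : u ∈ Finset.Icc 1 b) {k : Fin S.K} {β a c : Fin S.p → ℝ}
    (hβ : ∀ j ∉ S.suppB k, β j = 0) (hn : l2 (β - S.beta k) ≤ S.d1 / 2)
    (ha : ∀ j ∉ S.suppB k, a j = 0) (hc : ∀ j ∉ S.suppB k, c j = 0) :
    |S.hform d u k ω β a c| ≤ C1 * S.n u k * l2 a * l2 c := by
  refine (StreamModel.abs_hform_le hd _ _ _).trans ?_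
  have h0 : 0 ≤ C1 * S.n u k := by positivity
  have h1 := Real.sqrt_le_sqrt (hg.formMax u hu k β hβ hn a ha)
  have h2 := Real.sqrt_le_sqrt (hg.formMax u hu k β hβ hn c hc)
  rw [Real.sqrt_mul h0, Real.sqrt_sq (l2_nonneg _)] at h1 h2
  calc _ ≤ Real.sqrt (C1 * S.n u k) * l2 a * (Real.sqrt (C1 * S.n u k) * l2 c) :=
        mul_le_mul h1 h2 (Real.sqrt_nonneg _) (mul_nonneg (Real.sqrt_nonneg _) (l2_nonneg _))
    _ = Real.sqrt (C1 * S.n u k) * Real.sqrt (C1 * S.n u k) * l2 a * l2 c := by ring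
    _ = _ := by rw [Real.mul_self_sqrt h0]

/-- The Hessian form between an unimportant covariate and a direction in the true support. -/
theorem GoodSample.abs_hform_single_le (hg : S.GoodSample d Cx c1 C1 M b ω) (hd : IsCumulant d)
    (hb : S.Balanced γ b) (hs : Function.Surjective S.grp) (hs0 : 0 < S.s)
    (hCx : 0 ≤ Cx) (hC1 : 0 ≤ C1) (hM : 0 ≤ M) {R : ℝ} {u : ℕ}
    (hu : u ∈ Finset.Icc 1 b) {k : Fin S.K} {β a : Fin S.p → ℝ}
    (hβ : ∀ j ∉ S.suppB k, β j = 0) (hn : l2 (β - S.beta k) ≤ S.d1 / 2)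
    (hR : l2 (β - S.beta k) ≤ R * S.grate u (S.grp k))
    (ha : ∀ j ∉ S.suppB k, a j = 0) {D : ℝ} (hD : Real.sqrt (S.n u k) * l2 a ≤ D) (j : Fin S.p) :
    |S.hform d u k ω β a (Pi.single j 1)| ≤
      Cx * Real.sqrt ((M + C1 * (R ^ 2 * γ)) * C1) * (D * Real.sqrt (S.n u k + S.logDim)) := by
  refine (StreamModel.abs_hform_single_le hd hCx (fun i => hg.bdd u hu k i j) β (S.beta k) a).trans
    ?_
  have hL : 0 ≤ S.logDim := (Nat.cast_nonneg _).trans s_le_logDim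
  have hnpos : (0 : ℝ) < S.n u k := by exact_mod_cast hb.pos u hu k
  have hsg := (s_le_of_goodSample hb hs hg hu k).1
  have hγ : 0 ≤ γ := by
    by_contra! h
    have : (0 : ℝ) < S.s := by exact_mod_cast hs0
    nlinarith
  have hδ : ∀ j ∉ S.suppB k, (β - S.beta k) j = 0 := fun j hj => by
    simp [hβ j hj, beta_eq_zero hj]
  have hNg : (S.n u k : ℝ) ≤ S.Ng u (S.grp k) := by
    exact_mod_cast (n_le_Nk (Finset.mem_Icc.2 ⟨(Finset.mem_Icc.1 hu).1, le_rfl⟩) k).trans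
      (Nk_le_Ng u k)
  have hrate : S.grate u (S.grp k) ^ 2 ≤ γ := by
    rw [grate, Real.sq_sqrt (by positivity), div_le_iff₀ (hnpos.trans_le hNg)]
    exact hsg.trans (by gcongr)
  have h1 : l2 (β - S.beta k) ^ 2 ≤ R ^ 2 * γ := by
    calc l2 (β - S.beta k) ^ 2 ≤ (R * S.grate u (S.grp k)) ^ 2 := by
          gcongr; exact l2_nonneg _
      _ ≤ _ := by rw [mul_pow]; gcongr
  have h2 : ∑ i, varSup d (S.x u k i ω ⬝ᵥ S.beta k) +
      S.hform d u k ω β (β - S.beta k) (β - S.beta k) ≤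
        (M + C1 * (R ^ 2 * γ)) * (S.n u k + S.logDim) := by
    have h3 := hg.varSum u hu k
    have h4 := hg.formMax u hu k β hβ hn _ hδ
    have h5 : C1 * S.n u k * l2 (β - S.beta k) ^ 2 ≤ C1 * S.n u k * (R ^ 2 * γ) := by gcongr
    have h6 : 0 ≤ C1 * (R ^ 2 * γ) * S.logDim := by positivity
    nlinarith
  have h0 : 0 ≤ C1 * S.n u k := by positivity
  have h7 := Real.sqrt_le_sqrt (hg.formMax u hu k β hβ hn a ha)
  rw [Real.sqrt_mul h0, Real.sqrt_sq (l2_nonneg _), Real.sqrt_mul hC1] at h7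
  have h8 : 0 ≤ M + C1 * (R ^ 2 * γ) := by positivity
  calc _ ≤ Cx * Real.sqrt ((M + C1 * (R ^ 2 * γ)) * (S.n u k + S.logDim)) *
        (Real.sqrt C1 * Real.sqrt (S.n u k) * l2 a) := by gcongr
    _ = Cx * (Real.sqrt (M + C1 * (R ^ 2 * γ)) * Real.sqrt C1) *
        ((Real.sqrt (S.n u k) * l2 a) * Real.sqrt (S.n u k + S.logDim)) := by
        rw [Real.sqrt_mul h8]; ring
    _ ≤ _ := by
        rw [← Real.sqrt_mul h8]; gcongr

variable {Bh : ℕ → Fin S.K → Fin S.p → ℝ} {R : ℝ} {u : ℕ}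

/-- The estimation error of the previous batch, against which the accumulated Hessian is applied,
contributes at most the rate of the previous batch; nothing is accumulated before the first. -/
theorem PastGood.l2_sub_le (hp : S.PastGood R Bh u) {v : ℕ} (hv : v ∈ Finset.Ico 1 u)
    (k : Fin S.K) (β : Fin S.p → ℝ) :
    l2 (β - Bh (u - 1) k) ≤ l2 (β - S.beta k) + R * S.grate (u - 1) (S.grp k) := by
  have hv := Finset.mem_Ico.1 hv
  have h := (hp (u - 1) (Finset.mem_Ico.2 (by omega)) k).2.1
  rw [l2_sub_comm] at h
  exact (_root_.l2_sub_le β (S.beta k) (Bh (u - 1) k)).trans (by linarith)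

end

end StreamModel

namespace StreamModel

variable {G : ℕ} {S : StreamModel.{w} G} {γ : ℝ} {d : ℝ → ℝ} {Cx c1 C1 M : ℝ} {b : ℕ} {ω : S.Ω}
  {Bh : ℕ → Fin S.K → Fin S.p → ℝ} {R : ℝ} {u : ℕ}

theorem PastGood.sub_apply_eq_zero (hp : S.PastGood R Bh u) {v : ℕ} (hv : v ∈ Finset.Ico 1 u)
    {k : Fin S.K} {β : Fin S.p → ℝ} (hβ : ∀ j ∉ S.suppB k, β j = 0) {j : Fin S.p}
    (hj : j ∉ S.suppB k) : (β - Bh (u - 1) k) j = 0 := by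
  have hv := Finset.mem_Ico.1 hv
  have h := (hp (u - 1) (Finset.mem_Ico.2 (by omega)) k).1 j hj
  simp [hβ j hj, h]

theorem mem_Icc_of_mem_Ico (hu : u ∈ Finset.Icc 1 b) {v : ℕ} (hv : v ∈ Finset.Ico 1 u) :
    v ∈ Finset.Icc 1 b := by
  simp only [Finset.mem_Icc, Finset.mem_Ico] at *; omega

theorem GoodSample.abs_sum_hform_le (hg : S.GoodSample d Cx c1 C1 M b ω) (hd : IsCumulant d)
    (hC1 : 0 ≤ C1) (hp : S.PastGood R Bh u) (hu : u ∈ Finset.Icc 1 b) {k : Fin S.K}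
    {β a : Fin S.p → ℝ} (hβ : ∀ j ∉ S.suppB k, β j = 0) (ha : ∀ j ∉ S.suppB k, a j = 0) :
    |∑ v ∈ Finset.Ico 1 u, S.hform d v k ω (Bh v k) (β - Bh (u - 1) k) a| ≤
      C1 * S.Nk (u - 1) k * (l2 (β - S.beta k) + R * S.grate (u - 1) (S.grp k)) * l2 a := by
  rw [← sum_Ico_n (Finset.mem_Icc.1 hu).1, Finset.mul_sum, Finset.sum_mul, Finset.sum_mul]
  refine (Finset.abs_sum_le_sum_abs _ _).trans (Finset.sum_le_sum fun v hv => ?_)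
  have h := hp v hv k
  refine (hg.abs_hform_le hd hC1 (mem_Icc_of_mem_Ico hu hv) h.1 h.2.2
    (fun j hj => hp.sub_apply_eq_zero hv hβ hj) ha).trans ?_
  have := hp.l2_sub_le hv k β
  gcongr
  exact l2_nonneg _

theorem sum_err_mul_eq (k : Fin S.K) (a : Fin S.p → ℝ) :
    ∑ i, S.err d u k i ω * (S.x u k i ω ⬝ᵥ a) =
      ∑ j, a j * ∑ i, S.x u k i ω j * S.err d u k i ω := by
  simp only [dotProduct, Finset.mul_sum]
  rw [Finset.sum_comm]
  exact Finset.sum_congr rfl fun _ _ => Finset.sum_congr rfl fun _ _ => by ring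

theorem sum_n_le_Ng (hu : 1 ≤ u) (g : Fin G) :
    ∑ k ∈ S.members g, (S.n u k : ℝ) ≤ S.Ng u g := by
  rw [Ng]; push_cast
  exact Finset.sum_le_sum fun k _ => by
    exact_mod_cast n_le_Nk (Finset.mem_Icc.2 ⟨hu, le_rfl⟩) k

theorem sqrt_score_le (hM : 0 ≤ M) (hu : 1 ≤ u) {g : Fin G} {x : ℝ}
    (hx : x ≤ M ^ 2 * (S.s * ∑ k ∈ S.members g, (S.n u k : ℝ))) :
    Real.sqrt x ≤ M * Real.sqrt (S.s * S.Ng u g) := by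
  refine Real.sqrt_le_iff.2 ⟨by positivity, hx.trans ?_⟩
  rw [mul_pow, Real.sq_sqrt (by positivity)]
  have := sum_n_le_Ng (S := S) hu g
  gcongr

theorem Ng_pred_mul_grate_le (g : Fin G) :
    (S.Ng (u - 1) g : ℝ) * S.grate (u - 1) g ≤ Real.sqrt (S.s * S.Ng u g) := by
  rw [Ng_mul_grate]
  have : (S.Ng (u - 1) g : ℝ) ≤ S.Ng u g := by exact_mod_cast Ng_mono (Nat.sub_le u 1) g
  gcongr

/-- The gradient of the subgroup loss at the true coefficients. -/
theorem GoodSample.abs_ggrad_le (hg : S.GoodSample d Cx c1 C1 M b ω) (hd : IsCumulant d)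
    (hC1 : 0 ≤ C1) (hM : 0 ≤ M) (hR : 0 ≤ R) (hp : S.PastGood R Bh u) (hu : u ∈ Finset.Icc 1 b)
    (g : Fin G) {a : Fin S.p → ℝ} (ha : ∀ j ∉ S.A g, a j = 0) :
    |S.ggrad d Bh u g ω (S.xi g) a| ≤ (C1 * R + M) * Real.sqrt (S.s * S.Ng u g) * l2 a := by
  have hu1 := (Finset.mem_Icc.1 hu).1
  have hsupp : ∀ k ∈ S.members g, S.suppB k = S.A g := fun k hk => by
    rw [← mem_members.1 hk]; rfl
  have hbeta : ∀ k ∈ S.members g, S.beta k = S.xi g := fun k hk => by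
    rw [← mem_members.1 hk]; rfl
  have e : S.ggrad d Bh u g ω (S.xi g) a =
      ∑ k ∈ S.members g, ∑ v ∈ Finset.Ico 1 u,
        S.hform d v k ω (Bh v k) (S.beta k - Bh (u - 1) k) a -
      ∑ j, a j * ∑ k ∈ S.members g, ∑ i, S.x u k i ω j * S.err d u k i ω := by
    simp only [ggrad_apply, Finset.mul_sum (s := S.members g)]
    rw [Finset.sum_comm (s := Finset.univ), ← Finset.sum_sub_distrib]
    refine Finset.sum_congr rfl fun k hk => ?_
    obtain ⟨t, -, ht⟩ := exists_grad_eq (Bh := Bh) (u := u) (k := k) (ω := ω) hd (S.beta k) a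
    rw [← hbeta k hk, ht, sum_err_mul_eq, sub_self]
    have : S.hform d u k ω (S.beta k + t • (0 : Fin S.p → ℝ)) 0 a = 0 := by simp [hform]
    rw [this, add_zero]
  have h1 : |∑ k ∈ S.members g, ∑ v ∈ Finset.Ico 1 u,
      S.hform d v k ω (Bh v k) (S.beta k - Bh (u - 1) k) a| ≤
      C1 * R * Real.sqrt (S.s * S.Ng u g) * l2 a := by
    calc _ ≤ ∑ k ∈ S.members g, C1 * S.Nk (u - 1) k * (R * S.grate (u - 1) g) * l2 a := by
          refine (Finset.abs_sum_le_sum_abs _ _).trans (Finset.sum_le_sum fun k hk => ?_)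
          have := hg.abs_sum_hform_le hd hC1 hp hu (k := k) (β := S.beta k) (a := a)
            (fun j hj => beta_eq_zero hj) (fun j hj => ha j (by rwa [← hsupp k hk]))
          rwa [sub_self, l2_zero, zero_add, mem_members.1 hk] at this
      _ = C1 * R * (S.Ng (u - 1) g * S.grate (u - 1) g) * l2 a := by
          rw [← Finset.sum_mul, ← Finset.sum_mul, ← Finset.mul_sum, Ng]
          push_cast
          ring
      _ ≤ _ := by
          have := Ng_pred_mul_grate_le (S := S) (u := u) g
          gcongr
          exact l2_nonneg _
  have h2 : |∑ j, a j * ∑ k ∈ S.members g, ∑ i, S.x u k i ω j * S.err d u k i ω| ≤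
      M * Real.sqrt (S.s * S.Ng u g) * l2 a := by
    refine (abs_sum_mul_le_l2 ha _).trans ?_
    have := sqrt_score_le hM hu1 (hg.groupScore u hu g)
    gcongr
    exact l2_nonneg _
  rw [e]
  refine (abs_sub _ _).trans ?_
  linarith

/-- Strong convexity of the subgroup loss in the neighborhood of the true coefficients. -/
theorem GoodSample.gfit_strong (hg : S.GoodSample d Cx c1 C1 M b ω) (hd : IsCumulant d)
    (hp : S.PastGood R Bh u) (hu : u ∈ Finset.Icc 1 b) (g : Fin G) {β a : Fin S.p → ℝ}
    (hβ : ∀ j ∉ S.A g, β j = 0) (ha : ∀ j ∉ S.A g, a j = 0) (h0 : l2 (β - S.xi g) ≤ S.d1 / 2)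
    (h1 : l2 (β + a - S.xi g) ≤ S.d1 / 2) :
    S.gfit d Bh u g ω β + S.ggrad d Bh u g ω β a + c1 * S.Ng u g * l2 a ^ 2 / 2 ≤
      S.gfit d Bh u g ω (β + a) := by
  have hu1 := (Finset.mem_Icc.1 hu).1
  have e : c1 * S.Ng u g * l2 a ^ 2 / 2 = ∑ k ∈ S.members g, c1 * S.Nk u k * l2 a ^ 2 / 2 := by
    rw [← Finset.sum_div, ← Finset.sum_mul, ← Finset.mul_sum, Ng]
    push_cast
    ring
  rw [ggrad_apply, gfit, gfit, e, ← Finset.sum_add_distrib, ← Finset.sum_add_distrib]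
  refine Finset.sum_le_sum fun k hk => ?_
  obtain rfl := mem_members.1 hk
  have hm : ∀ t ∈ Set.Icc (0 : ℝ) 1,
      c1 * S.n u k * l2 a ^ 2 ≤ S.hform d u k ω (β + t • a) a a := by
    intro t ht
    refine hg.formMin u hu k _ (fun j hj => ?_) ?_ a ha
    · simp [hβ j hj, ha j hj]
    · have e2 : β + t • a - S.beta k =
          (1 - t) • (β - S.xi (S.grp k)) + t • (β + a - S.xi (S.grp k)) := by
        rw [beta]; module
      rw [e2]
      refine (l2_add_le _ _).trans ?_
      rw [l2_smul, l2_smul, abs_of_nonneg ht.1, abs_of_nonneg (sub_nonneg.2 ht.2)]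
      nlinarith [mul_le_mul_of_nonneg_left h0 (sub_nonneg.2 ht.2),
        mul_le_mul_of_nonneg_left h1 ht.1]
  have h2 := fit_add_ge (Bh := Bh) (u := u) (k := k) (ω := ω) hd β a hm
  have h3 : ∑ v ∈ Finset.Ico 1 u, c1 * S.n v k * l2 a ^ 2 ≤
      ∑ v ∈ Finset.Ico 1 u, S.hform d v k ω (Bh v k) a a :=
    Finset.sum_le_sum fun v hv => hg.formMin v (mem_Icc_of_mem_Ico hu hv) k _ (hp v hv k).1
      (hp v hv k).2.2 a ha
  rw [← Finset.sum_mul, ← Finset.mul_sum, sum_Ico_n hu1] at h3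
  have h4 : (S.Nk u k : ℝ) = S.Nk (u - 1) k + S.n u k := by exact_mod_cast Nk_eq hu1 k
  rw [h4]
  linarith

/-- Existence, uniqueness and rate of the minimizer of the subgroup loss: on the sphere whose
radius is a large multiple of the rate, strong convexity outweighs the gradient at the center. -/
theorem GoodSample.exists_isGroupMin (hg : S.GoodSample d Cx c1 C1 M b ω) (hd : IsCumulant d)
    (hc1 : 0 < c1) (hC1 : 0 ≤ C1) (hM : 0 ≤ M) (hR : 0 ≤ R) (hp : S.PastGood R Bh u)
    (hu : u ∈ Finset.Icc 1 b) (hs0 : 0 < S.s) (g : Fin G) (hN : 0 < S.Ng u g) {R' : ℝ}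
    (hR' : 2 * (C1 * R + M) / c1 < R') (hr : R' * S.grate u g ≤ S.d1 / 2) :
    ∃ β, S.IsGroupMin d Bh u g ω β ∧ l2 (β - S.xi g) ≤ R' * S.grate u g ∧
      ∀ β', S.IsGroupMin d Bh u g ω β' → β' = β := by
  have hs0' : (0 : ℝ) < S.s := by exact_mod_cast hs0
  have hN' : (0 : ℝ) < S.Ng u g := by exact_mod_cast hN
  have hT : 0 < S.grate u g := Real.sqrt_pos.2 (div_pos hs0' hN')
  have hR'0 : 0 < R' := lt_of_le_of_lt (by positivity) hR'
  have hr0 : 0 < R' * S.grate u g := mul_pos hR'0 hT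
  have hξ : ∀ j ∉ S.A g, S.xi g j = 0 := fun j hj => by simpa [A] using hj
  have hL := fun β a => gfit_tangent (Bh := Bh) (u := u) (ω := ω) hd g β a
  have hsphere : ∀ a : Fin S.p → ℝ, (∀ j ∉ S.A g, a j = 0) → l2 a = R' * S.grate u g →
      S.gfit d Bh u g ω (S.xi g) < S.gfit d Bh u g ω (S.xi g + a) := by
    intro a ha hla
    have h1 := hg.gfit_strong hd hp hu g hξ ha (by rw [sub_self, l2_zero]; linarith)
      (by rw [add_sub_cancel_left, hla]; exact hr)
    have h2 := (abs_le.1 (hg.abs_ggrad_le hd hC1 hM hR hp hu g ha)).1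
    rw [hla, ← Ng_mul_grate] at h2
    rw [hla] at h1
    rw [div_lt_iff₀ hc1] at hR'
    have h3 : 0 < S.Ng u g * S.grate u g ^ 2 * R' * (R' * c1 - 2 * (C1 * R + M)) :=
      mul_pos (by positivity) (by linarith)
    nlinarith
  obtain ⟨β, hβ, hmin⟩ := exists_min_of_sphere (continuous_gfit hd g) hL hξ hr0 hsphere
  have hball : ∀ β', S.IsGroupMin d Bh u g ω β' → l2 (β' - S.xi g) < R' * S.grate u g :=
    fun β' h => l2_sub_lt_of_le hL hξ hr0 hsphere h.1 (h.2 _ hξ)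
  have hmin' : S.IsGroupMin d Bh u g ω β := ⟨hβ, hmin⟩
  refine ⟨β, hmin', (hball β hmin').le, fun β' h => ?_⟩
  by_contra hne
  have ha : ∀ j ∉ S.A g, (β' - β) j = 0 := fun j hj => by simp [hβ j hj, h.1 j hj]
  have h1 := hg.gfit_strong hd hp hu g hβ ha ((hball β hmin').le.trans hr)
    (by rw [add_sub_cancel]; exact (hball β' h).le.trans hr)
  rw [add_sub_cancel, hmin'.stationary hd ha] at h1
  have h2 : 0 < l2 (β' - β) := l2_pos (sub_ne_zero.2 hne)
  have h3 : 0 < c1 * S.Ng u g * l2 (β' - β) ^ 2 / 2 := by positivity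
  linarith [h.2 β hβ]

/-- The gradient of one source at an oracle estimate, along the important variables. -/
theorem GoodSample.abs_grad_le (hg : S.GoodSample d Cx c1 C1 M b ω) (hd : IsCumulant d)
    (hC1 : 0 ≤ C1) (hM : 0 ≤ M) (hR : 0 ≤ R) (hp : S.PastGood R Bh u)
    (hu : u ∈ Finset.Icc 1 b) {R' : ℝ} (hR' : 0 ≤ R') {k : Fin S.K} {β : Fin S.p → ℝ}
    (hβ : ∀ j ∉ S.suppB k, β j = 0) (hn : l2 (β - S.beta k) ≤ S.d1 / 2)
    (hr : l2 (β - S.beta k) ≤ R' * S.grate u (S.grp k)) {a : Fin S.p → ℝ}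
    (ha : ∀ j ∉ S.suppB k, a j = 0) :
    |S.grad d Bh u k ω β a| ≤ (C1 * R' + C1 * R + M) * Real.sqrt (S.s * S.N u) * l2 a := by
  have hu1 := (Finset.mem_Icc.1 hu).1
  obtain ⟨t, ht, e⟩ := exists_grad_eq (Bh := Bh) (u := u) (k := k) (ω := ω) hd β a
  have hδ : ∀ j ∉ S.suppB k, (β - S.beta k) j = 0 := fun j hj => by
    simp [hβ j hj, beta_eq_zero hj]
  have h1 := hg.abs_sum_hform_le hd hC1 hp hu hβ ha
  have h2 := hg.abs_hform_le hd hC1 hu (k := k) (β := S.beta k + t • (β - S.beta k))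
    (a := β - S.beta k) (c := a)
    (fun j hj => by simp [hβ j hj, beta_eq_zero hj])
    (by
      rw [add_sub_cancel_left, l2_smul, abs_of_nonneg ht.1]
      exact (mul_le_of_le_one_left (l2_nonneg _) ht.2).trans hn) hδ ha
  have h3 : |∑ i, S.err d u k i ω * (S.x u k i ω ⬝ᵥ a)| ≤
      M * Real.sqrt (S.s * S.Ng u (S.grp k)) * l2 a := by
    rw [sum_err_mul_eq]
    refine (abs_sum_mul_le_l2 ha _).trans ?_
    have := sqrt_score_le hM hu1 (hg.scoreSq u hu k)
    gcongr
    exact l2_nonneg _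
  have hNk : (S.Nk u k : ℝ) = S.Nk (u - 1) k + S.n u k := by exact_mod_cast Nk_eq hu1 k
  have hNg : (S.Nk u k : ℝ) ≤ S.Ng u (S.grp k) := by exact_mod_cast Nk_le_Ng u k
  have hNg1 : (S.Nk (u - 1) k : ℝ) ≤ S.Ng (u - 1) (S.grp k) := by
    exact_mod_cast Nk_le_Ng (u - 1) k
  have hNN : (S.Ng u (S.grp k) : ℝ) ≤ S.N u := by exact_mod_cast Ng_le_N u _
  have hq : Real.sqrt (S.s * S.Ng u (S.grp k)) ≤ Real.sqrt (S.s * S.N u) := by gcongr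
  have hl := l2_nonneg a
  have hT := grate_nonneg (S := S) u (S.grp k)
  have hT1 := grate_nonneg (S := S) (u - 1) (S.grp k)
  -- the error of the current batch is weighted by all observations of the source
  have h4 : (S.Nk (u - 1) k + S.n u k : ℝ) * l2 (β - S.beta k) ≤
      R' * Real.sqrt (S.s * S.Ng u (S.grp k)) := by
    rw [← hNk, ← Ng_mul_grate]
    calc (S.Nk u k : ℝ) * l2 (β - S.beta k)
        ≤ S.Ng u (S.grp k) * (R' * S.grate u (S.grp k)) :=
          mul_le_mul hNg hr (l2_nonneg _) (Nat.cast_nonneg _)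
      _ = _ := by ring
  have h5 : (S.Nk (u - 1) k : ℝ) * (R * S.grate (u - 1) (S.grp k)) ≤
      R * Real.sqrt (S.s * S.Ng u (S.grp k)) := by
    calc _ = R * (S.Nk (u - 1) k * S.grate (u - 1) (S.grp k)) := by ring
      _ ≤ R * (S.Ng (u - 1) (S.grp k) * S.grate (u - 1) (S.grp k)) := by gcongr
      _ ≤ _ := by
        have := Ng_pred_mul_grate_le (S := S) (u := u) (S.grp k)
        gcongr
  rw [e]
  calc _ ≤ C1 * S.Nk (u - 1) k * (l2 (β - S.beta k) + R * S.grate (u - 1) (S.grp k)) * l2 a +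
        C1 * S.n u k * l2 (β - S.beta k) * l2 a +
        M * Real.sqrt (S.s * S.Ng u (S.grp k)) * l2 a :=
        (abs_sub _ _).trans (add_le_add ((abs_add_le _ _).trans (add_le_add h1 h2)) h3)
    _ = (C1 * ((S.Nk (u - 1) k + S.n u k : ℝ) * l2 (β - S.beta k)) +
        C1 * (S.Nk (u - 1) k * (R * S.grate (u - 1) (S.grp k))) +
        M * Real.sqrt (S.s * S.Ng u (S.grp k))) * l2 a := by ring
    _ ≤ (C1 * (R' * Real.sqrt (S.s * S.Ng u (S.grp k))) +
        C1 * (R * Real.sqrt (S.s * S.Ng u (S.grp k))) +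
        M * Real.sqrt (S.s * S.Ng u (S.grp k))) * l2 a := by gcongr
    _ = (C1 * R' + C1 * R + M) * Real.sqrt (S.s * S.Ng u (S.grp k)) * l2 a := by ring
    _ ≤ _ := by gcongr

/-- The constant in the cross bound between important and unimportant variables. -/
def crossConst (Cx C1 M γ R : ℝ) : ℝ := Cx * Real.sqrt ((M + C1 * (R ^ 2 * γ)) * C1)

/-- The gradient of one source at an oracle estimate, along an unimportant variable. -/
theorem GoodSample.abs_grad_single_le (hg : S.GoodSample d Cx c1 C1 M b ω) (hd : IsCumulant d)
    (hb : S.Balanced γ b) (hs : Function.Surjective S.grp) (hs0 : 0 < S.s)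
    (hCx : 0 ≤ Cx) (hC1 : 0 ≤ C1) (hM : 0 ≤ M) (hR : 0 ≤ R) (hp : S.PastGood R Bh u)
    (hu : u ∈ Finset.Icc 1 b) {R' : ℝ} (hR' : 0 ≤ R') {k : Fin S.K} {β : Fin S.p → ℝ}
    (hβ : ∀ j ∉ S.suppB k, β j = 0) (hn : l2 (β - S.beta k) ≤ S.d1 / 2)
    (hr : l2 (β - S.beta k) ≤ R' * S.grate u (S.grp k)) (j : Fin S.p) :
    |S.grad d Bh u k ω β (Pi.single j 1)| ≤
      (2 * (b * crossConst Cx C1 M γ R * (R' + R) + crossConst Cx C1 M γ R' * R') + M) *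
        Real.sqrt (S.logDim * S.N u) := by
  have hu1 := (Finset.mem_Icc.1 hu).1
  have hL : 0 ≤ S.logDim := (Nat.cast_nonneg _).trans s_le_logDim
  have hcc : ∀ R, 0 ≤ crossConst Cx C1 M γ R := fun R => mul_nonneg hCx (Real.sqrt_nonneg _)
  obtain ⟨t, ht, e⟩ := exists_grad_eq (Bh := Bh) (u := u) (k := k) (ω := ω) hd β (Pi.single j 1)
  have hδ : ∀ j ∉ S.suppB k, (β - S.beta k) j = 0 := fun j hj => by
    simp [hβ j hj, beta_eq_zero hj]
  have hnN : ∀ v ∈ Finset.Icc 1 u, (S.n v k : ℝ) ≤ S.N u := fun v hv => by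
    exact_mod_cast (n_le_Nk hv k).trans ((Nk_le_Ng u k).trans (Ng_le_N u _))
  have hsN : (S.s : ℝ) ≤ S.N u := by
    exact_mod_cast (s_le_of_goodSample hb hs hg hu k).2
  -- `√s √(N + L) ≤ 2 √(N L)`, as `s` is at most `N` and at most `L`
  have hkey : ∀ v ∈ Finset.Icc 1 u, Real.sqrt S.s * Real.sqrt (S.n v k + S.logDim) ≤
      2 * Real.sqrt (S.logDim * S.N u) := by
    intro v hv
    rw [← Real.sqrt_mul (Nat.cast_nonneg _)]
    refine Real.sqrt_le_iff.2 ⟨by positivity, ?_⟩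
    rw [mul_pow, Real.sq_sqrt (by positivity)]
    have h1 := hnN v hv
    have h2 := s_le_logDim (S := S)
    have h3 : (S.s : ℝ) * S.n v k ≤ S.logDim * S.N u := by gcongr
    have h4 : (S.s : ℝ) * S.logDim ≤ S.N u * S.logDim := by gcongr
    nlinarith [mul_nonneg hL (Nat.cast_nonneg (α := ℝ) (S.N u))]
  have hpast : |∑ v ∈ Finset.Ico 1 u,
      S.hform d v k ω (Bh v k) (β - Bh (u - 1) k) (Pi.single j 1)| ≤
      b * (crossConst Cx C1 M γ R * (R' + R) * (2 * Real.sqrt (S.logDim * S.N u))) := by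
    refine (Finset.abs_sum_le_sum_abs _ _).trans ?_
    refine (Finset.sum_le_card_nsmul _ _
      (crossConst Cx C1 M γ R * (R' + R) * (2 * Real.sqrt (S.logDim * S.N u))) fun v hv => ?_).trans
      ?_
    · have hvb := mem_Icc_of_mem_Ico hu hv
      have hv' := Finset.mem_Ico.1 hv
      have hvu : v ∈ Finset.Icc 1 u := Finset.mem_Icc.2 (by omega)
      have hvu1 : v ∈ Finset.Icc 1 (u - 1) := Finset.mem_Icc.2 (by omega)
      have h := hp v hv k
      have hD : Real.sqrt (S.n v k) * l2 (β - Bh (u - 1) k) ≤ (R' + R) * Real.sqrt S.s := by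
        have h1 := (hp.l2_sub_le hv k β).trans (add_le_add_left hr _)
        have h2 := sqrt_mul_grate_le (S := S) (k := k) hvu
        have h3 := sqrt_mul_grate_le (S := S) (k := k) hvu1
        calc _ ≤ Real.sqrt (S.n v k) *
              (R' * S.grate u (S.grp k) + R * S.grate (u - 1) (S.grp k)) := by gcongr
          _ = R' * (Real.sqrt (S.n v k) * S.grate u (S.grp k)) +
              R * (Real.sqrt (S.n v k) * S.grate (u - 1) (S.grp k)) := by ring
          _ ≤ R' * Real.sqrt S.s + R * Real.sqrt S.s := by gcongr
          _ = _ := by ring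
      refine (hg.abs_hform_single_le hd hb hs hs0 hCx hC1 hM hvb h.1 h.2.2 h.2.1
        (fun j hj => hp.sub_apply_eq_zero hv hβ hj) hD j).trans ?_
      have h4 := hkey v hvu
      have h5 := hcc R
      calc _ = crossConst Cx C1 M γ R * (R' + R) *
            (Real.sqrt S.s * Real.sqrt (S.n v k + S.logDim)) := by rw [crossConst]; ring
        _ ≤ _ := by gcongr
    · have h5 := hcc R
      rw [nsmul_eq_mul, Nat.card_Ico]
      have : ((u - 1 : ℕ) : ℝ) ≤ b := by
        have := (Finset.mem_Icc.1 hu).2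
        exact_mod_cast (Nat.sub_le u 1).trans this
      gcongr
  have hcur : |S.hform d u k ω (S.beta k + t • (β - S.beta k)) (β - S.beta k) (Pi.single j 1)| ≤
      crossConst Cx C1 M γ R' * R' * (2 * Real.sqrt (S.logDim * S.N u)) := by
    have huu : u ∈ Finset.Icc 1 u := Finset.mem_Icc.2 ⟨hu1, le_rfl⟩
    have hl : l2 (S.beta k + t • (β - S.beta k) - S.beta k) ≤ l2 (β - S.beta k) := by
      rw [add_sub_cancel_left, l2_smul, abs_of_nonneg ht.1]
      exact mul_le_of_le_one_left (l2_nonneg _) ht.2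
    have hD : Real.sqrt (S.n u k) * l2 (β - S.beta k) ≤ R' * Real.sqrt S.s := by
      have h2 := sqrt_mul_grate_le (S := S) (k := k) huu
      calc _ ≤ Real.sqrt (S.n u k) * (R' * S.grate u (S.grp k)) := by gcongr
        _ = R' * (Real.sqrt (S.n u k) * S.grate u (S.grp k)) := by ring
        _ ≤ _ := by gcongr
    refine (hg.abs_hform_single_le hd hb hs hs0 hCx hC1 hM hu
      (fun j hj => by simp [hβ j hj, beta_eq_zero hj]) (hl.trans hn) (hl.trans hr) hδ hD j).trans ?_
    have h4 := hkey u huu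
    have h5 := hcc R'
    calc _ = crossConst Cx C1 M γ R' * R' *
          (Real.sqrt S.s * Real.sqrt (S.n u k + S.logDim)) := by rw [crossConst]; ring
      _ ≤ _ := by gcongr
  have hscore : |∑ i, S.err d u k i ω * (S.x u k i ω ⬝ᵥ Pi.single j 1)| ≤
      M * Real.sqrt (S.logDim * S.N u) := by
    have h1 := hg.score u hu k j
    have h2 := hnN u (Finset.mem_Icc.2 ⟨hu1, le_rfl⟩)
    have e2 : ∑ i, S.err d u k i ω * (S.x u k i ω ⬝ᵥ Pi.single j 1) =
        ∑ i, S.x u k i ω j * S.err d u k i ω :=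
      Finset.sum_congr rfl fun i _ => by rw [dotProduct_single, mul_one, mul_comm]
    rw [e2]
    refine h1.trans ?_
    rw [mul_comm (S.n u k : ℝ)]
    gcongr
  rw [e]
  refine ((abs_sub _ _).trans (add_le_add ((abs_add_le _ _).trans
    (add_le_add hpast hcur)) hscore)).trans (le_of_eq ?_)
  ring

end StreamModel

/-! ### Induction over the batches -/

namespace StreamModel

variable {G : ℕ}

/-- The deterministic conditions at one stage: balanced samples, minimal signals, and tuning
parameters at least `C` times their rates. -/
structure Regime (S : StreamModel.{w} G) (a γ C : ℝ) (b : ℕ) : Prop where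
  surj : Function.Surjective S.grp
  bal : S.Balanced γ b
  s_pos : 0 < S.s
  lam_pos : ∀ u ∈ Finset.Icc 1 b, 0 < S.lam1 u ∧ 0 < S.lam2 u
  d1 : ∀ u ∈ Finset.Icc 1 b, 2 * a * S.lam1 u < S.d1
  d2 : ∀ u ∈ Finset.Icc 1 b, 2 * a * S.lam2 u < S.d2
  slack1 : ∀ u ∈ Finset.Icc 1 b, C * Real.sqrt (S.logDim / S.Nbar u) ≤ S.lam1 u
  slack2 : ∀ u ∈ Finset.Icc 1 b, C * S.rate u ≤ S.lam2 u

theorem Regime.mono {S : StreamModel.{w} G} {a γ C C' : ℝ} {b : ℕ} (h : S.Regime a γ C b)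
    (hC : C' ≤ C) : S.Regime a γ C' b where
  surj := h.surj
  bal := h.bal
  s_pos := h.s_pos
  lam_pos := h.lam_pos
  d1 := h.d1
  d2 := h.d2
  slack1 u hu := le_trans (by gcongr) (h.slack1 u hu)
  slack2 u hu := le_trans (mul_le_mul_of_nonneg_right hC (Real.sqrt_nonneg _)) (h.slack2 u hu)

theorem grate_le_rate [Nonempty (Fin G)] {S : StreamModel.{w} G} {γ : ℝ} {b : ℕ}
    (h : S.Balanced γ b) (hs : Function.Surjective S.grp) {u : ℕ} (hu : u ∈ Finset.Icc 1 b)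
    (g : Fin G) : S.grate u g ≤ S.rate u := by
  have h1 : (0 : ℝ) < S.Nbar u := by exact_mod_cast Nbar_pos h hs hu
  have h2 : (S.Nbar u : ℝ) ≤ S.Ng u g := by exact_mod_cast Nbar_le_Ng u g
  exact Real.sqrt_le_sqrt (by gcongr)

theorem rate_le_sqrt_logDim {S : StreamModel.{w} G} (u : ℕ) :
    S.rate u ≤ Real.sqrt (S.logDim / S.Nbar u) := by
  have := s_le_logDim (S := S)
  exact Real.sqrt_le_sqrt (by gcongr)

theorem d1_le {S : StreamModel.{w} G} (hs : Function.Surjective S.grp) (g : Fin G) {j : Fin S.p}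
    (hj : j ∈ S.A g) : S.d1 ≤ |S.xi g j| := by
  obtain ⟨k, rfl⟩ := hs g
  exact csInf_le ⟨0, by rintro _ ⟨k, j, -, rfl⟩; exact abs_nonneg _⟩ ⟨k, j, hj, rfl⟩

theorem d2_le {S : StreamModel.{w} G} (hs : Function.Surjective S.grp) {g₁ g₂ : Fin G}
    (h : g₁ ≠ g₂) : S.d2 ≤ l2 (S.xi g₁ - S.xi g₂) := by
  obtain ⟨k₁, rfl⟩ := hs g₁
  obtain ⟨k₂, rfl⟩ := hs g₂
  exact csInf_le ⟨0, by rintro _ ⟨k, j, -, rfl⟩; exact l2_nonneg _⟩ ⟨k₁, k₂, h, rfl⟩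

/-- One batch of the renewable scheme: if the past estimates have rate `R`, the oracle estimate of
the current batch exists, is unique, has a rate `R'` and is a strict local minimizer of the
penalized objective.  The constants depend on the model only through the constants in the
conditions. -/
theorem exists_step [Nonempty (Fin G)] (b : ℕ) {a γ Cx c1 C1 M R : ℝ} (ha : 0 < a)
    (hCx : 0 ≤ Cx) (hc1 : 0 < c1) (hC1 : 0 ≤ C1) (hM : 0 ≤ M) (hR : 0 ≤ R) :
    ∃ R' C : ℝ, 0 ≤ R' ∧ 0 ≤ C ∧ ∀ (S : StreamModel.{w} G) (d : ℝ → ℝ) (ρ : ℝ → ℝ → ℝ) (ω : S.Ω)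
      (Bh : ℕ → Fin S.K → Fin S.p → ℝ) (u : ℕ), IsPenalty a ρ → IsCumulant d →
      S.Regime a γ C b → S.GoodSample d Cx c1 C1 M b ω → u ∈ Finset.Icc 1 b →
      S.PastGood R Bh u →
      ∃ Xi : Fin G → Fin S.p → ℝ, (∀ g, S.IsGroupMin d Bh u g ω (Xi g)) ∧
        (∀ g β, S.IsGroupMin d Bh u g ω β → β = Xi g) ∧
        (∀ g, l2 (Xi g - S.xi g) ≤ R' * S.grate u g ∧ l2 (Xi g - S.xi g) ≤ S.d1 / 2) ∧
        IsStrictLocalMin (S.Qon d ρ Bh u ω) fun k => Xi (S.grp k) := by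
  obtain ⟨R', hR'def⟩ : ∃ R', R' = 2 * (C1 * R + M) / c1 + 1 := ⟨_, rfl⟩
  have hR' : 0 ≤ R' := by rw [hR'def]; positivity
  obtain ⟨C2, hC2⟩ : ∃ C2, C2 = C1 * R' + C1 * R + M := ⟨_, rfl⟩
  obtain ⟨C3, hC3⟩ : ∃ C3, C3 = 2 * (b * crossConst Cx C1 M γ R * (R' + R) +
    crossConst Cx C1 M γ R' * R') + M := ⟨_, rfl⟩
  have hcc : ∀ R, 0 ≤ crossConst Cx C1 M γ R := fun R => mul_nonneg hCx (Real.sqrt_nonneg _)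
  have hC2n : 0 ≤ C2 := by rw [hC2]; positivity
  have hC3n : 0 ≤ C3 := by
    have := hcc R
    have := hcc R'
    rw [hC3]
    positivity
  refine ⟨R', 2 * R' / a + 4 * C2 + 4 * C3, hR', by positivity, ?_⟩
  intro S d ρ ω Bh u hρ hd hreg hg hu hp
  set L := Real.sqrt (S.logDim / S.Nbar u) with hL
  have hL0 : 0 ≤ L := Real.sqrt_nonneg _
  have hr0 : 0 ≤ S.rate u := Real.sqrt_nonneg _
  have hs1 := hreg.slack1 u hu
  have hs2 := hreg.slack2 u hu
  obtain ⟨hl1, hl2⟩ := hreg.lam_pos u hu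
  have e : 2 * R' / a * a = 2 * R' := div_mul_cancel₀ _ ha.ne'
  have h0 : 0 ≤ 2 * R' / a := by positivity
  have b1 : 2 * R' * L ≤ a * S.lam1 u := by
    calc 2 * R' * L = 2 * R' / a * L * a := by rw [mul_right_comm (2 * R' / a), e]
      _ ≤ S.lam1 u * a := by
        gcongr
        nlinarith [mul_nonneg hC2n hL0, mul_nonneg hC3n hL0]
      _ = _ := mul_comm _ _
  have b2 : 2 * R' * S.rate u ≤ a * S.lam2 u := by
    calc 2 * R' * S.rate u
      _ = 2 * R' / a * S.rate u * a := by rw [mul_right_comm (2 * R' / a), e]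
      _ ≤ S.lam2 u * a := by
        gcongr
        nlinarith [mul_nonneg hC2n hr0, mul_nonneg hC3n hr0]
      _ = _ := mul_comm _ _
  have b3 : C3 * L ≤ S.lam1 u / 4 := by
    nlinarith [mul_nonneg hC2n hL0, mul_nonneg h0 hL0]
  have b4 : C2 * S.rate u ≤ S.lam2 u / 4 := by
    nlinarith [mul_nonneg hC3n hr0, mul_nonneg h0 hr0]
  have hd1 := hreg.d1 u hu
  have hd2 := hreg.d2 u hu
  have hgr : ∀ g, R' * S.grate u g ≤ R' * S.rate u := fun g =>
    mul_le_mul_of_nonneg_left (grate_le_rate hreg.bal hreg.surj hu g) hR'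
  have hrL : R' * S.rate u ≤ R' * L := mul_le_mul_of_nonneg_left (rate_le_sqrt_logDim u) hR'
  have hnb : ∀ g, R' * S.grate u g ≤ S.d1 / 2 := fun g => by
    have := hgr g
    nlinarith [mul_pos ha hl1, mul_nonneg hR' hL0]
  have hex := fun g => hg.exists_isGroupMin hd hc1 hC1 hM hR hp hu hreg.s_pos g
    (Ng_pos hreg.bal hreg.surj hu g) (hR'def ▸ lt_add_one _) (hnb g)
  choose Xi hmin hrate huniq using hex
  have hNpos : 0 < S.N u :=
    (Ng_pos hreg.bal hreg.surj hu (Classical.arbitrary _)).trans_le (Ng_le_N u _)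
  have hNbar : (0 : ℝ) < S.Nbar u := by exact_mod_cast Nbar_pos hreg.bal hreg.surj hu
  have hNbarN : (S.Nbar u : ℝ) ≤ S.N u := by
    exact_mod_cast (Nbar_le_Ng u (Classical.arbitrary _)).trans (Ng_le_N u _)
  refine ⟨Xi, hmin, huniq, fun g => ⟨hrate g, (hrate g).trans (hnb g)⟩, ?_⟩
  refine isStrictLocalMin_of_oracle hρ hd hreg.surj hNpos hmin huniq hl1 hl2 ?_ ?_ ?_ ?_
  · intro g j hj
    have h1 := d1_le hreg.surj g hj
    have h2 := (abs_le_l2 (Xi g - S.xi g) j).trans (hrate g)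
    have h3 := abs_sub_abs_le_abs_sub (S.xi g j) (Xi g j)
    rw [abs_sub_comm] at h3
    simp only [Pi.sub_apply] at h2
    have := hgr g
    nlinarith [mul_nonneg hR' hL0]
  · intro g₁ g₂ hne
    have h1 := d2_le hreg.surj hne
    have h2 := l2_sub_le (S.xi g₁) (Xi g₁) (S.xi g₂)
    have h3 := l2_sub_le (Xi g₁) (Xi g₂) (S.xi g₂)
    rw [l2_sub_comm (S.xi g₁) (Xi g₁)] at h2
    linarith [hrate g₁, hrate g₂, hgr g₁, hgr g₂]
  · intro k j _
    have h1 := hg.abs_grad_single_le hd hreg.bal hreg.surj hreg.s_pos hCx hC1 hM hR hp hu hR'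
      (k := k) (β := Xi (S.grp k)) (hmin _).1 ((hrate _).trans (hnb _)) (hrate _) j
    rw [← hC3] at h1
    refine h1.trans ?_
    have h2 := le_mul_sqrt_div (x := S.logDim) (Nat.cast_nonneg _)
      ((Nat.cast_nonneg _).trans s_le_logDim) hNbar hNbarN hL.ge
    calc _ ≤ C3 * (S.N u * L) := by gcongr
      _ = S.N u * (C3 * L) := by ring
      _ ≤ _ := by gcongr
  · intro k v hv
    have h1 := hg.abs_grad_le hd hC1 hM hR hp hu hR'
      (k := k) (β := Xi (S.grp k)) (hmin _).1 ((hrate _).trans (hnb _)) (hrate _) hv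
    rw [← hC2] at h1
    refine h1.trans ?_
    have h2 := le_mul_sqrt_div (x := S.s) (r := S.rate u) (Nat.cast_nonneg _)
      (Nat.cast_nonneg _) hNbar hNbarN le_rfl
    have h3 := l2_nonneg v
    calc _ ≤ C2 * (S.N u * S.rate u) * l2 v := by gcongr
      _ = S.N u * (C2 * S.rate u) * l2 v := by ring
      _ ≤ _ := by gcongr

/-- At batch `u` the online estimate is a strict local minimizer and equals the oracle estimate, and
the oracle estimates have rate `R`. -/
structure OracleHolds (S : StreamModel.{w} G) (d : ℝ → ℝ) (ρ : ℝ → ℝ → ℝ) (E : S.Estimates)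
    (R : ℝ) (u : ℕ) (ω : S.Ω) : Prop where
  oracle : S.IsOracle d (E.hat ω) u ω (E.orB ω u)
  locMin : IsStrictLocalMin (S.Qon d ρ (E.hat ω) u ω) (E.hat ω u)
  eq : E.hat ω u = E.orB ω u
  rateXi : ∀ g, l2 (E.orXi ω u g - S.xi g) ≤ R * S.grate u g
  rateB : ∀ k, l2 (E.orB ω u k - S.beta k) ≤ R * S.grate u (S.grp k)

/-- On good samples the renewable scheme reproduces the oracle estimates, batch after batch, with a
rate constant that depends on the number of batches but not on the stage of the array. -/
theorem exists_oracleHolds [Nonempty (Fin G)] (b : ℕ) {a γ Cx c1 C1 M : ℝ} (ha : 0 < a)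
    (hCx : 0 ≤ Cx) (hc1 : 0 < c1) (hC1 : 0 ≤ C1) (hM : 0 ≤ M) (u : ℕ) (hub : u ≤ b) :
    ∃ R C : ℝ, 0 ≤ R ∧ 0 ≤ C ∧ ∀ (S : StreamModel.{w} G) (d : ℝ → ℝ) (ρ : ℝ → ℝ → ℝ) (ω : S.Ω)
      (E : S.Estimates), IsPenalty a ρ → IsCumulant d → S.Regime a γ C b →
      S.GoodSample d Cx c1 C1 M b ω → S.IsRenewable d ρ b E →
      S.PastGood R (E.hat ω) (u + 1) ∧ (1 ≤ u → S.OracleHolds d ρ E R u ω) := by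
  induction u with
  | zero =>
    refine ⟨0, 0, le_rfl, le_rfl, fun S d ρ ω E _ _ _ _ _ => ⟨fun v hv => ?_, by omega⟩⟩
    simp at hv
  | succ u ih =>
    obtain ⟨R, C, hR, hC, ih⟩ := ih (by omega)
    obtain ⟨R', C', hR', hC', hstep⟩ :=
      exists_step.{w} (G := G) b (γ := γ) ha hCx hc1 hC1 hM hR
    refine ⟨max R R', max C C', le_max_of_le_left hR, le_max_of_le_left hC, ?_⟩
    intro S d ρ ω E hρ hd hreg hg hE
    have hu : u + 1 ∈ Finset.Icc 1 b := Finset.mem_Icc.2 (by omega)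
    have hpast := (ih S d ρ ω E hρ hd (hreg.mono (le_max_left _ _)) hg hE).1
    obtain ⟨Xi, hmin, huniq, hrate, hloc⟩ := hstep S d ρ ω (E.hat ω) (u + 1) hρ hd
      (hreg.mono (le_max_right _ _)) hg hu hpast
    have hN : 0 < S.N (u + 1) :=
      (Ng_pos hreg.bal hreg.surj hu (Classical.arbitrary _)).trans_le (Ng_le_N _ _)
    have hor := hE.oracle ω (u + 1) hu ⟨_, (isOracle_iff hd hreg.surj hN).2 ⟨Xi, hmin, rfl⟩⟩
    have horXi := hE.oracleXi ω (u + 1) hu ⟨Xi, (isOracleXi_iff hd hN).2 hmin⟩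
    have hBeq : E.orB ω (u + 1) = fun k => Xi (S.grp k) := by
      obtain ⟨Xi', hXi', he⟩ := (isOracle_iff hd hreg.surj hN).1 hor
      rw [he]
      ext1 k
      exact huniq _ _ (hXi' _)
    have hXeq : E.orXi ω (u + 1) = Xi := by
      ext1 g
      exact huniq _ _ ((isOracleXi_iff hd hN).1 horXi g)
    have hhat : E.hat ω (u + 1) = E.orB ω (u + 1) :=
      hE.select ω (u + 1) hu hor (by rw [hBeq]; exact hloc)
    have hrate' : ∀ g, l2 (Xi g - S.xi g) ≤ max R R' * S.grate (u + 1) g := fun g =>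
      (hrate g).1.trans (mul_le_mul_of_nonneg_right (le_max_right _ _) (grate_nonneg _ _))
    refine ⟨fun v hv k => ?_, fun _ => ⟨hor, ?_, hhat, ?_, ?_⟩⟩
    · rcases (Nat.lt_succ_iff.1 (Finset.mem_Ico.1 hv).2).eq_or_lt with rfl | hlt
      · rw [hhat, hBeq]
        exact ⟨(hmin (S.grp k)).1, hrate' (S.grp k), (hrate (S.grp k)).2⟩
      · obtain ⟨h1, h2, h3⟩ := hpast v (Finset.mem_Ico.2 ⟨(Finset.mem_Ico.1 hv).1, hlt⟩) k
        exact ⟨h1, h2.trans (mul_le_mul_of_nonneg_right (le_max_left _ _) (grate_nonneg _ _)), h3⟩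
    · rw [hhat, hBeq]; exact hloc
    · rw [hXeq]; exact hrate'
    · rw [hBeq]; exact fun k => hrate' (S.grp k)

end StreamModel

/-! ### Probability of good samples -/

theorem measure_exists_le_ofReal {Ω ι : Type*} [MeasurableSpace Ω] {μ : Measure Ω} [Fintype ι]
    {A : ι → Ω → Prop} {δ δ' : ℝ} (h : ∀ i, μ {ω | A i ω} ≤ ENNReal.ofReal δ)
    (hδ : Fintype.card ι * δ ≤ δ') : μ {ω | ∃ i, A i ω} ≤ ENNReal.ofReal δ' := by
  rw [Set.ofPred_exists]
  calc μ (⋃ i, {ω | A i ω}) ≤ ∑ i, μ {ω | A i ω} := measure_iUnion_fintype_le _ _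
    _ ≤ ∑ _i : ι, ENNReal.ofReal δ := Finset.sum_le_sum fun i _ => h i
    _ = ENNReal.ofReal (Fintype.card ι * δ) := by
      rw [ENNReal.ofReal_mul (Nat.cast_nonneg _)]; simp
    _ ≤ _ := ENNReal.ofReal_le_ofReal hδ

/-- Markov's inequality for a sum of squares of (possibly dependent) sub-Gaussian variables. -/
theorem measure_sum_sq_gt_le {Ω ι : Type*} [MeasurableSpace Ω] {μ : Measure Ω} [IsProbabilityMeasure μ]
    (t : Finset ι)
    {Z : ι → Ω → ℝ} {v : ι → NNReal} (hv : ∀ i ∈ t, 0 < v i)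
    (hZ : ∀ i ∈ t, HasSubgaussianMGF (Z i) (v i) μ) {T : ℝ} (hT : 0 < T) :
    μ {ω | T < ∑ i ∈ t, Z i ω ^ 2} ≤ ENNReal.ofReal (4 * (∑ i ∈ t, (v i : ℝ)) / T) := by
  have hm : ∀ i ∈ t, AEMeasurable (fun ω => ENNReal.ofReal (Z i ω ^ 2)) μ := fun i hi =>
    ((hZ i hi).aemeasurable.pow_const 2).ennreal_ofReal
  have hle : ∫⁻ ω, ∑ i ∈ t, ENNReal.ofReal (Z i ω ^ 2) ∂μ ≤
      ENNReal.ofReal (4 * ∑ i ∈ t, (v i : ℝ)) := by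
    rw [lintegral_finsetSum' _ hm, Finset.mul_sum,
      ENNReal.ofReal_sum_of_nonneg fun i _ => by positivity]
    exact Finset.sum_le_sum fun i hi => (hZ i hi).lintegral_sq_le (hv i hi)
  have hsub : {ω | T < ∑ i ∈ t, Z i ω ^ 2} ⊆
      {ω | ENNReal.ofReal T ≤ ∑ i ∈ t, ENNReal.ofReal (Z i ω ^ 2)} := fun ω hω => by
    rw [Set.mem_ofPred_eq, ← ENNReal.ofReal_sum_of_nonneg fun i _ => sq_nonneg _]
    exact ENNReal.ofReal_le_ofReal (le_of_lt hω)
  refine (measure_mono hsub).trans ?_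
  refine (meas_ge_le_lintegral_div (Finset.aemeasurable_fun_sum _ hm)
    (ENNReal.ofReal_pos.2 hT).ne' ENNReal.ofReal_ne_top).trans ?_
  rw [ENNReal.ofReal_div_of_pos hT]
  gcongr

namespace StreamModel

variable {G : ℕ} {S : StreamModel.{w} G} {ν : Measure ℝ} {c : ℝ → ℝ → ℝ} {d : ℝ → ℝ} {b : ℕ}

theorem p_pos (hs : 0 < S.s) : 0 < S.p := by
  by_contra h
  have h1 : S.s ≤ 0 := Finset.sup_le fun g _ => by
    have := Finset.card_le_univ (S.A g)
    rw [Fintype.card_fin] at this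
    omega
  omega

theorem card_A_le (g : Fin G) : (S.A g).card ≤ S.s :=
  Finset.le_sup (f := fun g => (S.A g).card) (Finset.mem_univ g)

/-- A probability of the order `exp (-(1 + T) (log (p K) + s))` survives a union bound over all
pairs of a source and a covariate. -/
theorem exp_neg_mul_logDim_le (hs : 0 < S.s) (hK : 0 < S.K) {T : ℝ} (hT : 0 ≤ T) :
    Real.exp (-((1 + T) * S.logDim)) ≤ Real.exp (-T) / (S.p * S.K) := by
  have hp : (0 : ℝ) < S.p := by exact_mod_cast p_pos hs
  have hK' : (0 : ℝ) < S.K := by exact_mod_cast hK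
  have hs' : (1 : ℝ) ≤ S.s := by exact_mod_cast hs
  rw [le_div_iff₀ (by positivity), ← Real.exp_log (show (0 : ℝ) < S.p * S.K by positivity),
    ← Real.exp_add, Real.exp_le_exp, logDim]
  nlinarith [log_mul_nonneg (S := S), mul_nonneg hT (log_mul_nonneg (S := S))]

section

variable (hc : ∀ y φ, 0 ≤ c y φ) (hm : ∀ φ, Measurable fun y => c y φ)
  (hp : ∀ (k : Fin S.K) θ, IsProbabilityMeasure (glmLaw ν c d (S.disp k) θ))

include hc hm hp

variable {κ Cx : ℝ} (hκ : 0 < κ) (ht : S.SubGaussianErrors d κ b) (h : S.IsModel ν c d b)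
  (hCx : 0 < Cx) (hb : ∀ᵐ ω ∂S.P, S.BoundedCov Cx b ω) {u : ℕ} (hu : u ∈ Finset.Icc 1 b)
  (hn : ∀ k, 0 < S.n u k) (hs : 0 < S.s)

include hκ ht h hu hn hs

include hCx hb in
theorem measure_score_gt_le {M T : ℝ} (hM : 0 ≤ M) (hT : 0 ≤ T)
    (hMT : 16 * Cx ^ 2 / κ * (1 + T) ≤ M ^ 2) :
    S.P {ω | ∃ q : Fin S.K × Fin S.p, ¬ |∑ i, S.x u q.1 i ω q.2 * S.err d u q.1 i ω| ≤
      M * Real.sqrt (S.n u q.1 * S.logDim)} ≤ ENNReal.ofReal (2 * Real.exp (-T)) := by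
  rcases Nat.eq_zero_or_pos S.K with hK | hK
  · have : IsEmpty (Fin S.K × Fin S.p) := by
      rw [isEmpty_prod, hK]; exact Or.inl inferInstance
    simp
  have hL : 0 ≤ S.logDim := (Nat.cast_nonneg _).trans s_le_logDim
  have hpp : (0 : ℝ) < S.p := by exact_mod_cast p_pos hs
  have hKK : (0 : ℝ) < S.K := by exact_mod_cast hK
  refine measure_exists_le_ofReal (δ := 2 * (Real.exp (-T) / (S.p * S.K))) (fun q => ?_) ?_
  · have hq := (ht.hasSubgaussianMGF_score hc hm hp hκ h hCx hb hu {q.1} q.2).abs_ge_le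
      (ε := M * Real.sqrt (S.n u q.1 * S.logDim)) (by positivity)
    simp only [Finset.sum_singleton] at hq
    refine (measure_mono fun ω hω => (not_le.1 hω).le).trans (hq.trans ?_)
    refine ENNReal.ofReal_le_ofReal (mul_le_mul_of_nonneg_left ?_ two_pos.le)
    refine le_trans (Real.exp_le_exp.2 ?_) (exp_neg_mul_logDim_le hs hK hT)
    have hn' : (0 : ℝ) < S.n u q.1 := by exact_mod_cast hn q.1
    rw [mul_pow, Real.sq_sqrt (by positivity)]
    push_cast
    rw [Real.coe_toNNReal _ (by positivity), neg_div, neg_le_neg_iff, le_div_iff₀ (by positivity)]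
    calc _ = 16 * Cx ^ 2 / κ * (1 + T) * (S.n u q.1 * S.logDim) := by ring
      _ ≤ _ := by gcongr
  · rw [Fintype.card_prod, Fintype.card_fin, Fintype.card_fin]
    push_cast
    rw [mul_comm (S.K : ℝ)]
    exact le_of_eq (by field_simp)

omit hn in
theorem measure_varSum_gt_le {M T : ℝ} (hT : 0 ≤ T)
    (hMT : 1 / κ + Real.log 3 + 1 + T ≤ κ / 4 * M) :
    S.P {ω | ∃ k, ¬ ∑ i, varSup d (S.x u k i ω ⬝ᵥ S.beta k) ≤ M * (S.n u k + S.logDim)} ≤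
      ENNReal.ofReal (Real.exp (-T)) := by
  rcases Nat.eq_zero_or_pos S.K with hK | hK
  · have : IsEmpty (Fin S.K) := by
      rw [hK]; infer_instance
    simp
  have hL : 0 ≤ S.logDim := (Nat.cast_nonneg _).trans s_le_logDim
  have hp1 : (1 : ℝ) ≤ S.p := by exact_mod_cast p_pos hs
  have hK1 : (0 : ℝ) < S.K := by exact_mod_cast hK
  have hlog : 0 ≤ Real.log 3 := Real.log_nonneg (by norm_num)
  refine measure_exists_le_ofReal (δ := Real.exp (-T) / (S.p * S.K)) (fun k => ?_) ?_
  · refine (measure_mono fun ω hω => (not_le.1 hω).le).trans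
      ((ht.measure_sum_varSup hc hm hp hκ h hu k _).trans ?_)
    refine ENNReal.ofReal_le_ofReal (le_trans ?_ (exp_neg_mul_logDim_le hs hK hT))
    have e : (Real.exp (1 / κ) * 3) ^ S.n u k =
        Real.exp (S.n u k * (1 / κ + Real.log 3)) := by
      rw [Real.exp_nat_mul, Real.exp_add, Real.exp_log (by norm_num)]
    rw [e, ← Real.exp_add, Real.exp_le_exp]
    have h1 : 0 ≤ 1 / κ := by positivity
    have h2 : (1 / κ + Real.log 3 + 1 + T) * (S.n u k + S.logDim) ≤
        κ / 4 * M * (S.n u k + S.logDim) := by gcongr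
    nlinarith [mul_nonneg (add_nonneg h1 hlog) hL,
      mul_nonneg (add_nonneg zero_le_one hT) (Nat.cast_nonneg (α := ℝ) (S.n u k))]
  · rw [Fintype.card_fin, mul_div_assoc', div_le_iff₀ (by positivity)]
    nlinarith [mul_pos hK1 (Real.exp_pos (-T))]

include hCx hb

theorem measure_scoreSq_gt_le {M δ : ℝ} (hM : 0 < M) (hMδ : 32 * Cx ^ 2 / κ ≤ δ * M ^ 2)
    {g : Fin G} (hg : (S.members g).Nonempty) :
    S.P {ω | ¬ ∑ k ∈ S.members g, ∑ j ∈ S.A g, (∑ i, S.x u k i ω j * S.err d u k i ω) ^ 2 ≤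
      M ^ 2 * (S.s * ∑ k ∈ S.members g, (S.n u k : ℝ))} ≤ ENNReal.ofReal δ := by
  have hng : (0 : ℝ) < ∑ k ∈ S.members g, (S.n u k : ℝ) :=
    Finset.sum_pos (fun k _ => by exact_mod_cast hn k) hg
  have hs' : (0 : ℝ) < S.s := by exact_mod_cast hs
  have hv : 0 < 4 * (2 * Cx ^ 2 / κ).toNNReal := by
    have : 0 < (2 * Cx ^ 2 / κ).toNNReal := Real.toNNReal_pos.2 (by positivity)
    positivity
  have key := measure_sum_sq_gt_le (μ := S.P) (S.members g ×ˢ S.A g)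
    (Z := fun q ω => ∑ i, S.x u q.1 i ω q.2 * S.err d u q.1 i ω)
    (v := fun q => 4 * (2 * Cx ^ 2 / κ).toNNReal * (S.n u q.1 : NNReal))
    (fun q _ => mul_pos hv (by exact_mod_cast hn q.1))
    (fun q _ => by
      simpa using ht.hasSubgaussianMGF_score hc hm hp hκ h hCx hb hu {q.1} q.2)
    (T := M ^ 2 * (S.s * ∑ k ∈ S.members g, (S.n u k : ℝ))) (by positivity)
  simp only [Finset.sum_product] at key
  simp only [not_le]
  refine key.trans (ENNReal.ofReal_le_ofReal ?_)
  have hδM : 0 ≤ δ * M ^ 2 := le_trans (by positivity) hMδ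
  have hA : ((S.A g).card : ℝ) ≤ S.s := by exact_mod_cast card_A_le g
  push_cast
  rw [Real.coe_toNNReal _ (by positivity), div_le_iff₀ (by positivity)]
  simp only [Finset.sum_const, nsmul_eq_mul]
  rw [← Finset.mul_sum, ← Finset.mul_sum]
  calc _ = 32 * Cx ^ 2 / κ * ((S.A g).card * ∑ k ∈ S.members g, (S.n u k : ℝ)) := by ring
    _ ≤ δ * M ^ 2 * (S.s * ∑ k ∈ S.members g, (S.n u k : ℝ)) := by gcongr
    _ = _ := by ring

theorem measure_groupScore_gt_le {M δ : ℝ} (hM : 0 < M) (hMδ : 32 * Cx ^ 2 / κ ≤ δ * M ^ 2)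
    {g : Fin G} (hg : (S.members g).Nonempty) :
    S.P {ω | ¬ ∑ j ∈ S.A g, (∑ k ∈ S.members g, ∑ i, S.x u k i ω j * S.err d u k i ω) ^ 2 ≤
      M ^ 2 * (S.s * ∑ k ∈ S.members g, (S.n u k : ℝ))} ≤ ENNReal.ofReal δ := by
  have hng : (0 : ℝ) < ∑ k ∈ S.members g, (S.n u k : ℝ) :=
    Finset.sum_pos (fun k _ => by exact_mod_cast hn k) hg
  have hng' : 0 < ∑ k ∈ S.members g, (S.n u k : NNReal) :=
    Finset.sum_pos (fun k _ => by exact_mod_cast hn k) hg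
  have hs' : (0 : ℝ) < S.s := by exact_mod_cast hs
  have hv : 0 < 4 * (2 * Cx ^ 2 / κ).toNNReal := by
    have : 0 < (2 * Cx ^ 2 / κ).toNNReal := Real.toNNReal_pos.2 (by positivity)
    positivity
  have key := measure_sum_sq_gt_le (μ := S.P) (S.A g)
    (Z := fun j ω => ∑ k ∈ S.members g, ∑ i, S.x u k i ω j * S.err d u k i ω)
    (fun _ _ => mul_pos hv hng')
    (fun j _ => ht.hasSubgaussianMGF_score hc hm hp hκ h hCx hb hu (S.members g) j)
    (T := M ^ 2 * (S.s * ∑ k ∈ S.members g, (S.n u k : ℝ))) (by positivity)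
  simp only [not_le]
  refine key.trans (ENNReal.ofReal_le_ofReal ?_)
  have hδM : 0 ≤ δ * M ^ 2 := le_trans (by positivity) hMδ
  have hA : ((S.A g).card : ℝ) ≤ S.s := by exact_mod_cast card_A_le g
  push_cast
  rw [Real.coe_toNNReal _ (by positivity), div_le_iff₀ (by positivity)]
  simp only [Finset.sum_const, nsmul_eq_mul]
  calc _ = 32 * Cx ^ 2 / κ * ((S.A g).card * ∑ k ∈ S.members g, (S.n u k : ℝ)) := by ring
    _ ≤ δ * M ^ 2 * (S.s * ∑ k ∈ S.members g, (S.n u k : ℝ)) := by gcongr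
    _ = _ := by ring

end

theorem members_nonempty (hs : Function.Surjective S.grp) (g : Fin G) : (S.members g).Nonempty := by
  obtain ⟨k, rfl⟩ := hs g
  exact ⟨k, mem_members.2 rfl⟩

/-- Up to irregular designs, samples are good with probability close to one, at every stage of the
array with a constant `M` that does not depend on the stage. -/
theorem exists_measure_not_goodSample_le (hc : ∀ y φ, 0 ≤ c y φ)
    (hm : ∀ φ, Measurable fun y => c y φ) {κ Cx c1 C1 C2 C3 : ℝ} (hκ : 0 < κ) (hCx : 0 < Cx)
    (hc1 : 0 < c1) (b : ℕ) {ε : ℝ} (hε : 0 < ε) :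
    ∃ M : ℝ, 0 ≤ M ∧ ∀ S : StreamModel.{w} G, Function.Surjective S.grp →
      (∀ k θ, IsProbabilityMeasure (glmLaw ν c d (S.disp k) θ)) → S.IsModel ν c d b →
      S.SubGaussianErrors d κ b → (∀ᵐ ω ∂S.P, S.BoundedCov Cx b ω) →
      (∀ u ∈ Finset.Icc 1 b, ∀ k, 0 < S.n u k) → 0 < S.s → 0 < S.d1 →
      S.P {ω | ¬ S.GoodSample d Cx c1 C1 M b ω} ≤
        S.P {ω | ¬ S.RegularDesign d Cx c1 C1 C2 C3 b ω} + ENNReal.ofReal ε := by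
  -- each batch fails with probability at most `2 δ` for the scores, `δ` for the variance functions,
  -- and `δ` per subgroup for each of the two squared norms
  obtain ⟨δ, hδ, hδε⟩ : ∃ δ : ℝ, 0 < δ ∧ b * (3 * δ + 2 * (G * δ)) ≤ ε := by
    refine ⟨ε / (b * (3 + 2 * G) + 1), by positivity, ?_⟩
    rw [show b * (3 * (ε / (b * (3 + 2 * G) + 1)) + 2 * (G * (ε / (b * (3 + 2 * G) + 1)))) =
      (b * (3 + 2 * G)) * ε / (b * (3 + 2 * G) + 1) by ring, div_le_iff₀ (by positivity)]
    nlinarith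
  obtain ⟨T, hT⟩ : ∃ T, T = 1 / δ := ⟨_, rfl⟩
  have hT0 : 0 < T := hT ▸ by positivity
  have hTδ : Real.exp (-T) ≤ δ := by
    rw [Real.exp_neg, inv_le_comm₀ (Real.exp_pos _) hδ, ← one_div, ← hT]
    linarith [Real.add_one_le_exp T]
  have hlog : 0 ≤ Real.log 3 := Real.log_nonneg (by norm_num)
  -- `M ≥ 1`, so that the lower bounds for `M` are also lower bounds for `M ^ 2`
  obtain ⟨M, hM⟩ : ∃ M, M = 1 + 16 * Cx ^ 2 / κ * (1 + T) + 32 * Cx ^ 2 / κ * T +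
      4 / κ * (1 / κ + Real.log 3 + 1 + T) := ⟨_, rfl⟩
  have t1 : 0 ≤ 16 * Cx ^ 2 / κ * (1 + T) := by positivity
  have t2 : 0 ≤ 32 * Cx ^ 2 / κ * T := by positivity
  have t3 : 0 ≤ 4 / κ * (1 / κ + Real.log 3 + 1 + T) := by positivity
  have hM1 : 1 ≤ M := by linarith
  have hM0 : 0 < M := by linarith
  have hMM : M ≤ M ^ 2 := by nlinarith
  have q1 : 16 * Cx ^ 2 / κ * (1 + T) ≤ M ^ 2 := by linarith
  have q2 : 1 / κ + Real.log 3 + 1 + T ≤ κ / 4 * M := by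
    have : κ / 4 * (4 / κ * (1 / κ + Real.log 3 + 1 + T)) = 1 / κ + Real.log 3 + 1 + T := by
      field_simp
    rw [← this]
    gcongr
    linarith
  have q3 : 32 * Cx ^ 2 / κ ≤ δ * M ^ 2 := by
    have h1 : 32 * Cx ^ 2 / κ * T ≤ M ^ 2 := by linarith
    calc 32 * Cx ^ 2 / κ = δ * (32 * Cx ^ 2 / κ * T) := by rw [hT]; field_simp
      _ ≤ _ := by gcongr
  refine ⟨M, hM0.le, fun S hsurj hp h ht hb hn hs hd1 => ?_⟩
  set E1 : Finset.Icc 1 b → S.Ω → Prop := fun u ω => ∃ q : Fin S.K × Fin S.p,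
    ¬ |∑ i, S.x u q.1 i ω q.2 * S.err d u q.1 i ω| ≤ M * Real.sqrt (S.n u q.1 * S.logDim) with hE1
  set E2 : Finset.Icc 1 b → S.Ω → Prop := fun u ω => ∃ k,
    ¬ ∑ i, varSup d (S.x u k i ω ⬝ᵥ S.beta k) ≤ M * (S.n u k + S.logDim) with hE2
  set E3 : Finset.Icc 1 b → S.Ω → Prop := fun u ω => ∃ g,
    ¬ ∑ k ∈ S.members g, ∑ j ∈ S.A g, (∑ i, S.x u k i ω j * S.err d u k i ω) ^ 2 ≤
      M ^ 2 * (S.s * ∑ k ∈ S.members g, (S.n u k : ℝ)) with hE3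
  set E4 : Finset.Icc 1 b → S.Ω → Prop := fun u ω => ∃ g,
    ¬ ∑ j ∈ S.A g, (∑ k ∈ S.members g, ∑ i, S.x u k i ω j * S.err d u k i ω) ^ 2 ≤
      M ^ 2 * (S.s * ∑ k ∈ S.members g, (S.n u k : ℝ)) with hE4
  have hsub : {ω | ¬ S.GoodSample d Cx c1 C1 M b ω} ⊆
      ({ω | ¬ S.RegularDesign d Cx c1 C1 C2 C3 b ω} ∪ {ω | ¬ S.BoundedCov Cx b ω}) ∪
        {ω | ∃ u, ((E1 u ω ∨ E2 u ω) ∨ E3 u ω) ∨ E4 u ω} := by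
    intro ω hω
    by_contra hcon
    simp only [Set.mem_union, Set.mem_ofPred_eq, not_or, not_not, not_exists, hE1, hE2, hE3,
      hE4] at hcon
    obtain ⟨⟨hreg, hbd⟩, hE⟩ := hcon
    refine hω
      { bdd := hbd
        formMin := fun u hu k β hβ hβ' a ha => hreg.formMin hu k hβ hβ' ha
        formMax := fun u hu k β hβ hβ' a ha => hreg.formMax hu k hβ hβ' ha
        card_le := fun u hu k => hreg.card_le hc1 hd1 hu k (hn u hu k)
        score := fun u hu k j => (hE ⟨u, hu⟩).1.1.1 (k, j)
        scoreSq := fun u hu k => ?_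
        groupScore := fun u hu g => (hE ⟨u, hu⟩).2 g
        varSum := fun u hu k => (hE ⟨u, hu⟩).1.1.2 k }
    refine le_trans ?_ ((hE ⟨u, hu⟩).1.2 (S.grp k))
    exact Finset.single_le_sum (f := fun k' => ∑ j ∈ S.A (S.grp k),
      (∑ i, S.x u k' i ω j * S.err d u k' i ω) ^ 2)
      (fun _ _ => Finset.sum_nonneg fun _ _ => sq_nonneg _) (mem_members.2 rfl)
  have hbd0 : S.P {ω | ¬ S.BoundedCov Cx b ω} = 0 := hb
  have hG : ∀ u : Finset.Icc 1 b,
      S.P {ω | ((E1 u ω ∨ E2 u ω) ∨ E3 u ω) ∨ E4 u ω} ≤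
        ENNReal.ofReal (3 * δ + 2 * (G * δ)) := by
    intro u
    have p1 : S.P {ω | E1 u ω} ≤ ENNReal.ofReal (2 * δ) :=
      (measure_score_gt_le hc hm hp hκ ht h hCx hb u.2 (hn u u.2) hs hM0.le hT0.le q1).trans
        (ENNReal.ofReal_le_ofReal (by linarith))
    have p2 : S.P {ω | E2 u ω} ≤ ENNReal.ofReal δ :=
      (measure_varSum_gt_le hc hm hp hκ ht h u.2 hs hT0.le q2).trans
        (ENNReal.ofReal_le_ofReal hTδ)
    have p3 : S.P {ω | E3 u ω} ≤ ENNReal.ofReal (G * δ) :=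
      measure_exists_le_ofReal (fun g => measure_scoreSq_gt_le hc hm hp hκ ht h hCx hb u.2
        (hn u u.2) hs hM0 q3 (members_nonempty hsurj g)) (by rw [Fintype.card_fin])
    have p4 : S.P {ω | E4 u ω} ≤ ENNReal.ofReal (G * δ) :=
      measure_exists_le_ofReal (fun g => measure_groupScore_gt_le hc hm hp hκ ht h hCx hb u.2
        (hn u u.2) hs hM0 q3 (members_nonempty hsurj g)) (by rw [Fintype.card_fin])
    have hGδ : 0 ≤ (G : ℝ) * δ := by positivity
    calc _ ≤ S.P {ω | E1 u ω} + S.P {ω | E2 u ω} + S.P {ω | E3 u ω} + S.P {ω | E4 u ω} :=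
          (measure_union_le _ _).trans (add_le_add_left ((measure_union_le _ _).trans
            (add_le_add_left (measure_union_le _ _) _)) _)
      _ ≤ ENNReal.ofReal (2 * δ) + ENNReal.ofReal δ + ENNReal.ofReal (G * δ) +
          ENNReal.ofReal (G * δ) := by gcongr
      _ = _ := by
        rw [← ENNReal.ofReal_add (by positivity) hδ.le, ← ENNReal.ofReal_add (by positivity) hGδ,
          ← ENNReal.ofReal_add (by positivity) hGδ]
        ring_nf
  refine (measure_mono hsub).trans ((measure_union_le _ _).trans ?_)
  refine add_le_add ((measure_union_le _ _).trans (by rw [hbd0, add_zero])) ?_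
  refine measure_exists_le_ofReal hG ?_
  simpa using hδε

end StreamModel

/-! ### Existence of renewable estimates -/

namespace StreamModel

variable {G : ℕ} {S : StreamModel.{w} G}

/-- The loss at batch `u` only involves the estimates of the earlier batches. -/
theorem approxLik_congr {d : ℝ → ℝ} {Bh Bh' : ℕ → Fin S.K → Fin S.p → ℝ} {u : ℕ} (hu : 1 ≤ u)
    (h : ∀ v < u, Bh v = Bh' v) (k : Fin S.K) (ω : S.Ω) :
    S.approxLik d Bh u k ω = S.approxLik d Bh' u k ω := by
  have h1 : S.accHess d Bh u k ω = S.accHess d Bh' u k ω :=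
    Finset.sum_congr rfl fun v hv => by rw [h v (Finset.mem_Ico.1 hv).2]
  ext β
  rw [approxLik, approxLik, h1, h (u - 1) (by omega)]

theorem loss_congr {d : ℝ → ℝ} {Bh Bh' : ℕ → Fin S.K → Fin S.p → ℝ} {u : ℕ} (hu : 1 ≤ u)
    (h : ∀ v < u, Bh v = Bh' v) (ω : S.Ω) : S.loss d Bh u ω = S.loss d Bh' u ω := by
  ext B
  simp only [loss, approxLik_congr hu h]

theorem lossOr_congr {d : ℝ → ℝ} {Bh Bh' : ℕ → Fin S.K → Fin S.p → ℝ} {u : ℕ} (hu : 1 ≤ u)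
    (h : ∀ v < u, Bh v = Bh' v) (ω : S.Ω) : S.lossOr d Bh u ω = S.lossOr d Bh' u ω := by
  ext B
  simp only [lossOr, approxLik_congr hu h]

theorem Qon_congr {d : ℝ → ℝ} {ρ : ℝ → ℝ → ℝ} {Bh Bh' : ℕ → Fin S.K → Fin S.p → ℝ} {u : ℕ}
    (hu : 1 ≤ u) (h : ∀ v < u, Bh v = Bh' v) (ω : S.Ω) :
    S.Qon d ρ Bh u ω = S.Qon d ρ Bh' u ω := by
  ext B
  simp only [Qon, loss_congr hu h]

/-- The sequence of estimates obtained by a rule `f` that turns the estimates of the earlier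
batches into that of the current batch. -/
theorem exists_renewable_seq {α : Type*} [Inhabited α] (f : (ℕ → α) → ℕ → α) :
    ∃ x : ℕ → α, ∀ u, ∃ y : ℕ → α, (∀ v < u, x v = y v) ∧ x u = f y u := by
  let hist : ℕ → ℕ → α := fun u => Nat.rec (fun _ => default)
    (fun u y => Function.update y u (f y u)) u
  have hs : ∀ u, hist (u + 1) = Function.update (hist u) u (f (hist u) u) := fun _ => rfl
  have hstable : ∀ u v, v < u → hist u v = hist (v + 1) v := by
    intro u
    induction u with
    | zero => intro v hv; omega
    | succ u ih =>
      intro v hv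
      rcases (Nat.lt_succ_iff.1 hv).eq_or_lt with rfl | hlt
      · rfl
      · rw [hs u, Function.update_of_ne hlt.ne, ih v hlt]
  refine ⟨fun u => hist (u + 1) u, fun u => ⟨hist u, fun v hv => (hstable u v hv).symm, ?_⟩⟩
  simp [hs u]

variable (S) in
theorem exists_isRenewable (d : ℝ → ℝ) (ρ : ℝ → ℝ → ℝ) (b : ℕ) :
    ∃ E : S.Estimates, S.IsRenewable d ρ b E := by
  classical
  have hB : ∀ Bh u ω, ∃ B, (∃ B, S.IsOracle d Bh u ω B) → S.IsOracle d Bh u ω B := by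
    intro Bh u ω
    by_cases h : ∃ B, S.IsOracle d Bh u ω B
    · exact ⟨h.choose, fun _ => h.choose_spec⟩
    · exact ⟨0, fun h' => absurd h' h⟩
  have hXi : ∀ Bh u ω, ∃ Xi, (∃ Xi, S.IsOracleXi d Bh u ω Xi) → S.IsOracleXi d Bh u ω Xi := by
    intro Bh u ω
    by_cases h : ∃ Xi, S.IsOracleXi d Bh u ω Xi
    · exact ⟨h.choose, fun _ => h.choose_spec⟩
    · exact ⟨0, fun h' => absurd h' h⟩
  choose fB hfB using hB
  choose fXi hfXi using hXi
  have hH : ∀ ω Bh u, ∃ H, ((∃ B, IsStrictLocalMin (S.Qon d ρ Bh u ω) B) →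
      IsStrictLocalMin (S.Qon d ρ Bh u ω) H) ∧
      (S.IsOracle d Bh u ω (fB Bh u ω) → IsStrictLocalMin (S.Qon d ρ Bh u ω) (fB Bh u ω) →
        H = fB Bh u ω) := by
    intro ω Bh u
    by_cases h1 : IsStrictLocalMin (S.Qon d ρ Bh u ω) (fB Bh u ω)
    · exact ⟨fB Bh u ω, fun _ => h1, fun _ _ => rfl⟩
    · by_cases h : ∃ B, IsStrictLocalMin (S.Qon d ρ Bh u ω) B
      · exact ⟨h.choose, fun _ => h.choose_spec, fun _ h' => absurd h' h1⟩
      · exact ⟨0, fun h' => absurd h' h, fun _ h' => absurd h' h1⟩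
  choose fH hfH hfH' using hH
  choose hat y hy hyf using fun ω => exists_renewable_seq (fH ω)
  refine ⟨⟨hat, fun ω u => fB (y ω u) u ω, fun ω u => fXi (y ω u) u ω⟩, ?_, ?_, ?_, ?_⟩
  · intro ω u hu
    have e := loss_congr (d := d) (Finset.mem_Icc.1 hu).1 (hy ω u) ω
    simp only [IsOracle, e]
    exact hfB (y ω u) u ω
  · intro ω u hu
    have e := lossOr_congr (d := d) (Finset.mem_Icc.1 hu).1 (hy ω u) ω
    simp only [IsOracleXi, e]
    exact hfXi (y ω u) u ω
  · intro ω u hu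
    have e := Qon_congr (d := d) (ρ := ρ) (Finset.mem_Icc.1 hu).1 (hy ω u) ω
    simp only [e, hyf]
    exact hfH ω (y ω u) u
  · intro ω u hu
    have e := loss_congr (d := d) (Finset.mem_Icc.1 hu).1 (hy ω u) ω
    have e' := Qon_congr (d := d) (ρ := ρ) (Finset.mem_Icc.1 hu).1 (hy ω u) ω
    simp only [IsOracle, e, e', hyf]
    exact hfH' ω (y ω u) u

/-! ### Asymptotics -/

theorem l2_restrict_le {ι : Type*} [Fintype ι] (A : Finset ι) (v : ι → ℝ) :
    l2 (fun j : A => v j) ≤ l2 v := by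
  refine Real.sqrt_le_sqrt ?_
  rw [Finset.sum_coe_sort A fun j => v j ^ 2]
  exact Finset.sum_le_sum_of_subset_of_nonneg (Finset.subset_univ _) fun _ _ _ => sq_nonneg _

theorem s_pos_of_d1_pos (h : 0 < S.d1) : 0 < S.s := by
  by_contra hs
  have hA : ∀ g, S.A g = ∅ := fun g => by
    have := card_A_le (S := S) g
    exact Finset.card_eq_zero.1 (by omega)
  have : S.d1 = 0 := by simp [d1, hA]
  linarith

theorem OracleHolds.mono {d : ℝ → ℝ} {ρ : ℝ → ℝ → ℝ} {E : S.Estimates} {R R' : ℝ} {u : ℕ} {ω : S.Ω}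
    (h : S.OracleHolds d ρ E R u ω) (hR : R ≤ R') : S.OracleHolds d ρ E R' u ω where
  oracle := h.oracle
  locMin := h.locMin
  eq := h.eq
  rateXi g := (h.rateXi g).trans (mul_le_mul_of_nonneg_right hR (grate_nonneg _ _))
  rateB k := (h.rateB k).trans (mul_le_mul_of_nonneg_right hR (grate_nonneg _ _))

theorem OracleHolds.errXi_le [Nonempty (Fin G)] {d : ℝ → ℝ} {ρ : ℝ → ℝ → ℝ} {E : S.Estimates}
    {R γ : ℝ} {b u : ℕ} {ω : S.Ω} (h : S.OracleHolds d ρ E R u ω) (hR : 0 ≤ R)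
    (hb : S.Balanced γ b) (hs : Function.Surjective S.grp) (hu : u ∈ Finset.Icc 1 b) :
    |S.errXi E u ω| ≤ R * S.rate u := by
  rw [errXi, abs_of_nonneg (Real.iSup_nonneg fun g => l2_nonneg _)]
  refine Real.iSup_le (fun g => ?_) (mul_nonneg hR (Real.sqrt_nonneg _))
  exact (l2_restrict_le (S.A g) (E.orXi ω u g - S.xi g)).trans ((h.rateXi g).trans
    (mul_le_mul_of_nonneg_left (grate_le_rate hb hs hu g) hR))

theorem OracleHolds.errB_le [Nonempty (Fin G)] {d : ℝ → ℝ} {ρ : ℝ → ℝ → ℝ} {E : S.Estimates}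
    {R γ : ℝ} {b u : ℕ} {ω : S.Ω} (h : S.OracleHolds d ρ E R u ω) (hR : 0 ≤ R)
    (hb : S.Balanced γ b) (hs : Function.Surjective S.grp) (hu : u ∈ Finset.Icc 1 b) :
    |S.errB E u ω| ≤ R * S.rate u := by
  rw [errB, abs_of_nonneg (Real.iSup_nonneg fun g => l2_nonneg _)]
  refine Real.iSup_le (fun k => ?_) (mul_nonneg hR (Real.sqrt_nonneg _))
  exact (l2_restrict_le (S.suppB k) (E.orB ω u k - S.beta k)).trans ((h.rateB k).trans
    (mul_le_mul_of_nonneg_left (grate_le_rate hb hs hu _) hR))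

theorem eventually_regime {S : ℕ → StreamModel.{w} G} {a cn Cn : ℝ} {b : ℕ} (hb : 1 ≤ b)
    (ha : 0 < a) (hgrp : ∀ m, Function.Surjective (S m).grp) {nstar : ℕ → ℕ → ℝ}
    (hnstar : ∀ u ∈ Finset.Icc 1 b, Tendsto (nstar u) atTop atTop)
    (hcn : 0 < cn) (hCn : 0 < Cn)
    (hn : ∀ m, ∀ u ∈ Finset.Icc 1 b, ∀ k,
      cn * nstar u m ≤ ((S m).n u k : ℝ) ∧ ((S m).n u k : ℝ) ≤ Cn * nstar u m)
    (hlam : ∀ m, ∀ u ∈ Finset.Icc 1 b, 0 < (S m).lam1 u ∧ 0 < (S m).lam2 u)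
    (hd1 : ∀ m, ∀ u ∈ Finset.Icc 1 b, 2 * a * (S m).lam1 u < (S m).d1)
    (hd2 : ∀ m, ∀ u ∈ Finset.Icc 1 b, 2 * a * (S m).lam2 u < (S m).d2)
    (hlam1 : ∀ u ∈ Finset.Icc 1 b,
      (fun m => Real.sqrt ((Real.log ((S m).p * (S m).K) + (S m).s) / (S m).Nbar u))
        =o[atTop] fun m => (S m).lam1 u)
    (hlam2 : ∀ u ∈ Finset.Icc 1 b,
      (fun m => (S m).rate u) =o[atTop] fun m => (S m).lam2 u) (C : ℝ) :
    ∀ᶠ m in atTop, (S m).Regime a (Cn / cn) C b := by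
  have slack : ∀ (r l : ℕ → ℝ), (∀ m, 0 ≤ r m) → (∀ m, 0 < l m) → r =o[atTop] l →
      ∀ᶠ m in atTop, C * r m ≤ l m := by
    intro r l hr hl h
    filter_upwards [h.bound (inv_pos.2 (show 0 < max C 1 by positivity))] with m hm
    rw [Real.norm_of_nonneg (hr m), Real.norm_of_nonneg (hl m).le,
      le_inv_mul_iff₀ (by positivity)] at hm
    exact (mul_le_mul_of_nonneg_right (le_max_left _ _) (hr m)).trans hm
  have h1 := (Finset.eventually_all (Finset.Icc 1 b)).2 fun u hu =>
    slack _ _ (fun m => Real.sqrt_nonneg _) (fun m => (hlam m u hu).1) (hlam1 u hu)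
  have h2 := (Finset.eventually_all (Finset.Icc 1 b)).2 fun u hu =>
    slack _ _ (fun m => Real.sqrt_nonneg _) (fun m => (hlam m u hu).2) (hlam2 u hu)
  have h3 := (Finset.eventually_all (Finset.Icc 1 b)).2 fun u hu =>
    (hnstar u hu).eventually_gt_atTop 0
  filter_upwards [h1, h2, h3] with m m1 m2 m3
  refine ⟨hgrp m, ⟨fun u hu k => ?_, fun u hu k k' => ?_⟩, ?_, hlam m, hd1 m, hd2 m, m1, m2⟩
  · have := (hn m u hu k).1
    have h4 := mul_pos hcn (m3 u hu)
    exact_mod_cast h4.trans_le this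
  · rw [div_mul_eq_mul_div, le_div_iff₀ hcn]
    have h5 := (hn m u hu k).2
    have h6 := (hn m u hu k').1
    nlinarith
  · have hu : 1 ∈ Finset.Icc 1 b := Finset.mem_Icc.2 ⟨le_rfl, hb⟩
    exact s_pos_of_d1_pos (lt_trans (by have := (hlam m 1 hu).1; positivity) (hd1 m 1 hu))

end StreamModel

end

theorem theorem2
    {G : ℕ} (hG : 2 ≤ G) (b : ℕ) (hb : 2 ≤ b)
    -- the exponential family, the penalty
    (ν : Measure ℝ) [SigmaFinite ν] (c : ℝ → ℝ → ℝ) (d : ℝ → ℝ)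
    (hc_nonneg : ∀ y φ, 0 ≤ c y φ) (hc_meas : ∀ φ, Measurable fun y => c y φ)
    (a : ℝ) (ha : 0 < a) (ρ : ℝ → ℝ → ℝ) (hρ : IsPenalty a ρ)
    -- the sequence of models, with nonempty subgroups
    (S : ℕ → StreamModel.{w} G) (hgrp : ∀ m, Function.Surjective (S m).grp)
    (hdens : ∀ m k θ, IsProbabilityMeasure (glmLaw ν c d ((S m).disp k) θ))
    (hmodel : ∀ m, (S m).IsModel ν c d b)
    -- diverging batch sizes of the same order in all sources
    (nstar : ℕ → ℕ → ℝ) (hnstar : ∀ u ∈ Finset.Icc 1 b, Tendsto (nstar u) atTop atTop)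
    (cn Cn : ℝ) (hcn : 0 < cn) (hCn : 0 < Cn)
    (hn : ∀ m, ∀ u ∈ Finset.Icc 1 b, ∀ k,
      cn * nstar u m ≤ ((S m).n u k : ℝ) ∧ ((S m).n u k : ℝ) ≤ Cn * nstar u m)
    -- minimal signals and tuning parameters
    (hlam : ∀ m, ∀ u ∈ Finset.Icc 1 b, 0 < (S m).lam1 u ∧ 0 < (S m).lam2 u)
    (hd1 : ∀ m, ∀ u ∈ Finset.Icc 1 b, 2 * a * (S m).lam1 u < (S m).d1)
    (hd2 : ∀ m, ∀ u ∈ Finset.Icc 1 b, 2 * a * (S m).lam2 u < (S m).d2)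
    (hlam1 : ∀ u ∈ Finset.Icc 1 b,
      (fun m => Real.sqrt ((Real.log ((S m).p * (S m).K) + (S m).s) / (S m).Nbar u))
        =o[atTop] fun m => (S m).lam1 u)
    (hlam2 : ∀ u ∈ Finset.Icc 1 b,
      (fun m => (S m).rate u) =o[atTop] fun m => (S m).lam2 u)
    -- design matrices and errors
    (Cx c1 C1 C2 C3 κ : ℝ) (hCx : 0 < Cx) (hc1 : 0 < c1) (hC1 : 0 < C1) (hC2 : 0 < C2)
    (hC3 : 0 < C3) (hκ : 0 < κ)
    (hbdd : ∀ m, ∀ᵐ ω ∂(S m).P, (S m).BoundedCov Cx b ω)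
    (hdesign : WithProbTendingToOne (fun m => (S m).P)
      fun m ω => (S m).RegularDesign d Cx c1 C1 C2 C3 b ω)
    (htail : ∀ m, (S m).SubGaussianErrors d κ b) :
    -- renewable estimates exist
    (∀ m, ∃ E : (S m).Estimates, (S m).IsRenewable d ρ b E) ∧
    ∀ E : ∀ m, (S m).Estimates, (∀ m, (S m).IsRenewable d ρ b (E m)) →
      -- rates of the oracle estimates
      IsBigOp (fun m => (S m).P) (fun m => (S m).errXi (E m) b) (fun m => (S m).rate b) ∧
      IsBigOp (fun m => (S m).P) (fun m => (S m).errB (E m) b) (fun m => (S m).rate b) ∧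
      -- the online estimate is a strict local minimizer equal to the oracle estimate
      WithProbTendingToOne (fun m => (S m).P) (fun m ω =>
        (S m).IsOracle d ((E m).hat ω) b ω ((E m).orB ω b) ∧
        IsStrictLocalMin ((S m).Qon d ρ ((E m).hat ω) b ω) ((E m).hat ω b) ∧
        (E m).hat ω b = (E m).orB ω b) := by
  have : Nonempty (Fin G) := ⟨⟨0, by omega⟩⟩
  have hb1 : b ∈ Finset.Icc 1 b := Finset.mem_Icc.2 ⟨by omega, le_rfl⟩
  have hd : IsCumulant d := by
    obtain ⟨k, -⟩ := hgrp 0 ⟨0, by omega⟩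
    exact isCumulant_of_glmLaw hc_nonneg hc_meas (hdens 0 k)
  refine ⟨fun m => (S m).exists_isRenewable d ρ b, fun E hE => ?_⟩
  have hreg : ∀ C, ∀ᶠ m in atTop, (S m).Regime a (Cn / cn) C b := fun C =>
    StreamModel.eventually_regime (by omega) ha hgrp hnstar hcn hCn hn hlam hd1 hd2 hlam1 hlam2 C
  have key : ∀ ε : ℝ, 0 < ε → ∃ R : ℝ, 0 < R ∧ ∀ᶠ m in atTop, (S m).Balanced (Cn / cn) b ∧
      (S m).P {ω | ¬ (S m).OracleHolds d ρ (E m) R b ω} ≤ ENNReal.ofReal ε := by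
    intro ε hε
    obtain ⟨M, hM, hgood⟩ := StreamModel.exists_measure_not_goodSample_le.{w} (G := G) (ν := ν)
      (d := d) (C1 := C1) (C2 := C2) (C3 := C3) hc_nonneg hc_meas hκ hCx hc1 b (half_pos hε)
    obtain ⟨R, C, hR, hC, hor⟩ := StreamModel.exists_oracleHolds.{w} (G := G) b (γ := Cn / cn) ha
      hCx.le hc1 hC1.le hM b le_rfl
    refine ⟨R + 1, by linarith, ?_⟩
    filter_upwards [hreg C, ENNReal.tendsto_nhds_zero.1 hdesign (ENNReal.ofReal (ε / 2))
      (ENNReal.ofReal_pos.2 (half_pos hε))] with m h1 h2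
    refine ⟨h1.bal, ?_⟩
    have hu1 : 1 ∈ Finset.Icc 1 b := Finset.mem_Icc.2 ⟨le_rfl, by omega⟩
    have hd1' : 0 < (S m).d1 :=
      lt_trans (by have := (hlam m 1 hu1).1; positivity) (hd1 m 1 hu1)
    calc _ ≤ (S m).P {ω | ¬ (S m).GoodSample d Cx c1 C1 M b ω} := by
          refine measure_mono fun ω hω hω' => hω ?_
          have h3 := (hor (S m) d ρ ω (E m) hρ hd h1 hω' (hE m)).2 (by omega)
          exact h3.mono (by linarith)
      _ ≤ _ := hgood (S m) (hgrp m) (hdens m) (hmodel m) (htail m) (hbdd m) h1.bal.pos h1.s_pos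
          hd1'
      _ ≤ ENNReal.ofReal (ε / 2) + ENNReal.ofReal (ε / 2) := by gcongr
      _ = ENNReal.ofReal ε := by
        rw [← ENNReal.ofReal_add (by positivity) (by positivity), add_halves]
  refine ⟨fun ε hε => ?_, fun ε hε => ?_, ?_⟩
  · obtain ⟨R, hR, h⟩ := key ε hε
    refine ⟨R, hR, h.mono fun m hm => le_trans (measure_mono fun ω hω => ?_) hm.2⟩
    exact fun hω' => hω (hω'.errXi_le hR.le hm.1 (hgrp m) hb1)
  · obtain ⟨R, hR, h⟩ := key ε hε
    refine ⟨R, hR, h.mono fun m hm => le_trans (measure_mono fun ω hω => ?_) hm.2⟩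
    exact fun hω' => hω (hω'.errB_le hR.le hm.1 (hgrp m) hb1)
  · refine ENNReal.tendsto_nhds_zero.2 fun ε hε => ?_
    obtain ⟨δ, hδ, hδε⟩ := ENNReal.lt_iff_exists_nnreal_btwn.1 hε
    obtain ⟨R, hR, h⟩ := key δ (by exact_mod_cast hδ)
    filter_upwards [h] with m hm
    refine le_trans (measure_mono fun ω hω => ?_) (hm.2.trans ?_)
    · exact fun hω' => hω ⟨hω'.oracle, hω'.locMin, hω'.eq⟩
    · rw [ENNReal.ofReal_coe_nnreal]; exact hδε.le
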